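/- **Setting.** Let $\Theta_0\in(0,1)$ be the de Gennes constant, i.e. $\Theta_0=\inf_{\xi\in\mathbb R}\lambda_1\big(-\tfrac{d^2}{dt^2}+(t-\xi)^2\big)$ with Neumann condition on $(0,\infty)$, and $\delta_0=\frac{1-\Theta_0}{2}$. For $B,R,h>0$ and $m\in\mathbb Z$ let $\mathscr L_{h,m}$ be the self-adjoint operator $$\mathscr L_{h,m}=-\frac{h^2}{r}\partial_r r\partial_r+\frac1{r^2}\Big(hm-\frac{Br^2}{2}\Big)^2\quad\text{in } L^2((R,\infty),r\,dr)$$ with Neumann condition at $r=R$ (the part of angular momentum $m$ of the magnetic Neumann Laplacian $(-ih\nabla-\frac B2(-x_2,x_1))^2$ in $\{|x|>R\}\subset\mathbb R^2$). Fix $e_0\in(-\frac12,\frac12]$ and a real $C_2$ (in particular $C_2$ may be the universal constant of the spectral asymptotics), and put $\xi_h=\frac{BR^2}{2h}+\sqrt{\frac{\Theta_0BR^2}{h}}+C_2$. Let $h\to0^+$ along a sequence with integers $m_-=m_-(h)$ such that $\xi_h-m_-\to e_0$, and $m_+=m_-+1$. Let $\Phi^\pm$ be $L^2(\{|x|>R\})$-normalised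 functions such that $e^{-im_\pm\theta}\Phi^\pm$ is the ground state of $\mathscr L_{h,m_\pm}$. **Lemma.** There are a universal constant $K_0>0$ and a universal function $v:(0,\infty)\to(0,\infty)$ of class $C^2$ solving $$-v''(t)+2(t-\sqrt{\Theta_0})v'(t)+v(t)=\Theta_0v(t)$$ such that the following holds for all $B,R>0$, all such sequences and each sign $\pm$. After multiplication of $\Phi^\pm$ by a constant of modulus one (depending on $h$), for $h$ small enough along the sequence, $$\Phi^\pm(r,\theta)=\Big(\frac{BR^2}{h}\Big)^{\frac{\Theta_0}{4}}\Big(\frac{re^{i\theta}}{R}\Big)^{m_\pm}e^{-\frac{B}{4h}(r^2-R^2)}u_h(r)\qquad(r\ge R),$$ where $u_h$ is analytic on $\{r\in\mathbb C:\mathrm{Re}(r^2)>0\}$ and real on the real points of this set, and is bounded on each compact subset of $\{\mathrm{Re}(r^2)>R^2\}$ uniformly in small $h$. Moreover: 1. For $r\in\mathbb C$ with $\mathrm{Re}(r^2)>R^2$, $$u_h(r)=\frac{K_0\Gamma(\delta_0)}{R}\Big(\frac{2R^2}{r^2-R^2}\Big)^{\delta_0}(1+o(1)),$$ where $o(1)\to0$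 as $h\to0$ and $\frac{h^{1/2}}{|r^2-R^2|}\to0$, uniformly for $r$ in bounded sets (so in particular for each fixed $r$ as $h\to 0$); the power is the principal branch. 2. For each $t>0$, as $h\to0$, $$u_h\Big(R+t\sqrt{\tfrac hB}\Big)=\frac{K_0v(t)}{R}\Big(\frac{h}{BR^2}\Big)^{\frac{\Theta_0-1}{4}}(1+o(1)).$$ 3. For each $t>0$, as $h\to0$, $$\partial_ru_h\Big(R+t\sqrt{\tfrac hB}\Big)=\frac{K_0v'(t)}{R^2}\Big(\frac{h}{BR^2}\Big)^{\frac{\Theta_0-3}{4}}(1+o(1)).$$ -/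

import Mathlib

open Filter Topology MeasureTheory Set Asymptotics

noncomputable section

/-- The de Gennes constant `Θ₀`: the infimum over `ξ ∈ ℝ` of the ground state energy of the Neumann
realisation of `-d²/dt² + (t - ξ)²` on the half line `(0, ∞)`. The test functions are the
restrictions to the half line of smooth compactly supported functions on `ℝ` (a form core). -/
def deGennesConst : ℝ :=
  sInf {E : ℝ | ∃ (ξ : ℝ) (φ : ℝ → ℝ), ContDiff ℝ (⊤ : ℕ∞) φ ∧ HasCompactSupport φ ∧
    (∫ t in Ioi (0 : ℝ), φ t ^ 2) = 1 ∧
    E = ∫ t in Ioi (0 : ℝ), (deriv φ t ^ 2 + (t - ξ) ^ 2 * φ t ^ 2)}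

/-- `δ₀ = (1 - Θ₀) / 2`. -/
def deltaZero : ℝ := (1 - deGennesConst) / 2

/-- `ξ_h = B R² / (2 h) + √(Θ₀ B R² / h) + C₂`. -/
def xiH (B R C₂ h : ℝ) : ℝ :=
  B * R ^ 2 / (2 * h) + Real.sqrt (deGennesConst * B * R ^ 2 / h) + C₂

/-- The measure `r dr` on `(R, ∞)`. -/
def radialMeasure (R : ℝ) : Measure ℝ :=
  (volume.restrict (Ioi R)).withDensity (fun r => ENNReal.ofReal r)

/-- The differential expression
`L_{h,m} f = - (h² / r) (r f')' + (1 / r²) (h m - B r² / 2)² f`. -/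
def radialOp (B h : ℝ) (m : ℤ) (f : ℝ → ℂ) (r : ℝ) : ℂ :=
  -((h ^ 2 / r : ℝ) : ℂ) * deriv (fun ρ : ℝ => (ρ : ℂ) * deriv f ρ) r
    + (((h * m - B * r ^ 2 / 2) ^ 2 / r ^ 2 : ℝ) : ℂ) * f r

/-- The domain of the self-adjoint Neumann realisation of `L_{h,m}` in `L²((R, ∞), r dr)`:
`f` is `C¹` on `[R, ∞)` with locally absolutely continuous derivative, the functions `f`, `f'` and
`L_{h,m} f` are square integrable for `r dr`, and `f'(R) = 0`. -/
structure InRadialDomain (B R h : ℝ) (m : ℤ) (f : ℝ → ℂ) : Prop where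
  differentiableOn : DifferentiableOn ℝ f (Ici R)
  deriv_ac : ∀ b : ℝ, R < b → AbsolutelyContinuousOnInterval (derivWithin f (Ici R)) R b
  memLp : MemLp f 2 (radialMeasure R)
  memLp_deriv : MemLp (deriv f) 2 (radialMeasure R)
  memLp_op : MemLp (radialOp B h m f) 2 (radialMeasure R)
  neumann : derivWithin f (Ici R) R = 0

/-- `f` is a ground state of the Neumann realisation of `L_{h,m}`: a nonzero eigenfunction whose
eigenvalue `μ` is the bottom of the spectrum, i.e. `μ ‖g‖² ≤ ⟨g, L_{h,m} g⟩` on the domain. -/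
def IsRadialGroundState (B R h : ℝ) (m : ℤ) (f : ℝ → ℂ) : Prop :=
  InRadialDomain B R h m f ∧ (∃ r : ℝ, R < r ∧ f r ≠ 0) ∧
    ∃ μ : ℝ, (∀ᵐ r ∂(radialMeasure R), radialOp B h m f r = (μ : ℂ) * f r) ∧
      ∀ g : ℝ → ℂ, InRadialDomain B R h m g →
        μ * ∫ r, ‖g r‖ ^ 2 ∂(radialMeasure R) ≤
          (∫ r, (starRingEnd ℂ) (g r) * radialOp B h m g r ∂(radialMeasure R)).re

/-- `Φ` is a normalised eigenfunction of the magnetic Neumann Laplacian in the exterior of the disc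
of radius `R` (points of the plane are complex numbers `z = r e^{iθ}`) with angular momentum `m`,
and `e^{-imθ} Φ` is the ground state of `L_{h,m}`. -/
def IsMomentumGroundState (B R h : ℝ) (m : ℤ) (Φ : ℂ → ℂ) : Prop :=
  (∃ f : ℝ → ℂ, IsRadialGroundState B R h m f ∧
    ∀ r θ : ℝ, R ≤ r →
      Φ ((r : ℂ) * Complex.exp (Complex.I * θ)) = Complex.exp (Complex.I * (m * θ)) * f r) ∧
  (∫ z in {z : ℂ | R < ‖z‖}, ‖Φ z‖ ^ 2) = 1

/-- `h → 0⁺` along an `e₀`-sequence, where `m n` is the integer `m₋ = ξ_h - e₀ + o(1)`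
attached to `h = h n`. -/
structure IsESequence (B R C₂ e₀ : ℝ) (h : ℕ → ℝ) (m : ℕ → ℤ) : Prop where
  pos : ∀ n, 0 < h n
  tendsto_zero : Tendsto h atTop (𝓝 0)
  tendsto_xi : Tendsto (fun n => xiH B R C₂ (h n) - (m n : ℝ)) atTop (𝓝 e₀)

/-- The outer leading term `(K₀ Γ(δ₀) / R) (2 R² / (r² - R²))^{δ₀}`, principal branch. -/
def outerTerm (K₀ R : ℝ) (r : ℂ) : ℂ :=
  ((K₀ * Real.Gamma deltaZero / R : ℝ) : ℂ) *
    (2 * (R : ℂ) ^ 2 / (r ^ 2 - (R : ℂ) ^ 2)) ^ (deltaZero : ℂ)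

/-- The point `R + t √(h / B)` of the boundary layer. -/
def layerPoint (B R t h : ℝ) : ℂ := ((R + t * Real.sqrt (h / B) : ℝ) : ℂ)

end

/-! Put `N = √(B R² / h)`. For angular momentum `m` and eigenvalue `h B (1 - 2 a)` the radial
equation has an explicit solution decaying at infinity, `radialSol`: the factor `(r/R)^m
e^(-(N²/4)(r²/R² - 1))` times the Laplace integral `F(a, σ) = ∫₀^∞ y^(a-1) w(y) e^(-σ y) dy`, where
`w(y) = e^(-N y/2) (1 + y/N)^(m-a)` and `σ = (N/2)(r²/R² - 1)`. This is a rescaled Kummer function.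
It is positive, so as soon as `a` makes its derivative vanish at `r = R`, any ground state is a
multiple of it; a Wronskian comparison (`eq_const_mul_of_neumann`) proves this without spectral
theory. The lemma is thereby reduced to the asymptotics of `F`.

Along the sequence `m = N²/2 + √Θ₀ N + O(1)`. Expanding the logarithm, `w(y)` tends to `e^(-y²/4 +
√Θ₀ y)` with error `O(1/N)` and uniform exponential bounds (`diskWeight_estimates`), so the moments
of `w` tend to parabolic cylinder functions `pcf`, and the Neumann equation for `a` tends to
`neumannDefect a = 0`. This limit equation has the root `δ₀` and changes sign there at a linear rate
(`exists_neumannDefect_bound`); the intermediate value theorem gives a root `a` of the true equation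
within `N^(-1/2)` of `δ₀` (`exists_neumann_root`).

That `δ₀` is a root is where the variational definition of `Θ₀` enters. Let `Q` be the logarithmic
derivative of the decaying solution `D` of `-D'' + x² D = Θ₀ D`. If `Q` were positive somewhere, a
translate of `D` would be a trial function with Rayleigh quotient below `Θ₀`. If `Q` were negative
everywhere, it would stay below some `-c < 0`, and `Q + c` would be a Riccati subsolution proving
`Θ₀ + c² ≤ Θ₀`. Hence `Q ≤ 0` with a zero. At this maximum `Q' = 0`, and the Riccati equation `Q' =
x² - Θ₀ - Q²` forces the zero to be `-√Θ₀` (`weberQ_deltaZero_xiZero`).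

The asymptotics follow. At `r = R + t R/N` one has `σ = t + t²/(2N)`, and dominated convergence
yields the profile `v(t) = pcf δ₀ (t - √Θ₀)`, its derivative, and the limit of the `L²` mass, which
fixes `K₀`. Away from the layer `|σ|` is large with `Re σ > 0`, and Watson's lemma, uniform in the
half plane (`laplaceMoment_diskWeight_sub_le`), gives `F ~ Γ(δ₀) σ^(-δ₀)`; replacing `a` by `δ₀` in
the power is harmless because `log N / √N → 0`. Since `F` is holomorphic for `Re σ > -N/2`, that is
for `Re r² > 0`, it is also the analytic factor `u_h`, up to normalisation. -/

noncomputable section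

/-! ### Laplace moments of exponentially decaying weights. -/

/-- The Laplace transform `∫₀^∞ y^(b-1) g(y) e^(-σ y) dy` at a complex point. -/
def laplaceMoment (g : ℝ → ℝ) (b : ℝ) (σ : ℂ) : ℂ :=
  ∫ y in Ioi (0 : ℝ), ((y ^ (b - 1) * g y : ℝ) : ℂ) * Complex.exp (-σ * y)

/-- The Laplace transform `∫₀^∞ y^(b-1) g(y) e^(-σ y) dy` at a real point. -/
def realMoment (g : ℝ → ℝ) (b σ : ℝ) : ℝ :=
  ∫ y in Ioi (0 : ℝ), y ^ (b - 1) * g y * Real.exp (-σ * y)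

/-- A positive continuous weight on the half line dominated by a multiple of `e^(-Λ y)`. -/
structure ExpKernel (g : ℝ → ℝ) (Λ : ℝ) : Prop where
  cont : ContinuousOn g (Ici 0)
  pos : ∀ y, 0 ≤ y → 0 < g y
  bound : ∃ D, 0 < D ∧ ∀ y, 0 ≤ y → g y ≤ D * Real.exp (-Λ * y)

lemma integrableOn_rpow_mul_exp {b s : ℝ} (hb : 0 < b) (hs : 0 < s) :
    IntegrableOn (fun y : ℝ => y ^ (b - 1) * Real.exp (-s * y)) (Ioi 0) := by
  have := integrableOn_rpow_mul_exp_neg_mul_rpow (p := 1) (s := b - 1) (b := s) (by linarith)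
    one_pos hs
  simpa using this

lemma ExpKernel.aestronglyMeasurable {g : ℝ → ℝ} {Λ : ℝ} (hg : ExpKernel g Λ) (b : ℝ) (σ : ℂ) :
    AEStronglyMeasurable
      (fun y : ℝ => ((y ^ (b - 1) * g y : ℝ) : ℂ) * Complex.exp (-σ * y))
      (volume.restrict (Ioi 0)) := by
  refine ContinuousOn.aestronglyMeasurable ?_ measurableSet_Ioi
  refine ContinuousOn.mul ?_ (by fun_prop)
  refine Complex.continuous_ofReal.comp_continuousOn ?_
  refine ContinuousOn.mul ?_ (hg.cont.mono Ioi_subset_Ici_self)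
  exact fun y hy => (Real.continuousAt_rpow_const _ _ (Or.inl (ne_of_gt hy))).continuousWithinAt

lemma norm_laplace_integrand {g : ℝ → ℝ} {Λ : ℝ} (hg : ExpKernel g Λ) (b : ℝ) (σ : ℂ) {y : ℝ}
    (hy : 0 < y) :
    ‖((y ^ (b - 1) * g y : ℝ) : ℂ) * Complex.exp (-σ * y)‖
      = y ^ (b - 1) * g y * Real.exp (-σ.re * y) := by
  rw [norm_mul, Complex.norm_real, Complex.norm_exp, Real.norm_eq_abs, abs_of_pos]
  · simp
  · exact mul_pos (Real.rpow_pos_of_pos hy _) (hg.pos y hy.le)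

lemma ExpKernel.integrableOn_complex {g : ℝ → ℝ} {Λ : ℝ} (hg : ExpKernel g Λ) {b : ℝ} (hb : 0 < b)
    {σ : ℂ} (hσ : -Λ < σ.re) :
    IntegrableOn (fun y : ℝ => ((y ^ (b - 1) * g y : ℝ) : ℂ) * Complex.exp (-σ * y)) (Ioi 0) := by
  obtain ⟨D, hD, hbd⟩ := hg.bound
  have h1 := (integrableOn_rpow_mul_exp hb (s := Λ + σ.re) (by linarith)).const_mul D
  refine Integrable.mono' h1 (hg.aestronglyMeasurable b σ) ?_
  refine (ae_restrict_iff' measurableSet_Ioi).2 (ae_of_all _ fun y hy => ?_)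
  have hy : 0 < y := hy
  rw [norm_laplace_integrand hg b σ hy]
  have h2 := hbd y hy.le
  have h3 : Real.exp (-(Λ + σ.re) * y) = Real.exp (-Λ * y) * Real.exp (-σ.re * y) := by
    rw [← Real.exp_add]; ring_nf
  rw [h3]
  have := Real.rpow_pos_of_pos hy (b - 1)
  calc _ ≤ y ^ (b - 1) * (D * Real.exp (-Λ * y)) * Real.exp (-σ.re * y) := by gcongr
    _ = _ := by ring

lemma ExpKernel.integrableOn {g : ℝ → ℝ} {Λ : ℝ} (hg : ExpKernel g Λ) {b : ℝ} (hb : 0 < b)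
    {σ : ℝ} (hσ : -Λ < σ) :
    IntegrableOn (fun y : ℝ => y ^ (b - 1) * g y * Real.exp (-σ * y)) (Ioi 0) := by
  have := (hg.integrableOn_complex hb (σ := σ) (by simpa using hσ)).norm
  refine this.congr ?_
  refine (ae_restrict_iff' measurableSet_Ioi).2 (ae_of_all _ fun y hy => ?_)
  simpa using norm_laplace_integrand hg b σ hy

lemma laplaceMoment_ofReal (g : ℝ → ℝ) (b σ : ℝ) :
    laplaceMoment g b (σ : ℂ) = (realMoment g b σ : ℂ) := by
  rw [laplaceMoment, realMoment, ← integral_complex_ofReal]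
  congr 1 with y
  push_cast
  rfl

lemma ExpKernel.realMoment_pos {g : ℝ → ℝ} {Λ : ℝ} (hg : ExpKernel g Λ) {b : ℝ} (hb : 0 < b)
    {σ : ℝ} (hσ : -Λ < σ) : 0 < realMoment g b σ := by
  rw [realMoment, integral_pos_iff_support_of_nonneg_ae _ (hg.integrableOn hb hσ)]
  · rw [Measure.restrict_apply' measurableSet_Ioi]
    refine lt_of_lt_of_le ?_ (measure_mono (s := Ioi 0) fun y hy => ⟨?_, hy⟩)
    · simp
    · have hy : 0 < y := hy
      have := hg.pos y hy.le
      have := Real.rpow_pos_of_pos hy (b - 1)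
      simp only [Function.mem_support]
      positivity
  · refine (ae_restrict_iff' measurableSet_Ioi).2 (ae_of_all _ fun y hy => ?_)
    have hy : 0 < y := hy
    have := hg.pos y hy.le
    have := Real.rpow_pos_of_pos hy (b - 1)
    simp only [Pi.zero_apply]
    positivity

/-- Differentiation under the integral brings down a factor `-y`, which only raises `b` by one. The
family of moments is therefore closed under differentiation, and differential equations become
recurrences in `b`. -/
lemma ExpKernel.hasDerivAt_laplaceMoment {g : ℝ → ℝ} {Λ : ℝ} (hg : ExpKernel g Λ) {b : ℝ}
    (hb : 0 < b) {σ : ℂ} (hσ : -Λ < σ.re) :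
    HasDerivAt (laplaceMoment g b) (-laplaceMoment g (b + 1) σ) σ := by
  -- An abscissa strictly between `-Λ` and `σ.re` supplies one integrable bound valid for all `w`
  -- near `σ`.
  obtain ⟨l, hl1, hl2⟩ := exists_between hσ
  have key := hasDerivAt_integral_of_dominated_loc_of_deriv_le
    (μ := volume.restrict (Ioi (0 : ℝ))) (s := {w : ℂ | l < w.re}) (x₀ := σ)
    (F := fun w y => ((y ^ (b - 1) * g y : ℝ) : ℂ) * Complex.exp (-w * y))
    (F' := fun w y => -(((y ^ (b + 1 - 1) * g y : ℝ) : ℂ) * Complex.exp (-w * y)))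
    (bound := fun y => y ^ (b + 1 - 1) * g y * Real.exp (-l * y))
    ((isOpen_lt continuous_const Complex.continuous_re).mem_nhds hl2)
    (Eventually.of_forall fun w => hg.aestronglyMeasurable b w)
    (hg.integrableOn_complex hb hσ)
    (hg.aestronglyMeasurable (b + 1) σ).neg
    ((ae_restrict_iff' measurableSet_Ioi).2 (ae_of_all _ fun y hy w hw => ?_))
    (hg.integrableOn (by linarith) hl1)
    ((ae_restrict_iff' measurableSet_Ioi).2 (ae_of_all _ fun y hy w hw => ?_))
  · have h2 := key.2
    rw [integral_neg] at h2
    exact h2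
  · have hy : 0 < y := hy
    have hw : l < w.re := hw
    rw [norm_neg, norm_laplace_integrand hg (b + 1) w hy]
    have := hg.pos y hy.le
    have := Real.rpow_pos_of_pos hy (b + 1 - 1)
    gcongr
  · have hy : 0 < y := hy
    have h1 : HasDerivAt (fun w : ℂ => Complex.exp (-w * y)) (Complex.exp (-w * y) * (-1 * y)) w :=
      (((hasDerivAt_id w).neg).mul_const (y : ℂ)).cexp
    have h2 := h1.const_mul ((y ^ (b - 1) * g y : ℝ) : ℂ)
    refine h2.congr_deriv ?_
    have : y ^ (b + 1 - 1) = y ^ (b - 1) * y := by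
      rw [← Real.rpow_add_one hy.ne']; ring_nf
    rw [this]
    push_cast
    ring

lemma ExpKernel.hasDerivAt_realMoment {g : ℝ → ℝ} {Λ : ℝ} (hg : ExpKernel g Λ) {b : ℝ}
    (hb : 0 < b) {σ : ℝ} (hσ : -Λ < σ) :
    HasDerivAt (realMoment g b) (-realMoment g (b + 1) σ) σ := by
  have h := (hg.hasDerivAt_laplaceMoment hb (σ := σ) (by simpa using hσ)).real_of_complex
  simp only [laplaceMoment_ofReal] at h
  simpa using h

lemma ExpKernel.differentiableOn_laplaceMoment {g : ℝ → ℝ} {Λ : ℝ} (hg : ExpKernel g Λ) {b : ℝ}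
    (hb : 0 < b) : DifferentiableOn ℂ (laplaceMoment g b) {σ : ℂ | -Λ < σ.re} :=
  fun _ hσ => (hg.hasDerivAt_laplaceMoment hb hσ).differentiableAt.differentiableWithinAt

lemma ExpKernel.realMoment_antitone {g : ℝ → ℝ} {Λ : ℝ} (hg : ExpKernel g Λ) {b : ℝ} (hb : 0 < b)
    {σ τ : ℝ} (hσ : -Λ < σ) (hτ : σ ≤ τ) : realMoment g b τ ≤ realMoment g b σ := by
  refine setIntegral_mono_on (hg.integrableOn hb (hσ.trans_le hτ)) (hg.integrableOn hb hσ)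
    measurableSet_Ioi fun y hy => ?_
  have hy : 0 < y := hy
  have := hg.pos y hy.le
  have := Real.rpow_pos_of_pos hy (b - 1)
  gcongr

lemma tendsto_rpow_mul_exp_neg_atTop (b : ℝ) {s : ℝ} (hs : 0 < s) :
    Tendsto (fun y : ℝ => y ^ b * Real.exp (-s * y)) atTop (𝓝 0) :=
  tendsto_rpow_mul_exp_neg_mul_atTop_nhds_zero b s hs

/-- Integration by parts for a kernel with `(p + r y) g' = (α + β y) g`. -/
lemma ExpKernel.recurrence {g g' : ℝ → ℝ} {Λ : ℝ} (hg : ExpKernel g Λ)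
    (hd : ∀ y, 0 < y → HasDerivAt g (g' y) y) {p r α β : ℝ}
    (hode : ∀ y, 0 < y → (p + r * y) * g' y = (α + β * y) * g y)
    {b : ℝ} (hb : 0 < b) {σ : ℝ} (hσ : -Λ < σ) :
    b * p * realMoment g b σ + (b * r + r - σ * p + α) * realMoment g (b + 1) σ
      + (β - σ * r) * realMoment g (b + 2) σ = 0 := by
  obtain ⟨D, hD, hbd⟩ := hg.bound
  -- The recurrence is `∫ F' = 0`. The factor `p + r y` lets the equation for `g` eliminate `g'`;
  -- `F` vanishes at `0` because `b > 0` and at infinity because `-Λ < σ`.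
  set F : ℝ → ℝ := fun y => (p + r * y) * (y ^ b * g y * Real.exp (-σ * y)) with hF
  have i0 := hg.integrableOn hb hσ
  have i1 := hg.integrableOn (b := b + 1) (by linarith) hσ
  have i2 := hg.integrableOn (b := b + 2) (by linarith) hσ
  set F' : ℝ → ℝ := fun y => b * p * (y ^ (b - 1) * g y * Real.exp (-σ * y))
    + (b * r + r - σ * p + α) * (y ^ (b + 1 - 1) * g y * Real.exp (-σ * y))
    + (β - σ * r) * (y ^ (b + 2 - 1) * g y * Real.exp (-σ * y)) with hF'
  have hint : IntegrableOn F' (Ioi 0) := ((i0.const_mul _).add (i1.const_mul _)).add (i2.const_mul _)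
  have hval : ∫ y in Ioi (0 : ℝ), F' y = b * p * realMoment g b σ
      + (b * r + r - σ * p + α) * realMoment g (b + 1) σ + (β - σ * r) * realMoment g (b + 2) σ := by
    have e1 := integral_add ((i0.const_mul (b * p)).add
      (i1.const_mul (b * r + r - σ * p + α))) (i2.const_mul (β - σ * r))
    have e2 := integral_add (i0.const_mul (b * p)) (i1.const_mul (b * r + r - σ * p + α))
    simp only [integral_const_mul] at e1 e2
    simp only [realMoment]
    rw [← e2]
    exact e1
  have hder : ∀ y ∈ Ioi (0 : ℝ), HasDerivAt F (F' y) y := by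
    intro y hy
    have hy : 0 < y := hy
    have e1 : y ^ (b + 1 - 1) = y ^ (b - 1) * y := by
      rw [← Real.rpow_add_one hy.ne']; ring_nf
    have e2 : y ^ (b + 2 - 1) = y ^ (b - 1) * y * y := by
      rw [← Real.rpow_add_one hy.ne', ← Real.rpow_add_one hy.ne']; ring_nf
    have e3 : y ^ b = y ^ (b - 1) * y := by
      rw [← Real.rpow_add_one hy.ne']; ring_nf
    have d1 : HasDerivAt (fun y : ℝ => p + r * y) r y := by
      simpa using ((hasDerivAt_id y).const_mul r).const_add p
    have d2 : HasDerivAt (fun y : ℝ => y ^ b) (b * y ^ (b - 1)) y :=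
      Real.hasDerivAt_rpow_const (Or.inl hy.ne')
    have d3 : HasDerivAt (fun y : ℝ => Real.exp (-σ * y)) (Real.exp (-σ * y) * -σ) y := by
      simpa using ((hasDerivAt_id y).const_mul (-σ)).exp
    have := d1.mul ((d2.mul (hd y hy)).mul d3)
    refine this.congr_deriv ?_
    simp only [hF', Pi.mul_apply]
    rw [e1, e2, e3]
    linear_combination (y ^ (b - 1) * y * Real.exp (-σ * y)) * hode y hy
  have hbound : ∀ y, 0 < y → ‖F y‖ ≤ (|p| + |r| * y) * (D * (y ^ b * Real.exp (-(Λ + σ) * y))) := by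
    intro y hy
    have h3 : Real.exp (-(Λ + σ) * y) = Real.exp (-Λ * y) * Real.exp (-σ * y) := by
      rw [← Real.exp_add]; ring_nf
    have hgp := hg.pos y hy.le
    have := Real.rpow_pos_of_pos hy b
    have hg2 := hbd y hy.le
    simp only [hF, norm_mul, Real.norm_eq_abs]
    rw [abs_of_pos this, abs_of_pos hgp, abs_of_pos (Real.exp_pos _), h3]
    have a1 : |p + r * y| ≤ |p| + |r| * y := by
      refine (abs_add_le _ _).trans ?_
      rw [abs_mul, abs_of_pos hy]
    have a2 : y ^ b * g y * Real.exp (-σ * y)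
        ≤ D * (y ^ b * (Real.exp (-Λ * y) * Real.exp (-σ * y))) := by
      calc _ ≤ y ^ b * (D * Real.exp (-Λ * y)) * Real.exp (-σ * y) := by gcongr
        _ = _ := by ring
    exact mul_le_mul a1 a2 (by positivity) (by positivity)
  have hinf : Tendsto F atTop (𝓝 0) := by
    have t1 := (tendsto_rpow_mul_exp_neg_atTop b (s := Λ + σ) (by linarith)).const_mul (|p| * D)
    have t2 := (tendsto_rpow_mul_exp_neg_atTop (b + 1) (s := Λ + σ) (by linarith)).const_mul (|r| * D)
    have t3 := t1.add t2
    simp only [mul_zero, add_zero] at t3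
    refine squeeze_zero_norm' ?_ t3
    filter_upwards [eventually_gt_atTop 0] with y hy
    refine (hbound y hy).trans (le_of_eq ?_)
    rw [Real.rpow_add_one hy.ne']
    ring
  have hzero : Tendsto F (𝓝[>] 0) (𝓝 0) := by
    have hc : Tendsto (fun y : ℝ => (|p| + |r| * y) * (D * (y ^ b * Real.exp (-(Λ + σ) * y))))
        (𝓝[>] 0) (𝓝 ((|p| + |r| * 0) * (D * ((0 : ℝ) ^ b * Real.exp (-(Λ + σ) * 0))))) := by
      refine Tendsto.mono_left ?_ nhdsWithin_le_nhds
      have c1 : ContinuousAt (fun y : ℝ => y ^ b) 0 :=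
        Real.continuousAt_rpow_const _ _ (Or.inr hb.le)
      have c2 : ContinuousAt (fun y : ℝ => |p| + |r| * y) 0 := by fun_prop
      have c3 : ContinuousAt (fun y : ℝ => Real.exp (-(Λ + σ) * y)) 0 := by fun_prop
      exact (c2.mul (continuousAt_const.mul (c1.mul c3))).tendsto
    rw [Real.zero_rpow hb.ne'] at hc
    simp only [zero_mul, mul_zero] at hc
    refine squeeze_zero_norm' ?_ hc
    filter_upwards [self_mem_nhdsWithin] with y hy using hbound y hy
  have hF0 : F 0 = 0 := by simp [hF, Real.zero_rpow hb.ne']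
  have hcont : ContinuousWithinAt F (Ici 0) 0 := by
    rw [← continuousWithinAt_Ioi_iff_Ici, ContinuousWithinAt, hF0]
    exact hzero
  have := integral_Ioi_of_hasDerivAt_of_tendsto hcont hder hint hinf
  rw [hval, hF0] at this
  simpa using this

/-! ### Upper and lower bounds for the de Gennes constant. -/

/-- The Rayleigh quotient inequality for one compactly supported test function. -/
lemma deGennesConst_mul_le {ξ : ℝ} {φ : ℝ → ℝ} (hφ : ContDiff ℝ (⊤ : ℕ∞) φ)
    (hc : HasCompactSupport φ) :
    deGennesConst * ∫ t in Ioi (0 : ℝ), φ t ^ 2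
      ≤ ∫ t in Ioi (0 : ℝ), (deriv φ t ^ 2 + (t - ξ) ^ 2 * φ t ^ 2) := by
  have hE : 0 ≤ ∫ t in Ioi (0 : ℝ), (deriv φ t ^ 2 + (t - ξ) ^ 2 * φ t ^ 2) :=
    integral_nonneg fun t => by positivity
  have hn : 0 ≤ ∫ t in Ioi (0 : ℝ), φ t ^ 2 := integral_nonneg fun t => by positivity
  rcases hn.eq_or_lt with h0 | hpos
  · rw [← h0, mul_zero]; exact hE
  set n := ∫ t in Ioi (0 : ℝ), φ t ^ 2 with hndef
  set k := (Real.sqrt n)⁻¹ with hk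
  have hk2 : k ^ 2 = n⁻¹ := by rw [hk, inv_pow, Real.sq_sqrt hn]
  have hb : BddBelow {E : ℝ | ∃ (ξ : ℝ) (φ : ℝ → ℝ), ContDiff ℝ (⊤ : ℕ∞) φ ∧ HasCompactSupport φ ∧
      (∫ t in Ioi (0 : ℝ), φ t ^ 2) = 1 ∧
      E = ∫ t in Ioi (0 : ℝ), (deriv φ t ^ 2 + (t - ξ) ^ 2 * φ t ^ 2)} := by
    refine ⟨0, ?_⟩
    rintro E ⟨ξ, φ, -, -, -, rfl⟩
    exact integral_nonneg fun t => by positivity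
  have h := csInf_le hb (a := ∫ t in Ioi (0 : ℝ),
      (deriv (fun t => k * φ t) t ^ 2 + (t - ξ) ^ 2 * (k * φ t) ^ 2))
    ⟨ξ, fun t => k * φ t, contDiff_const.mul hφ, hc.mul_left, ?_, rfl⟩
  · have e : ∀ t, deriv (fun t => k * φ t) t ^ 2 + (t - ξ) ^ 2 * (k * φ t) ^ 2
        = k ^ 2 * (deriv φ t ^ 2 + (t - ξ) ^ 2 * φ t ^ 2) := by
      intro t
      rw [deriv_const_mul _ (hφ.differentiable (by simp) t)]
      ring
    simp only [e, integral_const_mul] at h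
    change deGennesConst ≤ _ at h
    rw [hk2] at h
    rw [← le_div_iff₀ hpos, div_eq_inv_mul]
    exact h
  · simp only [mul_pow, integral_const_mul]
    rw [hk2, ← hndef, inv_mul_cancel₀ hpos.ne']

lemma HasCompactSupport.fun_sq {f : ℝ → ℝ} (hf : HasCompactSupport f) :
    HasCompactSupport (fun x => f x ^ 2) := by
  simp only [sq]; exact hf.mul_left

lemma exists_cutoff : ∃ χ : ℝ → ℝ, ContDiff ℝ (⊤ : ℕ∞) χ ∧ HasCompactSupport χ ∧
    (∀ t, 0 ≤ χ t ∧ χ t ≤ 1) ∧ (∀ t, |t| ≤ 1 → χ t = 1) := by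
  let f : ContDiffBump (0 : ℝ) := ⟨1, 2, one_pos, one_lt_two⟩
  refine ⟨f, f.contDiff, f.hasCompactSupport, fun t => ⟨f.nonneg, f.le_one⟩, fun t ht => ?_⟩
  exact f.one_of_mem_closedBall (by simpa [Real.dist_eq] using ht)

/-- The Rayleigh quotient inequality for smooth functions of finite energy. -/
lemma deGennesConst_mul_le_of_integrable {ξ : ℝ} {ψ : ℝ → ℝ} (hψ : ContDiff ℝ (⊤ : ℕ∞) ψ)
    (h0 : IntegrableOn (fun t => ψ t ^ 2) (Ioi 0))
    (h1 : IntegrableOn (fun t => deriv ψ t ^ 2) (Ioi 0))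
    (h2 : IntegrableOn (fun t => (t - ξ) ^ 2 * ψ t ^ 2) (Ioi 0)) :
    deGennesConst * ∫ t in Ioi (0 : ℝ), ψ t ^ 2
      ≤ ∫ t in Ioi (0 : ℝ), (deriv ψ t ^ 2 + (t - ξ) ^ 2 * ψ t ^ 2) := by
  obtain ⟨χ, hχ, hχc, hχb, hχ1⟩ := exists_cutoff
  obtain ⟨C, hC⟩ := (hχ.continuous_deriv (by simp)).bounded_above_of_compact_support hχc.deriv
  have hC0 : 0 ≤ C := (norm_nonneg _).trans (hC 0)
  -- Cutting off at scale `n + 1` keeps the slope of the cutoff bounded by `C`, so `ψ²` and `ψ'²`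
  -- dominate. At a fixed `t` the cutoff is eventually `1` near `t`, so values and derivatives
  -- converge.
  set φ : ℕ → ℝ → ℝ := fun n t => χ (((n : ℝ) + 1)⁻¹ * t) * ψ t with hφ
  have hn1 : ∀ n : ℕ, 0 < ((n : ℝ) + 1)⁻¹ := fun n => by positivity
  have hn2 : ∀ n : ℕ, ((n : ℝ) + 1)⁻¹ ≤ 1 := fun n =>
    inv_le_one_of_one_le₀ (by have : (0 : ℝ) ≤ n := Nat.cast_nonneg n; linarith)
  have hφs : ∀ n, ContDiff ℝ (⊤ : ℕ∞) (φ n) := fun n =>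
    (hχ.comp (contDiff_const.mul contDiff_id)).mul hψ
  have hφc : ∀ n, HasCompactSupport (φ n) := fun n =>
    HasCompactSupport.mul_right (hχc.comp_homeomorph (Homeomorph.mulLeft₀ _ (hn1 n).ne'))
  have hder : ∀ n t, deriv (φ n) t = ((n : ℝ) + 1)⁻¹ * deriv χ (((n : ℝ) + 1)⁻¹ * t) * ψ t
      + χ (((n : ℝ) + 1)⁻¹ * t) * deriv ψ t := by
    intro n t
    have d1 : HasDerivAt (fun t : ℝ => ((n : ℝ) + 1)⁻¹ * t) (((n : ℝ) + 1)⁻¹) t := by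
      simpa using (hasDerivAt_id t).const_mul (((n : ℝ) + 1)⁻¹)
    have d2 := (hχ.differentiable (by simp) (((n : ℝ) + 1)⁻¹ * t)).hasDerivAt.comp t d1
    have d3 := (hψ.differentiable (by simp) t).hasDerivAt
    have := (d2.mul d3).deriv
    simp only [Function.comp_def] at this
    rw [mul_comm (((n : ℝ) + 1)⁻¹)]
    exact this
  have hev : ∀ t : ℝ, ∀ᶠ n : ℕ in atTop, ∀ᶠ s in 𝓝 t, χ (((n : ℝ) + 1)⁻¹ * s) = 1 := by
    intro t
    obtain ⟨n0, hn0⟩ := exists_nat_gt |t|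
    filter_upwards [eventually_ge_atTop n0] with n hn
    have : ∀ᶠ s in 𝓝 t, |s| < (n : ℝ) + 1 := by
      refine (continuous_abs.tendsto t).eventually_lt_const ?_
      have : (n0 : ℝ) ≤ n := by exact_mod_cast hn
      linarith
    filter_upwards [this] with s hs
    refine hχ1 _ ?_
    rw [abs_mul, abs_of_pos (hn1 n), inv_mul_le_iff₀ (by positivity)]
    linarith
  have hlim0 : ∀ t, Tendsto (fun n => φ n t) atTop (𝓝 (ψ t)) := by
    intro t
    refine tendsto_const_nhds.congr' ?_
    filter_upwards [hev t] with n hn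
    simp [hφ, hn.self_of_nhds]
  have hlim1 : ∀ t, Tendsto (fun n => deriv (φ n) t) atTop (𝓝 (deriv ψ t)) := by
    intro t
    refine tendsto_const_nhds.congr' ?_
    filter_upwards [hev t] with n hn
    refine (Filter.EventuallyEq.deriv_eq ?_).symm
    filter_upwards [hn] with s hs
    simp [hφ, hs]
  have hle0 : ∀ n t, φ n t ^ 2 ≤ ψ t ^ 2 := by
    intro n t
    have := hχb (((n : ℝ) + 1)⁻¹ * t)
    simp only [hφ, mul_pow]
    exact mul_le_of_le_one_left (sq_nonneg _) (pow_le_one₀ this.1 this.2)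
  have hle1 : ∀ n t, deriv (φ n) t ^ 2 ≤ 2 * (C ^ 2 * ψ t ^ 2) + 2 * deriv ψ t ^ 2 := by
    intro n t
    rw [hder]
    have b1 := hχb (((n : ℝ) + 1)⁻¹ * t)
    have b2 := hC (((n : ℝ) + 1)⁻¹ * t)
    set A := ((n : ℝ) + 1)⁻¹ * deriv χ (((n : ℝ) + 1)⁻¹ * t)
    have hA : |A| ≤ C := by
      rw [abs_mul, abs_of_pos (hn1 n)]
      calc _ ≤ 1 * C := mul_le_mul (hn2 n) b2 (abs_nonneg _) zero_le_one
        _ = C := one_mul C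
    have hA2 : A ^ 2 ≤ C ^ 2 := sq_le_sq' (by linarith [neg_abs_le A]) (by linarith [le_abs_self A])
    set X := χ (((n : ℝ) + 1)⁻¹ * t)
    have hX2 : X ^ 2 ≤ 1 := pow_le_one₀ b1.1 b1.2
    have e1 : (A * ψ t) ^ 2 ≤ C ^ 2 * ψ t ^ 2 := by
      rw [mul_pow]; exact mul_le_mul_of_nonneg_right hA2 (sq_nonneg _)
    have e2 : (X * deriv ψ t) ^ 2 ≤ deriv ψ t ^ 2 := by
      rw [mul_pow]; exact mul_le_of_le_one_left (sq_nonneg _) hX2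
    nlinarith [sq_nonneg (A * ψ t - X * deriv ψ t)]
  have T0 : Tendsto (fun n => ∫ t in Ioi (0 : ℝ), φ n t ^ 2) atTop
      (𝓝 (∫ t in Ioi (0 : ℝ), ψ t ^ 2)) := by
    refine tendsto_integral_of_dominated_convergence _ (fun n => ?_) h0 (fun n => ?_) ?_
    · exact ((hφs n).continuous.pow 2).aestronglyMeasurable
    · refine ae_of_all _ fun t => ?_
      rw [Real.norm_eq_abs, abs_of_nonneg (sq_nonneg _)]; exact hle0 n t
    · exact ae_of_all _ fun t => (hlim0 t).pow 2
  have T1 : Tendsto (fun n => ∫ t in Ioi (0 : ℝ), (deriv (φ n) t ^ 2 + (t - ξ) ^ 2 * φ n t ^ 2))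
      atTop (𝓝 (∫ t in Ioi (0 : ℝ), (deriv ψ t ^ 2 + (t - ξ) ^ 2 * ψ t ^ 2))) := by
    refine tendsto_integral_of_dominated_convergence
      (fun t => 2 * (C ^ 2 * ψ t ^ 2) + 2 * deriv ψ t ^ 2 + (t - ξ) ^ 2 * ψ t ^ 2)
      (fun n => ?_) ((((h0.const_mul _).const_mul 2).add (h1.const_mul 2)).add h2) (fun n => ?_) ?_
    · have := (hφs n).continuous
      have := (hφs n).continuous_deriv (by simp)
      exact Continuous.aestronglyMeasurable (by fun_prop)
    · refine ae_of_all _ fun t => ?_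
      rw [Real.norm_eq_abs, abs_of_nonneg (by positivity)]
      have := hle1 n t
      have := mul_le_mul_of_nonneg_left (hle0 n t) (sq_nonneg (t - ξ))
      linarith
    · exact ae_of_all _ fun t => ((hlim1 t).pow 2).add (((hlim0 t).pow 2).const_mul _)
  exact le_of_tendsto_of_tendsto' (T0.const_mul _) T1 fun n => deGennesConst_mul_le (hφs n) (hφc n)

/-- For `D'' = (x² - lam) D` the derivative of `D D'` is the energy density minus `lam D²`.
Integrating it over the half line makes the energy of the translate `D (t - ξ)` explicit up to the
boundary term at `x = -ξ`, whose sign decides on which side of `lam` the Rayleigh quotient lies. -/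
lemma deGennesConst_le_trial {lam C ξ : ℝ} {D D1 : ℝ → ℝ} (hs : ContDiff ℝ (⊤ : ℕ∞) D)
    (hD : ∀ x, HasDerivAt D (D1 x) x) (hD1 : ∀ x, HasDerivAt D1 ((x ^ 2 - lam) * D x) x)
    (b0 : ∀ x, -ξ ≤ x → |D x| ≤ C * Real.exp (-(1 / 4) * x ^ 2))
    (b1 : ∀ x, -ξ ≤ x → |D1 x| ≤ C * Real.exp (-(1 / 4) * x ^ 2))
    (b2 : ∀ x, -ξ ≤ x → |x * D x| ≤ C * Real.exp (-(1 / 4) * x ^ 2)) :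
    deGennesConst * ∫ t in Ioi (0 : ℝ), D (t - ξ) ^ 2
      ≤ lam * (∫ t in Ioi (0 : ℝ), D (t - ξ) ^ 2) - D (-ξ) * D1 (-ξ) := by
  have hDc : Continuous D := hs.continuous
  have hD1c : Continuous D1 := continuous_iff_continuousAt.2 fun x => (hD1 x).continuousAt
  have hgi : Integrable (fun t : ℝ => C ^ 2 * Real.exp (-(1 / 2) * (t - ξ) ^ 2)) :=
    ((integrable_exp_neg_mul_sq (by norm_num : (0 : ℝ) < 1 / 2)).comp_sub_right ξ).const_mul _
  have hsq : ∀ x : ℝ, (C * Real.exp (-(1 / 4) * x ^ 2)) ^ 2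
      = C ^ 2 * Real.exp (-(1 / 2) * x ^ 2) := by
    intro x
    rw [mul_pow, ← Real.exp_nat_mul]
    congr 2; push_cast; ring
  have mk : ∀ f : ℝ → ℝ, Continuous f → (∀ x, -ξ ≤ x → |f x| ≤ C * Real.exp (-(1 / 4) * x ^ 2)) →
      IntegrableOn (fun t => f (t - ξ) ^ 2) (Ioi 0) := by
    intro f hf hb
    refine Integrable.mono' hgi.integrableOn
      (Continuous.aestronglyMeasurable (by fun_prop)) ?_
    refine (ae_restrict_iff' measurableSet_Ioi).2 (ae_of_all _ fun t ht => ?_)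
    have ht : 0 < t := ht
    rw [Real.norm_eq_abs, abs_of_nonneg (sq_nonneg _), ← hsq, ← sq_abs]
    exact pow_le_pow_left₀ (abs_nonneg _) (hb _ (by linarith)) 2
  have i0 := mk D hDc b0
  have i1 := mk D1 hD1c b1
  have i2 := mk (fun x => x * D x) (by fun_prop) b2
  simp only [mul_pow] at i2
  have hdψ : ∀ t, HasDerivAt (fun t => D (t - ξ)) (D1 (t - ξ)) t := fun t => by
    simpa using (hD (t - ξ)).comp_sub_const t ξ
  have hder : deriv (fun t => D (t - ξ)) = fun t => D1 (t - ξ) := funext fun t => (hdψ t).deriv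
  have main := deGennesConst_mul_le_of_integrable (ξ := ξ) (ψ := fun t => D (t - ξ))
    (hs.comp (contDiff_id.sub contDiff_const)) i0 (by rw [hder]; exact i1) i2
  rw [hder] at main
  have hW : ∀ t ∈ Ioi (0 : ℝ), HasDerivAt (fun t => D (t - ξ) * D1 (t - ξ))
      (D1 (t - ξ) ^ 2 + (t - ξ) ^ 2 * D (t - ξ) ^ 2 - lam * D (t - ξ) ^ 2) t := by
    intro t _
    have d2 : HasDerivAt (fun t => D1 (t - ξ)) (((t - ξ) ^ 2 - lam) * D (t - ξ)) t := by
      simpa using (hD1 (t - ξ)).comp_sub_const t ξ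
    refine ((hdψ t).mul d2).congr_deriv ?_
    ring
  have hinf : Tendsto (fun t => D (t - ξ) * D1 (t - ξ)) atTop (𝓝 0) := by
    have h1 : Tendsto (fun t : ℝ => C ^ 2 * Real.exp (-(1 / 2) * (t - ξ) ^ 2)) atTop (𝓝 0) := by
      have h2 : Tendsto (fun t : ℝ => (1 / 2) * (t - ξ) ^ 2) atTop atTop :=
        ((tendsto_pow_atTop two_ne_zero).comp
          (tendsto_atTop_add_const_right atTop (-ξ) tendsto_id)).const_mul_atTop (by norm_num)
      have h3 := (Real.tendsto_exp_neg_atTop_nhds_zero.comp h2).const_mul (C ^ 2)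
      simpa [Function.comp_def, neg_mul] using h3
    refine squeeze_zero_norm' ?_ h1
    filter_upwards [eventually_gt_atTop 0] with t ht
    rw [norm_mul, ← hsq, sq]
    exact mul_le_mul (b0 _ (by linarith)) (b1 _ (by linarith)) (abs_nonneg _)
      ((abs_nonneg _).trans (b0 _ (by linarith)))
  have hI := integral_Ioi_of_hasDerivAt_of_tendsto
    (f := fun t => D (t - ξ) * D1 (t - ξ))
    (Continuous.continuousWithinAt (by fun_prop)) hW ((i1.add i2).sub (i0.const_mul lam)) hinf
  have hsplit := integral_sub (i1.add i2) (i0.const_mul lam)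
  rw [integral_const_mul] at hsplit
  simp only [zero_sub] at hI
  have hI' := hsplit.symm.trans hI
  have : ∫ t in Ioi (0 : ℝ), ((fun t => D1 (t - ξ) ^ 2) + fun t => (t - ξ) ^ 2 * D (t - ξ) ^ 2) t
      = ∫ t in Ioi (0 : ℝ), (D1 (t - ξ) ^ 2 + (t - ξ) ^ 2 * D (t - ξ) ^ 2) := rfl
  rw [this] at hI'
  linarith

/-- A lower bound for the de Gennes constant from a subsolution of a Riccati equation. -/
lemma le_deGennesConst {lam : ℝ} {p p' : ℝ → ℝ} (hp : ∀ x, HasDerivAt p (p' x) x)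
    (hp' : Continuous p') (hneg : ∀ x, p x ≤ 0) (hric : ∀ x, p' x + p x ^ 2 ≤ x ^ 2 - lam) :
    lam ≤ deGennesConst := by
  have hpc : Continuous p := continuous_iff_continuousAt.2 fun x => (hp x).continuousAt
  refine le_csInf ?_ ?_
  · obtain ⟨χ, hχ, hχc, hχb, hχ1⟩ := exists_cutoff
    have hi : Integrable (fun t => χ t ^ 2) :=
      (hχ.continuous.pow 2).integrable_of_hasCompactSupport hχc.fun_sq
    have hpos : 0 < ∫ t in Ioi (0 : ℝ), χ t ^ 2 := by
      rw [integral_pos_iff_support_of_nonneg (fun t => sq_nonneg _) hi.integrableOn,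
        Measure.restrict_apply' measurableSet_Ioi]
      refine lt_of_lt_of_le ?_ (measure_mono (s := Ioo 0 1) fun y hy => ⟨?_, hy.1⟩)
      · simp
      · simp [hχ1 y (abs_le.2 ⟨by linarith [hy.1], hy.2.le⟩)]
    set n := ∫ t in Ioi (0 : ℝ), χ t ^ 2
    refine ⟨_, 0, fun t => (Real.sqrt n)⁻¹ * χ t, contDiff_const.mul hχ, hχc.mul_left, ?_, rfl⟩
    simp only [mul_pow, integral_const_mul]
    rw [inv_pow, Real.sq_sqrt hpos.le]
    exact inv_mul_cancel₀ hpos.ne'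
  · rintro E ⟨ξ, φ, hφ, hc, hn, rfl⟩
    have hφ1 := hφ.continuous_deriv (by simp)
    have hφ0 := hφ.continuous
    have i0 : Integrable (fun t => φ t ^ 2) :=
      (hφ0.pow 2).integrable_of_hasCompactSupport hc.fun_sq
    have i1 : Integrable (fun t => deriv φ t ^ 2 + (t - ξ) ^ 2 * φ t ^ 2) := by
      refine Integrable.add ?_ ?_
      · exact (hφ1.pow 2).integrable_of_hasCompactSupport
          hc.deriv.fun_sq
      · refine Continuous.integrable_of_hasCompactSupport (by fun_prop) ?_
        exact hc.fun_sq.mul_left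
    have hd : ∀ t, HasDerivAt (fun t => p (t - ξ) * φ t ^ 2)
        (p' (t - ξ) * φ t ^ 2 + p (t - ξ) * (2 * φ t * deriv φ t)) t := by
      intro t
      have d1 : HasDerivAt (fun t => p (t - ξ)) (p' (t - ξ)) t := by
        simpa using (hp (t - ξ)).comp_sub_const t ξ
      have d2 := ((hφ.differentiable (by simp) t).hasDerivAt).pow 2
      refine (d1.mul d2).congr_deriv ?_
      simp
    have hcs : HasCompactSupport (fun t => p (t - ξ) * φ t ^ 2) :=
      hc.fun_sq.mul_left
    have hC1 : ContDiff ℝ 1 (fun t => p (t - ξ) * φ t ^ 2) := by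
      rw [contDiff_one_iff_deriv]
      refine ⟨fun t => (hd t).differentiableAt, ?_⟩
      rw [funext fun t => (hd t).deriv]
      fun_prop
    have hI := hcs.integral_Ioi_deriv_eq hC1 0
    have i2 : Integrable (deriv (fun t => p (t - ξ) * φ t ^ 2)) :=
      (hC1.continuous_deriv le_rfl).integrable_of_hasCompactSupport hcs.deriv
    have hmono : ∫ t in Ioi (0 : ℝ), (lam * φ t ^ 2 + deriv (fun t => p (t - ξ) * φ t ^ 2) t)
        ≤ ∫ t in Ioi (0 : ℝ), (deriv φ t ^ 2 + (t - ξ) ^ 2 * φ t ^ 2) := by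
      refine setIntegral_mono (((i0.const_mul lam).add i2).integrableOn) i1.integrableOn fun t => ?_
      simp only
      rw [(hd t).deriv]
      have := mul_le_mul_of_nonneg_right (hric (t - ξ)) (sq_nonneg (φ t))
      -- Completing the square: `φ'² ≥ 2 p φ φ' - p² φ²`, and the right side is `(p φ²)' - (p' + p²)
      -- φ²`. The total derivative contributes `-p(-ξ) φ(0)² ≥ 0` after integration.
      nlinarith [sq_nonneg (deriv φ t - p (t - ξ) * φ t)]
    rw [integral_add (i0.const_mul lam).integrableOn i2.integrableOn, integral_const_mul, hn, hI]
      at hmono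
    have := mul_nonneg (neg_nonneg.2 (hneg (0 - ξ))) (sq_nonneg (φ 0))
    linarith

/-! ### Parabolic cylinder functions and the characterisation of `Θ₀`. -/

/-- The Gaussian weight `e^(-y²/4)`. -/
def gaussWeight (y : ℝ) : ℝ := Real.exp (-y ^ 2 / 4)

lemma expKernel_gaussWeight (Λ : ℝ) : ExpKernel gaussWeight Λ := by
  refine ⟨by unfold gaussWeight; fun_prop, fun y _ => Real.exp_pos _, Real.exp (Λ ^ 2),
    Real.exp_pos _, fun y _ => ?_⟩
  rw [gaussWeight, ← Real.exp_add, Real.exp_le_exp]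
  nlinarith [sq_nonneg (y / 2 - Λ)]

/-- The parabolic cylinder function `∫₀^∞ y^(b-1) e^(-y²/4 - x y) dy` without Gaussian factor. -/
def pcf (b x : ℝ) : ℝ := realMoment gaussWeight b x

lemma pcf_pos {b : ℝ} (hb : 0 < b) (x : ℝ) : 0 < pcf b x :=
  (expKernel_gaussWeight (1 - x)).realMoment_pos hb (by linarith)

lemma hasDerivAt_pcf {b : ℝ} (hb : 0 < b) (x : ℝ) : HasDerivAt (pcf b) (-pcf (b + 1) x) x :=
  (expKernel_gaussWeight (1 - x)).hasDerivAt_realMoment hb (by linarith)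

lemma pcf_antitone {b : ℝ} (hb : 0 < b) : Antitone (pcf b) := fun x _ h =>
  (expKernel_gaussWeight (1 - x)).realMoment_antitone hb (by linarith) h

/-- Since `pcf (b + 1)` and `pcf (b + 2)` are minus the first and the second derivative of `pcf b`,
up to sign, this is the Hermite equation `f'' = 2 b f + 2 x f'`. -/
lemma pcf_recurrence {b : ℝ} (hb : 0 < b) (x : ℝ) :
    pcf (b + 2) x = 2 * b * pcf b x - 2 * x * pcf (b + 1) x := by
  have h := (expKernel_gaussWeight (1 - x)).recurrence
    (g' := fun y => -y / 2 * gaussWeight y) (fun y _ => ?_) (p := 1) (r := 0) (α := 0)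
    (β := -1 / 2) (fun y _ => by ring) hb (σ := x) (by linarith)
  · simp only [pcf]
    linarith
  · have h1 : HasDerivAt (fun y : ℝ => -y ^ 2 / 4) (-(2 * y) / 4) y := by
      simpa using ((hasDerivAt_pow 2 y).neg).div_const 4
    refine h1.exp.congr_deriv ?_
    simp only [gaussWeight]
    ring

lemma contDiff_pcf_nat (n : ℕ) : ∀ {b : ℝ}, 0 < b → ContDiff ℝ n (pcf b) := by
  induction n with
  | zero =>
    intro b hb
    exact contDiff_zero.2 (continuous_iff_continuousAt.2 fun x => (hasDerivAt_pcf hb x).continuousAt)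
  | succ n ih =>
    intro b hb
    push_cast
    rw [contDiff_succ_iff_deriv]
    refine ⟨fun x => (hasDerivAt_pcf hb x).differentiableAt, by simp, ?_⟩
    rw [funext fun x => (hasDerivAt_pcf hb x).deriv]
    exact (ih (by linarith)).neg

lemma contDiff_pcf {b : ℝ} (hb : 0 < b) : ContDiff ℝ (⊤ : ℕ∞) (pcf b) :=
  contDiff_infty.2 fun n => contDiff_pcf_nat n hb

/-- The decaying solution of `-D'' + x² D = (1 - 2 b) D`. -/
def weberD (b x : ℝ) : ℝ := Real.exp (-x ^ 2 / 2) * pcf b x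

/-- The logarithmic derivative of `weberD`. -/
def weberQ (b x : ℝ) : ℝ := -x - pcf (b + 1) x / pcf b x

lemma weberD_pos {b : ℝ} (hb : 0 < b) (x : ℝ) : 0 < weberD b x :=
  mul_pos (Real.exp_pos _) (pcf_pos hb x)

lemma hasDerivAt_weberD {b : ℝ} (hb : 0 < b) (x : ℝ) :
    HasDerivAt (weberD b) (weberQ b x * weberD b x) x := by
  have h1 : HasDerivAt (fun x : ℝ => Real.exp (-x ^ 2 / 2))
      (Real.exp (-x ^ 2 / 2) * (-(2 * x) / 2)) x := by
    simpa using (((hasDerivAt_pow 2 x).neg).div_const 2).exp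
  refine (h1.mul (hasDerivAt_pcf hb x)).congr_deriv ?_
  have := (pcf_pos hb x).ne'
  simp only [weberQ, weberD]
  field_simp
  ring

lemma hasDerivAt_weberQ {b : ℝ} (hb : 0 < b) (x : ℝ) :
    HasDerivAt (weberQ b) (x ^ 2 - (1 - 2 * b) - weberQ b x ^ 2) x := by
  have h0 := pcf_pos hb x
  have h1 := hasDerivAt_pcf hb x
  have h2 := hasDerivAt_pcf (b := b + 1) (by linarith) x
  have hr := pcf_recurrence hb x
  rw [show b + 1 + 1 = b + 2 by ring, hr] at h2
  refine ((hasDerivAt_id x).neg.sub (h2.div h1 h0.ne')).congr_deriv ?_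
  simp only [weberQ]
  field_simp
  ring

lemma continuous_weberQ {b : ℝ} (hb : 0 < b) : Continuous (weberQ b) :=
  continuous_iff_continuousAt.2 fun x => (hasDerivAt_weberQ hb x).continuousAt

lemma weberQ_lt {b : ℝ} (hb : 0 < b) (x : ℝ) : weberQ b x < -x := by
  have := div_pos (pcf_pos (b := b + 1) (by linarith) x) (pcf_pos hb x)
  simp only [weberQ]; linarith

lemma hasDerivAt_weberQ_mul_weberD {b : ℝ} (hb : 0 < b) (x : ℝ) :
    HasDerivAt (fun x => weberQ b x * weberD b x) ((x ^ 2 - (1 - 2 * b)) * weberD b x) x := by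
  refine ((hasDerivAt_weberQ hb x).mul (hasDerivAt_weberD hb x)).congr_deriv ?_
  ring

lemma abs_mul_exp_le (x : ℝ) :
    |x| * Real.exp (-x ^ 2 / 2) ≤ 2 * Real.exp (-(1 / 4) * x ^ 2) := by
  have h1 : |x| ≤ 2 * Real.exp (x ^ 2 / 4) := by
    have := Real.add_one_le_exp (x ^ 2 / 4)
    have h2 := sq_abs x
    nlinarith [sq_nonneg (|x| - 1)]
  have h2 : Real.exp (-(1 / 4) * x ^ 2) = Real.exp (x ^ 2 / 4) * Real.exp (-x ^ 2 / 2) := by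
    rw [← Real.exp_add]; ring_nf
  rw [h2, ← mul_assoc]
  exact mul_le_mul_of_nonneg_right h1 (Real.exp_pos _).le

lemma exp_half_le (x : ℝ) : Real.exp (-x ^ 2 / 2) ≤ Real.exp (-(1 / 4) * x ^ 2) := by
  rw [Real.exp_le_exp]; nlinarith [sq_nonneg x]

/-- The Gaussian solves the equation with `lam = 1`. Centred at `ξ = 1`, it is increasing at the
boundary point `x = -1`, so the boundary term strictly lowers its energy below `1`. -/
lemma deGennesConst_lt_one : deGennesConst < 1 := by
  have hD : ∀ x : ℝ, HasDerivAt (fun x : ℝ => Real.exp (-x ^ 2 / 2))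
      (-x * Real.exp (-x ^ 2 / 2)) x := by
    intro x
    refine ((((hasDerivAt_pow 2 x).neg).div_const 2).exp).congr_deriv ?_
    simp only [Nat.cast_ofNat, Nat.add_one_sub_one, pow_one, Pi.neg_apply]
    ring
  have main := deGennesConst_le_trial (lam := 1) (C := 2) (ξ := 1)
    (D := fun x => Real.exp (-x ^ 2 / 2)) (D1 := fun x => -x * Real.exp (-x ^ 2 / 2))
    (by fun_prop) hD (fun x => ?_) (fun x _ => ?_) (fun x _ => ?_) (fun x _ => ?_)
  · have hn : 0 ≤ ∫ t in Ioi (0 : ℝ), Real.exp (-(t - 1) ^ 2 / 2) ^ 2 :=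
      integral_nonneg fun t => by positivity
    by_contra! hcon
    have h1 := mul_le_mul_of_nonneg_right hcon hn
    have h2 : 0 < Real.exp (-(-1 : ℝ) ^ 2 / 2) := Real.exp_pos _
    nlinarith
  · refine ((hasDerivAt_id x).neg.mul (hD x)).congr_deriv ?_
    simp only [Pi.neg_apply, id]
    ring
  · rw [abs_of_pos (Real.exp_pos _)]
    have := exp_half_le x
    have := Real.exp_pos (-(1 / 4) * x ^ 2)
    linarith
  · rw [abs_mul, abs_neg, abs_of_pos (Real.exp_pos _)]
    exact abs_mul_exp_le x
  · rw [abs_mul, abs_of_pos (Real.exp_pos _)]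
    exact abs_mul_exp_le x

lemma deltaZero_pos : 0 < deltaZero := by
  have := deGennesConst_lt_one
  simp only [deltaZero]; linarith

lemma one_sub_two_mul_deltaZero : 1 - 2 * deltaZero = deGennesConst := by
  simp only [deltaZero]; ring

/-- A positive logarithmic derivative at `x` makes the boundary term favourable for the half line
starting at `x`. The decaying solution for the value `1 - 2 δ₀ = Θ₀` would then have Rayleigh
quotient strictly below `Θ₀`. -/
lemma weberQ_deltaZero_nonpos (x : ℝ) : weberQ deltaZero x ≤ 0 := by
  by_contra! hq
  have hd := deltaZero_pos
  set ξ := -x with hξ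
  have hx : x = -ξ := by rw [hξ, neg_neg]
  set C0 := pcf deltaZero x
  set C1 := pcf (deltaZero + 1) x
  have hC0 : 0 < C0 := pcf_pos hd x
  have hC1 : 0 < C1 := pcf_pos (by linarith) x
  have bD : ∀ y, -ξ ≤ y → |weberD deltaZero y| ≤ C0 * Real.exp (-y ^ 2 / 2) := by
    intro y hy
    rw [abs_of_pos (weberD_pos hd y), weberD, mul_comm]
    exact mul_le_mul_of_nonneg_right (pcf_antitone hd (hx ▸ hy)) (Real.exp_pos _).le
  have bxD : ∀ y, -ξ ≤ y → |y * weberD deltaZero y| ≤ C0 * (2 * Real.exp (-(1 / 4) * y ^ 2)) := by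
    intro y hy
    rw [abs_mul]
    calc |y| * |weberD deltaZero y| ≤ |y| * (C0 * Real.exp (-y ^ 2 / 2)) :=
          mul_le_mul_of_nonneg_left (bD y hy) (abs_nonneg _)
      _ = C0 * (|y| * Real.exp (-y ^ 2 / 2)) := by ring
      _ ≤ _ := mul_le_mul_of_nonneg_left (abs_mul_exp_le y) hC0.le
  have main := deGennesConst_le_trial (lam := 1 - 2 * deltaZero) (C := 2 * C0 + C1) (ξ := ξ)
    (D := weberD deltaZero) (D1 := fun x => weberQ deltaZero x * weberD deltaZero x)
    (ContDiff.mul (by fun_prop) (contDiff_pcf hd)) (hasDerivAt_weberD hd)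
    (hasDerivAt_weberQ_mul_weberD hd) (fun y hy => ?_) (fun y hy => ?_) (fun y hy => ?_)
  · rw [one_sub_two_mul_deltaZero, ← hx] at main
    have h1 := weberD_pos hd x
    have h2 : 0 < weberD deltaZero x * (weberQ deltaZero x * weberD deltaZero x) := by positivity
    linarith
  · have h1 := mul_le_mul_of_nonneg_left (exp_half_le y) hC0.le
    have h2 : 0 < Real.exp (-(1 / 4) * y ^ 2) := Real.exp_pos _
    have := bD y hy
    nlinarith [mul_pos hC0 h2, mul_pos hC1 h2]
  · have e : weberQ deltaZero y * weberD deltaZero y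
        = -(y * weberD deltaZero y) - Real.exp (-y ^ 2 / 2) * pcf (deltaZero + 1) y := by
      have := (pcf_pos hd y).ne'
      simp only [weberQ, weberD]
      field_simp
    have h3 : |Real.exp (-y ^ 2 / 2) * pcf (deltaZero + 1) y|
        ≤ C1 * Real.exp (-(1 / 4) * y ^ 2) := by
      rw [abs_of_pos (mul_pos (Real.exp_pos _) (pcf_pos (by linarith) y)), mul_comm]
      exact mul_le_mul (pcf_antitone (by linarith) (hx ▸ hy)) (exp_half_le y) (Real.exp_pos _).le
        hC1.le
    rw [e]
    refine (abs_sub _ _).trans ?_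
    rw [abs_neg]
    have := bxD y hy
    linarith
  · have := bxD y hy
    have h2 : 0 < Real.exp (-(1 / 4) * y ^ 2) := Real.exp_pos _
    nlinarith [mul_pos hC1 h2]

/-- Without a zero the logarithmic derivative is bounded away from `0`, uniformly on the line.
Adding the gap `c` gives a nonpositive Riccati subsolution for a value larger than `Θ₀`, against its
definition as an infimum. No minimiser is needed. -/
lemma exists_weberQ_deltaZero_eq_zero : ∃ x, weberQ deltaZero x = 0 := by
  have hd := deltaZero_pos
  by_contra! hne
  have hneg : ∀ x, weberQ deltaZero x < 0 := fun x =>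
    lt_of_le_of_ne (weberQ_deltaZero_nonpos x) (hne x)
  have hcont := continuous_weberQ hd
  obtain ⟨z, -, hz⟩ := (isCompact_Icc (a := (-2 : ℝ)) (b := 2)).exists_isMaxOn
    (nonempty_Icc.2 (by norm_num)) hcont.continuousOn
  -- The cap at `1` serves outside `[-2, 2]`: to the right `Q < -x < -2`, and to the left the
  -- barrier needs `x² - Θ₀ - c² > 0`.
  set c := min 1 (-weberQ deltaZero z) with hc
  have hcpos : 0 < c := lt_min one_pos (by linarith [hneg z])
  have hmid : ∀ x, x ∈ Icc (-2 : ℝ) 2 → weberQ deltaZero x ≤ -c := fun x hx => by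
    have h1 := hz hx
    have h2 := min_le_right 1 (-weberQ deltaZero z)
    change weberQ deltaZero x ≤ weberQ deltaZero z at h1
    linarith
  have hΘ : deGennesConst < 1 := deGennesConst_lt_one
  have hall : ∀ x, weberQ deltaZero x ≤ -c := by
    intro x
    rcases le_or_gt x (-2) with h1 | h1
    · have hd' : ∀ s, HasDerivAt (fun s => weberQ deltaZero (-s))
          (-((-s) ^ 2 - (1 - 2 * deltaZero) - weberQ deltaZero (-s) ^ 2)) s := fun s => by
        have := (hasDerivAt_weberQ hd (-s)).scomp s (hasDerivAt_neg s)
        simpa [Function.comp_def] using this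
      -- Going left from `-2`, whenever `Q = -c` the Riccati equation gives slope `-(s² - Θ₀ - c²) <
      -- 0` in `s = -x ≥ 2`, so the level `-c` cannot be crossed upwards.
      have := image_le_of_deriv_right_lt_deriv_boundary (a := 2) (b := -x)
        (f := fun s => weberQ deltaZero (-s)) (B := fun _ => -c) (B' := fun _ => 0)
        (Continuous.continuousOn (by fun_prop)) (fun s _ => (hd' s).hasDerivWithinAt)
        (hmid _ (by norm_num)) (fun s => hasDerivAt_const s _) (fun s hs he => ?_)
        (x := -x) ⟨by linarith, le_rfl⟩
      · simpa using this
      · rw [he, one_sub_two_mul_deltaZero]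
        have hc1 : c ≤ 1 := min_le_left _ _
        nlinarith [hs.1]
    · rcases le_or_gt x 2 with h2 | h2
      · exact hmid x ⟨h1.le, h2⟩
      · have := weberQ_lt hd x
        have hc1 : c ≤ 1 := min_le_left _ _
        linarith
  -- With `p = Q + c`, the quantity `p' + p²` equals `x² - Θ₀ + 2 c Q + c²`, at most `x² - (Θ₀ +
  -- c²)` because `Q ≤ -c`.
  have := le_deGennesConst (lam := deGennesConst + c ^ 2)
    (p := fun x => weberQ deltaZero x + c)
    (p' := fun x => x ^ 2 - (1 - 2 * deltaZero) - weberQ deltaZero x ^ 2)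
    (fun x => (hasDerivAt_weberQ hd x).add_const c) (by fun_prop)
    (fun x => by linarith [hall x]) (fun x => by
      rw [one_sub_two_mul_deltaZero]
      nlinarith [hall x])
  nlinarith

/-- `√Θ₀`, the minimising parameter. -/
def xiZero : ℝ := Real.sqrt deGennesConst

/-- The zero is a maximum because the function is nonpositive, so the Riccati equation there reads
`x² = Θ₀`; `Q < -x` makes `x` negative. Positivity of `Θ₀` comes out as a by-product. -/
lemma weberQ_deltaZero_xiZero : weberQ deltaZero (-xiZero) = 0 ∧ 0 < xiZero := by
  obtain ⟨x, hx⟩ := exists_weberQ_deltaZero_eq_zero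
  have hd := deltaZero_pos
  have hmax : IsLocalMax (weberQ deltaZero) x :=
    Eventually.of_forall fun y => by rw [hx]; exact weberQ_deltaZero_nonpos y
  have h0 := hmax.hasDerivAt_eq_zero (hasDerivAt_weberQ hd x)
  rw [hx, one_sub_two_mul_deltaZero] at h0
  have hneg : x < 0 := by have := weberQ_lt hd x; linarith
  have : xiZero = -x := by
    rw [xiZero, show deGennesConst = (-x) ^ 2 by linarith, Real.sqrt_sq (by linarith)]
  rw [this, neg_neg]
  exact ⟨hx, by linarith⟩

lemma xiZero_pos : 0 < xiZero := weberQ_deltaZero_xiZero.2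

lemma pcf_deltaZero_add_one : pcf (deltaZero + 1) (-xiZero) = xiZero * pcf deltaZero (-xiZero) := by
  have h := weberQ_deltaZero_xiZero.1
  have := (pcf_pos deltaZero_pos (-xiZero)).ne'
  simp only [weberQ, neg_neg] at h
  field_simp at h
  linarith

lemma deGennesConst_pos : 0 < deGennesConst := Real.sqrt_pos.1 xiZero_pos

lemma deltaZero_lt : deltaZero < 1 / 2 := by
  have := deGennesConst_pos
  simp only [deltaZero]; linarith

/-! ### The Kummer weight at large `N` and the convergence of its moments. -/

/-- The weight `e^(-N y/2) (1 + y/N)^M` of the scaled Kummer integral. -/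
def diskWeight (N M y : ℝ) : ℝ := Real.exp (-N * y / 2 + M * Real.log (1 + y / N))

/-- The derivative of `diskWeight`. -/
def diskWeight' (N M y : ℝ) : ℝ := diskWeight N M y * (-N / 2 + M / (N + y))

/-- The limit `e^(-y²/4 + √Θ₀ y)` of `diskWeight`. -/
def limitWeight (y : ℝ) : ℝ := Real.exp (-y ^ 2 / 4 + xiZero * y)

lemma diskWeight_pos (N M y : ℝ) : 0 < diskWeight N M y := Real.exp_pos _

lemma diskWeight_zero (N M : ℝ) : diskWeight N M 0 = 1 := by simp [diskWeight]

lemma hasDerivAt_diskWeight {N : ℝ} (hN : 0 < N) (M : ℝ) {y : ℝ} (hy : 0 ≤ y) :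
    HasDerivAt (diskWeight N M) (diskWeight' N M y) y := by
  have h0 : 1 + y / N ≠ 0 := by positivity
  have h1 : HasDerivAt (fun y : ℝ => 1 + y / N) (1 / N) y := by
    simpa using ((hasDerivAt_id y).div_const N).const_add 1
  have h2 : HasDerivAt (fun y : ℝ => -N * y / 2) (-N / 2) y := by
    simpa using (((hasDerivAt_id y).const_mul (-N)).div_const 2)
  refine (h2.add ((h1.log h0).const_mul M)).exp.congr_deriv ?_
  have : N + y ≠ 0 := by positivity
  simp only [diskWeight', diskWeight, Pi.add_apply]
  congr 2
  field_simp

lemma diskWeight'_ode {N : ℝ} (hN : 0 < N) (M : ℝ) {y : ℝ} (hy : 0 ≤ y) :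
    (N + 1 * y) * diskWeight' N M y = ((M - N ^ 2 / 2) + -N / 2 * y) * diskWeight N M y := by
  have : N + y ≠ 0 := by positivity
  simp only [diskWeight']
  field_simp
  ring

lemma continuousOn_diskWeight {N : ℝ} (hN : 0 < N) (M : ℝ) :
    ContinuousOn (diskWeight N M) (Ici 0) := fun _ hy =>
  (hasDerivAt_diskWeight hN M hy).continuousAt.continuousWithinAt

/-- For fixed `N` the logarithm grows more slowly than any linear function, so any rate below `N/2`
is available. In the variable `σ` this gives holomorphy on `Re σ > -N/2`. -/
lemma expKernel_diskWeight {N : ℝ} (hN : 0 < N) (M : ℝ) {Λ : ℝ} (hΛ : Λ < N / 2) :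
    ExpKernel (diskWeight N M) Λ := by
  -- Slope allowed for the logarithm: `|M| η` must not exceed `N/2 - Λ`; the `+ 1` covers `M = 0`.
  set η := (N / 2 - Λ) / (|M| + 1) with hη
  have hM : 0 < |M| + 1 := by positivity
  have hη0 : 0 < η := div_pos (by linarith) hM
  set K := η * N - 1 - Real.log (η * N) with hK
  refine ⟨continuousOn_diskWeight hN M, fun y _ => diskWeight_pos _ _ _,
    Real.exp (|M| * K), Real.exp_pos _, fun y hy => ?_⟩
  have hz : 0 < 1 + y / N := by positivity
  have h0 : 0 ≤ Real.log (1 + y / N) :=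
    Real.log_nonneg (by have : 0 ≤ y / N := by positivity
                        linarith)
  have h1 : Real.log (1 + y / N) ≤ η * y + K := by
    have := Real.log_le_sub_one_of_pos (mul_pos hz (mul_pos hη0 hN))
    rw [Real.log_mul hz.ne' (mul_pos hη0 hN).ne'] at this
    have e : (1 + y / N) * (η * N) = η * y + η * N := by field_simp; ring
    rw [hK]; linarith
  rw [diskWeight, ← Real.exp_add, Real.exp_le_exp]
  have h2 : M * Real.log (1 + y / N) ≤ |M| * (η * y + K) :=
    (mul_le_mul_of_nonneg_right (le_abs_self M) h0).trans
      (mul_le_mul_of_nonneg_left h1 (abs_nonneg M))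
  have h3 : |M| * η ≤ N / 2 - Λ := by
    have : (|M| + 1) * η = N / 2 - Λ := by rw [hη]; field_simp
    linarith
  nlinarith [mul_le_mul_of_nonneg_right h3 hy]

/-- This is `l ≤ sinh l` at `l = log (1 + z)`. It retains the quadratic gain with the correct
constant near `0` and still a linear gain for large `z`. -/
lemma log_one_add_le {z : ℝ} (hz : 0 ≤ z) : Real.log (1 + z) ≤ z - z ^ 2 / (2 * (1 + z)) := by
  have h1 : 0 < 1 + z := by linarith
  have h := Real.self_le_sinh_iff.2 (Real.log_nonneg (by linarith : 1 ≤ 1 + z))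
  rw [Real.sinh_log h1] at h
  refine h.trans (le_of_eq ?_)
  field_simp
  ring

lemma abs_exp_sub_exp_le {a b C : ℝ} (ha : Real.exp a ≤ C) (hb : Real.exp b ≤ C) :
    |Real.exp a - Real.exp b| ≤ C * |a - b| := by
  have key : ∀ u v : ℝ, Real.exp u ≤ C → Real.exp u - Real.exp v ≤ C * |u - v| := by
    intro u v hu
    have h1 : Real.exp v = Real.exp u * Real.exp (v - u) := by rw [← Real.exp_add]; ring_nf
    have h2 := Real.add_one_le_exp (v - u)
    have h3 := Real.exp_pos u
    calc Real.exp u - Real.exp v ≤ Real.exp u * (u - v) := by rw [h1]; nlinarith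
      _ ≤ Real.exp u * |u - v| := mul_le_mul_of_nonneg_left (le_abs_self _) h3.le
      _ ≤ _ := mul_le_mul_of_nonneg_right hu (abs_nonneg _)
  rw [abs_le]
  constructor
  · have := key b a hb
    rw [abs_sub_comm] at this
    linarith
  · exact key a b ha

/-- With `z = y/N`, the linear part of `log (1 + z)` cancels `-N y/2`, the quadratic part gives
`-y²/4`, and the remainder is cubic; the term `√Θ₀ N` of the exponent supplies `√Θ₀ y`. -/
lemma diskExponent_sub_le {N c C y : ℝ} (hN : 1 ≤ N) (hc : |c| ≤ C) (hy : 0 ≤ y) :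
    |(-N * y / 2 + (N ^ 2 / 2 + xiZero * N + c) * Real.log (1 + y / N))
      - (-y ^ 2 / 4 + xiZero * y)| ≤ (y ^ 3 + xiZero * y ^ 2 + C * y) / N := by
  have hN0 : 0 < N := by linarith
  have hξ := xiZero_pos
  set z := y / N with hz
  have hyz : y = N * z := by rw [hz]; field_simp
  have hz0 : 0 ≤ z := by positivity
  set l := Real.log (1 + z)
  have u1 : l ≤ z - z ^ 2 / 2 + z ^ 3 / 2 := by
    refine (log_one_add_le hz0).trans ?_
    have : z ^ 2 / (2 * (1 + z)) = z ^ 2 / 2 - z ^ 3 / (2 * (1 + z)) := by field_simp; ring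
    have h2 : z ^ 3 / (2 * (1 + z)) ≤ z ^ 3 / 2 :=
      div_le_div_of_nonneg_left (by positivity) (by norm_num) (by linarith)
    linarith
  have u2 : l ≤ z := by
    have := Real.log_le_sub_one_of_pos (by linarith : 0 < 1 + z)
    linarith
  have l1 : z - z ^ 2 / 2 ≤ l := by
    refine le_trans ?_ (Real.le_log_one_add_of_nonneg hz0)
    rw [le_div_iff₀ (by linarith)]
    nlinarith [pow_nonneg hz0 3]
  have l0 : 0 ≤ l := Real.log_nonneg (by linarith)
  have e : (-N * y / 2 + (N ^ 2 / 2 + xiZero * N + c) * l) - (-y ^ 2 / 4 + xiZero * y)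
      = N ^ 2 / 2 * (l - (z - z ^ 2 / 2)) + (-(xiZero * N * (z - l)) + c * l) := by
    rw [hyz]; ring
  have e2 : (y ^ 3 + xiZero * y ^ 2 + C * y) / N
      = N ^ 2 * z ^ 3 + (xiZero * N * z ^ 2 + C * z) := by
    rw [hyz]; field_simp; ring
  rw [e, e2]
  refine (abs_add_le _ _).trans (add_le_add ?_ ((abs_add_le _ _).trans (add_le_add ?_ ?_)))
  · rw [abs_of_nonneg (mul_nonneg (by positivity) (by linarith))]
    have : l - (z - z ^ 2 / 2) ≤ 2 * z ^ 3 := by nlinarith [pow_nonneg hz0 3]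
    calc _ ≤ N ^ 2 / 2 * (2 * z ^ 3) := mul_le_mul_of_nonneg_left this (by positivity)
      _ = _ := by ring
  · rw [abs_neg, abs_of_nonneg (mul_nonneg (by positivity) (by linarith))]
    exact mul_le_mul_of_nonneg_left (by nlinarith) (by positivity)
  · rw [abs_mul, abs_of_nonneg l0]
    exact mul_le_mul hc u2 l0 ((abs_nonneg _).trans hc)

lemma limitWeight_le (Λ : ℝ) (y : ℝ) :
    limitWeight y ≤ Real.exp ((Λ + xiZero) ^ 2) * Real.exp (-Λ * y) := by
  rw [limitWeight, ← Real.exp_add, Real.exp_le_exp]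
  nlinarith [sq_nonneg (y / 2 - (Λ + xiZero))]

lemma expKernel_limitWeight (Λ : ℝ) : ExpKernel limitWeight Λ :=
  ⟨by unfold limitWeight; fun_prop, fun y _ => Real.exp_pos _, _, Real.exp_pos _,
    fun y _ => limitWeight_le Λ y⟩

lemma realMoment_limitWeight (b σ : ℝ) : realMoment limitWeight b σ = pcf b (σ - xiZero) := by
  unfold realMoment pcf realMoment
  congr 1 with y
  rw [limitWeight, gaussWeight, mul_assoc, mul_assoc, ← Real.exp_add, ← Real.exp_add]
  ring_nf

/-- The gain `-(N/4) y²/(N + y)` from the logarithm is Gaussian for small `y` and linear for large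
`y`. Its linear rate grows with `N`, so for `N` large it absorbs `√Θ₀ y`, `c` and any prescribed
rate, uniformly. -/
lemma diskWeight_le (C Λ : ℝ) : ∃ N₀ D : ℝ, 1 ≤ N₀ ∧ 0 < D ∧ ∀ N c y : ℝ, N₀ ≤ N → |c| ≤ C →
    0 ≤ y → diskWeight N (N ^ 2 / 2 + xiZero * N + c) y ≤ D * Real.exp (-Λ * y) := by
  have hξ := xiZero_pos
  -- The gain will be at least `n (y - n)/4`, so `n/4` must exceed the three linear terms to be
  -- absorbed; `n²/4` is what remains in the constant.
  set n := 4 * (xiZero + |C| + |Λ|) + 1 with hn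
  have hn1 : 1 ≤ n := by have := abs_nonneg C; have := abs_nonneg Λ; linarith
  refine ⟨n, Real.exp (n ^ 2 / 4), hn1, Real.exp_pos _, fun N c y hN hc hy => ?_⟩
  have hN1 : 1 ≤ N := hn1.trans hN
  have hN0 : 0 < N := by linarith
  rw [diskWeight, ← Real.exp_add, Real.exp_le_exp]
  have hz0 : 0 ≤ y / N := by positivity
  set l := Real.log (1 + y / N)
  have u2 : l ≤ y / N := by
    have := Real.log_le_sub_one_of_pos (by linarith : 0 < 1 + y / N)
    linarith
  have l0 : 0 ≤ l := Real.log_nonneg (by linarith)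
  have u3 : N ^ 2 / 2 * l ≤ N * y / 2 - n * (y - n) / 4 := by
    have h1 := mul_le_mul_of_nonneg_left (log_one_add_le hz0) (by positivity : 0 ≤ N ^ 2 / 2)
    refine h1.trans ?_
    have h2 : N ^ 2 / 2 * (y / N - (y / N) ^ 2 / (2 * (1 + y / N)))
        = N * y / 2 - N * (y ^ 2 / (N + y)) / 4 := by
      field_simp
      ring
    rw [h2]
    have h3 : n * (y - n) ≤ N * (y ^ 2 / (N + y)) := by
      rw [← mul_div_assoc, le_div_iff₀ (by positivity)]
      rcases le_or_gt y n with h | h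
      · have a1 : n * (y - n) ≤ 0 := mul_nonpos_of_nonneg_of_nonpos (by linarith) (by linarith)
        have a2 : n * (y - n) * (N + y) ≤ 0 :=
          mul_nonpos_of_nonpos_of_nonneg a1 (by linarith)
        exact a2.trans (by positivity)
      · have a1 : 0 ≤ (N - n) * y ^ 2 := mul_nonneg (by linarith) (sq_nonneg y)
        have a2 : 0 ≤ (N - n) * (n * n) := mul_nonneg (by linarith) (by positivity)
        have a3 : 0 ≤ (N - n) * (y - n) := mul_nonneg (by linarith) (by linarith)
        have a4 : 0 ≤ (N - n) * (y - n) * y := mul_nonneg a3 hy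
        have a5 : 0 ≤ n * n * n := by positivity
        nlinarith
    linarith
  have u4 : xiZero * N * l ≤ xiZero * y := by
    calc _ ≤ xiZero * N * (y / N) := mul_le_mul_of_nonneg_left u2 (by positivity)
      _ = _ := by field_simp
  have u5 : c * l ≤ |C| * y := by
    have h1 : l ≤ y := u2.trans (div_le_self hy hN1)
    calc c * l ≤ |C| * l :=
          mul_le_mul_of_nonneg_right ((le_abs_self c).trans (hc.trans (le_abs_self C))) l0
      _ ≤ _ := mul_le_mul_of_nonneg_left h1 (abs_nonneg C)
  have u6 : Λ * y ≤ |Λ| * y := mul_le_mul_of_nonneg_right (le_abs_self Λ) hy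
  nlinarith

/-- Uniform exponential bounds and convergence of `diskWeight` to `limitWeight`. -/
lemma diskWeight_estimates (C : ℝ) : ∃ N₀ D : ℝ, 1 ≤ N₀ ∧ 0 < D ∧ ∀ N c y : ℝ, N₀ ≤ N → |c| ≤ C →
    0 ≤ y → diskWeight N (N ^ 2 / 2 + xiZero * N + c) y ≤ D * Real.exp (-1 * y) ∧
      |diskWeight N (N ^ 2 / 2 + xiZero * N + c) y - limitWeight y| ≤ D / N * Real.exp (-1 * y) ∧
      |diskWeight' N (N ^ 2 / 2 + xiZero * N + c) y| ≤ D * Real.exp (-1 * y) := by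
  -- Rate `2` instead of `1`: one factor `e^(-y)` is spent on the polynomials in the exponent
  -- difference and in the logarithmic derivative.
  obtain ⟨N₀, D, hN₀, hD, hb⟩ := diskWeight_le C 2
  have hξ := xiZero_pos
  set D' := max D (Real.exp ((2 + xiZero) ^ 2)) with hD'
  have hD'0 : 0 < D' := lt_max_of_lt_left hD
  have hK : 0 ≤ |C| := abs_nonneg C
  set K := 6 + 2 * xiZero + |C| with hKdef
  have hK1 : 1 ≤ K := by linarith
  refine ⟨N₀, D' * K, hN₀, by positivity, fun N c y hN hc hy => ?_⟩
  have hN1 : 1 ≤ N := hN₀.trans hN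
  have hN0 : 0 < N := by linarith
  have hc' : |c| ≤ |C| := hc.trans (le_abs_self C)
  have hexp : Real.exp (-2 * y) * Real.exp y = Real.exp (-1 * y) := by
    rw [← Real.exp_add]; ring_nf
  have hexp1 : Real.exp (-2 * y) ≤ Real.exp (-1 * y) := by
    rw [Real.exp_le_exp]; linarith
  have hW : diskWeight N (N ^ 2 / 2 + xiZero * N + c) y ≤ D' * Real.exp (-2 * y) :=
    (hb N c y hN hc hy).trans (mul_le_mul_of_nonneg_right (le_max_left _ _) (Real.exp_pos _).le)
  have hG : limitWeight y ≤ D' * Real.exp (-2 * y) :=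
    (limitWeight_le 2 y).trans (mul_le_mul_of_nonneg_right (le_max_right _ _) (Real.exp_pos _).le)
  have y1 : y ≤ Real.exp y := by have := Real.add_one_le_exp y; linarith
  have y2 : y ^ 2 ≤ 2 * Real.exp y := by
    have := Real.pow_div_factorial_le_exp y hy 2
    norm_num [Nat.factorial] at this; linarith
  have y3 : y ^ 3 ≤ 6 * Real.exp y := by
    have := Real.pow_div_factorial_le_exp y hy 3
    norm_num [Nat.factorial] at this; linarith
  refine ⟨?_, ?_, ?_⟩
  · calc _ ≤ D' * Real.exp (-2 * y) := hW
      _ ≤ D' * Real.exp (-1 * y) := mul_le_mul_of_nonneg_left hexp1 hD'0.le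
      _ ≤ D' * K * Real.exp (-1 * y) := by
        refine mul_le_mul_of_nonneg_right ?_ (Real.exp_pos _).le
        exact le_mul_of_one_le_right hD'0.le hK1
  · have h1 := abs_exp_sub_exp_le hW hG
    refine h1.trans ?_
    have h2 := diskExponent_sub_le hN1 hc' hy
    have h3 : y ^ 3 + xiZero * y ^ 2 + |C| * y ≤ K * Real.exp y := by
      have := mul_le_mul_of_nonneg_left y2 hξ.le
      have := mul_le_mul_of_nonneg_left y1 hK
      rw [hKdef]; linarith
    calc _ ≤ D' * Real.exp (-2 * y) * ((y ^ 3 + xiZero * y ^ 2 + |C| * y) / N) :=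
          mul_le_mul_of_nonneg_left h2 (by positivity)
      _ ≤ D' * Real.exp (-2 * y) * (K * Real.exp y / N) := by gcongr
      _ = D' * K / N * (Real.exp (-2 * y) * Real.exp y) := by ring
      _ = _ := by rw [hexp]
  · have h1 : |(-N / 2 + (N ^ 2 / 2 + xiZero * N + c) / (N + y))| ≤ K * Real.exp y := by
      have e : -N / 2 + (N ^ 2 / 2 + xiZero * N + c) / (N + y)
          = (-(N * y / 2) + (xiZero * N + c)) / (N + y) := by field_simp; ring
      rw [e, abs_div, abs_of_pos (by positivity : 0 < N + y), div_le_iff₀ (by positivity)]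
      have a1 : |-(N * y / 2) + (xiZero * N + c)| ≤ N * y / 2 + (xiZero * N + |C|) := by
        refine (abs_add_le _ _).trans (add_le_add ?_ ((abs_add_le _ _).trans (add_le_add ?_ hc')))
        · rw [abs_neg, abs_of_nonneg (by positivity)]
        · rw [abs_of_nonneg (by positivity)]
      have a2 : 1 ≤ Real.exp y := by simpa using hy
      have a3 : y / 2 + xiZero + |C| ≤ K * Real.exp y := by nlinarith
      calc _ ≤ (y / 2 + xiZero + |C|) * N := by nlinarith
        _ ≤ (K * Real.exp y) * N := mul_le_mul_of_nonneg_right a3 hN0.le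
        _ ≤ _ := mul_le_mul_of_nonneg_left (by linarith) (by positivity)
    rw [diskWeight', abs_mul, abs_of_pos (diskWeight_pos _ _ _)]
    calc _ ≤ D' * Real.exp (-2 * y) * (K * Real.exp y) :=
          mul_le_mul hW h1 (abs_nonneg _) (by positivity)
      _ = D' * K * (Real.exp (-2 * y) * Real.exp y) := by ring
      _ = _ := by rw [hexp]

lemma rpow_sub_one_mul_exp_integral {b : ℝ} (hb : 0 < b) :
    ∫ y in Ioi (0 : ℝ), y ^ (b - 1) * Real.exp (-1 * y) = Real.Gamma b := by
  have := Real.integral_rpow_mul_exp_neg_mul_Ioi hb one_pos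
  simpa using this

lemma continuousOn_Gamma_Ioi : ContinuousOn Real.Gamma (Ioi 0) := fun x hx =>
  (Real.differentiableAt_Gamma fun m => by
    have hx : 0 < x := hx
    have : (0 : ℝ) ≤ m := Nat.cast_nonneg m
    linarith).continuousAt.continuousWithinAt

lemma Gamma_bddOn (l u : ℝ) (hl : 0 < l) : ∃ G : ℝ, 0 < G ∧ ∀ b ∈ Icc l u, Real.Gamma b ≤ G := by
  obtain ⟨G, hG⟩ := (isCompact_Icc (a := l) (b := u)).bddAbove_image
    (continuousOn_Gamma_Ioi.mono fun x hx => hl.trans_le hx.1)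
  exact ⟨max G 1, by positivity, fun b hb => (hG ⟨b, hb, rfl⟩).trans (le_max_left _ _)⟩

/-- Moments of `diskWeight` are uniformly bounded and converge to those of `limitWeight`. -/
lemma realMoment_diskWeight_estimates (C : ℝ) : ∃ N₀ D : ℝ, 3 ≤ N₀ ∧ 0 < D ∧
    ∀ N c b σ : ℝ, N₀ ≤ N → |c| ≤ C → 0 < b → 0 ≤ σ →
      realMoment (diskWeight N (N ^ 2 / 2 + xiZero * N + c)) b σ ≤ D * Real.Gamma b ∧
      |realMoment (diskWeight N (N ^ 2 / 2 + xiZero * N + c)) b σ - pcf b (σ - xiZero)|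
        ≤ D / N * Real.Gamma b := by
  obtain ⟨N₀, D, hN₀, hD, hest⟩ := diskWeight_estimates C
  refine ⟨max N₀ 3, D, le_max_right _ _, hD, fun N c b σ hN hc hb hσ => ?_⟩
  have hN' : N₀ ≤ N := (le_max_left _ _).trans hN
  have hN3 : 3 ≤ N := (le_max_right _ _).trans hN
  have hN0 : 0 < N := by linarith
  have hG := expKernel_limitWeight 1
  have hW := expKernel_diskWeight hN0 (N ^ 2 / 2 + xiZero * N + c) (Λ := 1) (by linarith)
  have iW := hW.integrableOn hb (σ := σ) (by linarith)
  have iG := hG.integrableOn hb (σ := σ) (by linarith)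
  have i1 := integrableOn_rpow_mul_exp hb one_pos
  rw [← realMoment_limitWeight]
  constructor
  · rw [← rpow_sub_one_mul_exp_integral hb, ← integral_const_mul, realMoment]
    refine setIntegral_mono_on iW (i1.const_mul _) measurableSet_Ioi fun y hy => ?_
    have hy : 0 < y := hy
    have h1 := (hest N c y hN' hc hy.le).1
    have h2 : Real.exp (-σ * y) ≤ 1 := Real.exp_le_one_iff.2 (by nlinarith)
    have h3 := Real.rpow_pos_of_pos hy (b - 1)
    have h4 := (diskWeight_pos N (N ^ 2 / 2 + xiZero * N + c) y).le
    calc _ ≤ y ^ (b - 1) * diskWeight N (N ^ 2 / 2 + xiZero * N + c) y :=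
          mul_le_of_le_one_right (by positivity) h2
      _ ≤ y ^ (b - 1) * (D * Real.exp (-1 * y)) := mul_le_mul_of_nonneg_left h1 h3.le
      _ = _ := by ring
  · rw [← rpow_sub_one_mul_exp_integral hb, ← integral_const_mul, realMoment, realMoment,
      ← integral_sub iW iG, ← Real.norm_eq_abs]
    refine norm_integral_le_of_norm_le (i1.const_mul _) ?_
    refine (ae_restrict_iff' measurableSet_Ioi).2 (ae_of_all _ fun y hy => ?_)
    have hy : 0 < y := hy
    have h1 := (hest N c y hN' hc hy.le).2.1
    have h2 : Real.exp (-σ * y) ≤ 1 := Real.exp_le_one_iff.2 (by nlinarith)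
    have h3 := Real.rpow_pos_of_pos hy (b - 1)
    rw [← sub_mul, ← mul_sub, norm_mul, norm_mul, Real.norm_eq_abs, Real.norm_eq_abs,
      Real.norm_eq_abs, abs_of_pos h3, abs_of_pos (Real.exp_pos _)]
    calc _ ≤ y ^ (b - 1) * |diskWeight N (N ^ 2 / 2 + xiZero * N + c) y - limitWeight y| :=
          mul_le_of_le_one_right (by positivity) h2
      _ ≤ y ^ (b - 1) * (D / N * Real.exp (-1 * y)) := mul_le_mul_of_nonneg_left h1 h3.le
      _ = _ := by ring

/-! ### The Neumann equation and its root near `δ₀`. -/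

/-- `∫₀^∞ (y - ξ₀) y^(a-1) e^(-y²/4 + ξ₀ y) dy`, which vanishes at `a = δ₀`. -/
def neumannDefect (a : ℝ) : ℝ := pcf (a + 1) (-xiZero) - xiZero * pcf a (-xiZero)

lemma neumannDefect_deltaZero : neumannDefect deltaZero = 0 := by
  rw [neumannDefect, pcf_deltaZero_add_one, sub_self]

lemma neumannDefect_eq {a : ℝ} (ha : 0 < a) :
    neumannDefect a = ∫ y in Ioi (0 : ℝ), (y - xiZero) * y ^ (a - 1) * limitWeight y := by
  have e : ∀ b, pcf b (-xiZero) = realMoment limitWeight b 0 := fun b => by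
    rw [realMoment_limitWeight, zero_sub]
  have i1 := (expKernel_limitWeight 1).integrableOn (b := a + 1) (by linarith) (σ := 0) (by norm_num)
  have i0 := (expKernel_limitWeight 1).integrableOn ha (σ := 0) (by norm_num)
  rw [neumannDefect, e, e, realMoment, realMoment, ← integral_const_mul,
    ← integral_sub i1 (i0.const_mul _)]
  refine setIntegral_congr_fun measurableSet_Ioi fun y hy => ?_
  have hy : 0 < y := hy
  have e1 : y ^ (a + 1 - 1) = y ^ (a - 1) * y := by
    rw [← Real.rpow_add_one hy.ne']; ring_nf
  simp only [e1]
  simp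
  ring

lemma integrableOn_neumannDefect {a : ℝ} (ha : 0 < a) :
    IntegrableOn (fun y => (y - xiZero) * y ^ (a - 1) * limitWeight y) (Ioi 0) := by
  have i1 := (expKernel_limitWeight 1).integrableOn (b := a + 1) (by linarith) (σ := 0) (by norm_num)
  have i0 := (expKernel_limitWeight 1).integrableOn ha (σ := 0) (by norm_num)
  refine IntegrableOn.congr_fun (i1.sub (i0.const_mul xiZero)) (fun y hy => ?_) measurableSet_Ioi
  have hy : 0 < y := hy
  have e1 : y ^ (a + 1 - 1) = y ^ (a - 1) * y := by
    rw [← Real.rpow_add_one hy.ne']; ring_nf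
  simp only [Pi.sub_apply, e1]
  simp
  ring

/-- The integrand `w` of the defect at `δ₀` has integral zero and the sign of `y - ξ`. Hence the
defect at `δ₀ + e` is `ξ^e ∫ w ((y/ξ)^e - 1)`, whose integrand has the sign of `e` throughout, and
any fixed window of `y` already gives a bound linear in `e`. -/
lemma exists_neumannDefect_bound : ∃ k : ℝ, 0 < k ∧ ∀ ε, 0 < ε → ε ≤ deltaZero / 2 →
    k * ε ≤ neumannDefect (deltaZero + ε) ∧ neumannDefect (deltaZero - ε) ≤ -(k * ε) := by
  have hd := deltaZero_pos
  have hd2 := deltaZero_lt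
  have hξ := xiZero_pos
  set ξ := xiZero with hξdef
  set w : ℝ → ℝ := fun y => (y - ξ) * y ^ (deltaZero - 1) * limitWeight y with hw
  have iw : IntegrableOn w (Ioi 0) := integrableOn_neumannDefect hd
  have w0 : ∫ y in Ioi (0 : ℝ), w y = 0 := by
    rw [← neumannDefect_eq hd, neumannDefect_deltaZero]
  -- On this window `y/ξ ≥ 2` makes `(y/ξ)^e - 1` at least `e log 2` for `e > 0`, and `y/ξ ≤ 3`
  -- controls the inverse power needed for negative `e`.
  set S : Set ℝ := Ioo (2 * ξ) (3 * ξ) with hS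
  have hSsub : S ⊆ Ioi 0 := fun y hy => by have := hy.1; simp only [mem_Ioi]; linarith
  have wpos : ∀ y ∈ S, 0 < w y := fun y hy => by
    have h1 : 0 < y := hSsub hy
    have h2 : 0 < y - ξ := by have := hy.1; linarith
    have := Real.rpow_pos_of_pos h1 (deltaZero - 1)
    have : 0 < limitWeight y := Real.exp_pos _
    simp only [hw]; positivity
  set k0 := ∫ y in S, w y with hk0
  have hk0pos : 0 < k0 := by
    rw [hk0, integral_pos_iff_support_of_nonneg_ae _ (iw.mono_set hSsub)]
    · rw [Measure.restrict_apply' measurableSet_Ioo]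
      refine lt_of_lt_of_le ?_ (measure_mono (s := S) fun y hy => ⟨(wpos y hy).ne', hy⟩)
      simp only [hS, Real.volume_Ioo, ENNReal.ofReal_pos]; linarith
    · exact (ae_restrict_iff' measurableSet_Ioo).2 (ae_of_all _ fun y hy => (wpos y hy).le)
  have hl2 : 0 < Real.log 2 := Real.log_pos one_lt_two
  have key : ∀ e : ℝ, 0 < deltaZero + e → |e| ≤ 1 →
      ∀ y, 0 < y → w y * ((y / ξ) ^ e - 1) * ξ ^ e
        = (y - ξ) * y ^ (deltaZero + e - 1) * limitWeight y - ξ ^ e * w y := by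
    intro e he _ y hy
    have e1 : y ^ (deltaZero + e - 1) = y ^ (deltaZero - 1) * y ^ e := by
      rw [← Real.rpow_add hy]; ring_nf
    have e2 := (Real.rpow_pos_of_pos hξ e).ne'
    rw [e1, Real.div_rpow hy.le hξ.le]
    simp only [hw]
    field_simp
  have keyI : ∀ e : ℝ, 0 < deltaZero + e → |e| ≤ 1 →
      IntegrableOn (fun y => w y * ((y / ξ) ^ e - 1)) (Ioi 0) ∧
      neumannDefect (deltaZero + e) = ξ ^ e * ∫ y in Ioi (0 : ℝ), w y * ((y / ξ) ^ e - 1) := by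
    intro e he he1
    have i2 := (integrableOn_neumannDefect he).sub (iw.const_mul (ξ ^ e))
    have e2 := (Real.rpow_pos_of_pos hξ e)
    have i3 : IntegrableOn (fun y => w y * ((y / ξ) ^ e - 1) * ξ ^ e) (Ioi 0) :=
      IntegrableOn.congr_fun i2 (fun y hy => (key e he he1 y hy).symm) measurableSet_Ioi
    constructor
    · have := i3.mul_const (ξ ^ e)⁻¹
      refine IntegrableOn.congr_fun this (fun y _ => ?_) measurableSet_Ioi
      field_simp
    · rw [mul_comm, ← integral_mul_const,
        setIntegral_congr_fun measurableSet_Ioi (fun y hy => key e he he1 y hy),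
        integral_sub (integrableOn_neumannDefect he) (iw.const_mul _), integral_const_mul, w0,
        mul_zero, sub_zero, neumannDefect_eq he]
  have hsign : ∀ e y : ℝ, 0 < y → 0 < e → 0 ≤ w y * ((y / ξ) ^ e - 1) := by
    intro e y hy he
    have h1 := Real.rpow_pos_of_pos hy (deltaZero - 1)
    have h2 : 0 < limitWeight y := Real.exp_pos _
    have h3 : 0 ≤ (y - ξ) * ((y / ξ) ^ e - 1) := by
      rcases le_total y ξ with h | h
      · exact mul_nonneg_of_nonpos_of_nonpos (by linarith)
          (by have := Real.rpow_le_one (by positivity) ((div_le_one hξ).2 h) he.le; linarith)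
      · exact mul_nonneg (by linarith)
          (by have := Real.one_le_rpow ((one_le_div hξ).2 h) he.le; linarith)
    have : w y * ((y / ξ) ^ e - 1)
        = (y - ξ) * ((y / ξ) ^ e - 1) * (y ^ (deltaZero - 1) * limitWeight y) := by
      simp only [hw]; ring
    rw [this]; positivity
  have hlow : ∀ e y : ℝ, y ∈ S → 0 < e → e * Real.log 2 ≤ (y / ξ) ^ e - 1 := by
    intro e y hy he
    have h2 : 2 ≤ y / ξ := by rw [le_div_iff₀ hξ]; exact hy.1.le
    have h1 : (2 : ℝ) ^ e ≤ (y / ξ) ^ e := Real.rpow_le_rpow (by norm_num) h2 he.le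
    have h3 : Real.log 2 * e + 1 ≤ (2 : ℝ) ^ e := by
      rw [Real.rpow_def_of_pos two_pos]; exact Real.add_one_le_exp _
    linarith
  have hξm : ∀ e : ℝ, |e| ≤ 1 → min ξ ξ⁻¹ ≤ ξ ^ e := by
    intro e he
    rw [abs_le] at he
    rcases le_total 1 ξ with h | h
    · refine (min_le_right _ _).trans ?_
      rw [← Real.rpow_neg_one]
      exact Real.rpow_le_rpow_of_exponent_le h he.1
    · refine (min_le_left _ _).trans ?_
      nth_rw 1 [← Real.rpow_one ξ]
      exact Real.rpow_le_rpow_of_exponent_ge hξ h he.2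
  have hmpos : 0 < min ξ ξ⁻¹ := lt_min hξ (inv_pos.2 hξ)
  -- The minimum bounds `ξ^e` from below for `|e| ≤ 1`; the `3` is needed only below `δ₀`.
  refine ⟨min ξ ξ⁻¹ * (Real.log 2 * k0 / 3), by positivity, fun ε hε hε2 => ⟨?_, ?_⟩⟩
  · have h1 : |ε| ≤ 1 := by rw [abs_of_pos hε]; linarith
    obtain ⟨i1, e1⟩ := keyI ε (by linarith) h1
    have h2 : ε * Real.log 2 * k0 ≤ ∫ y in Ioi (0 : ℝ), w y * ((y / ξ) ^ ε - 1) := by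
      calc ε * Real.log 2 * k0 = ∫ y in S, ε * Real.log 2 * w y := by rw [integral_const_mul]
        _ ≤ ∫ y in S, w y * ((y / ξ) ^ ε - 1) :=
          setIntegral_mono_on ((iw.mono_set hSsub).const_mul _) (i1.mono_set hSsub)
            measurableSet_Ioo fun y hy => by
              rw [mul_comm]; exact mul_le_mul_of_nonneg_left (hlow ε y hy hε) (wpos y hy).le
        _ ≤ _ := setIntegral_mono_set i1
          ((ae_restrict_iff' measurableSet_Ioi).2 (ae_of_all _ fun y hy => hsign ε y hy hε))
          (Eventually.of_forall hSsub)
    rw [e1]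
    have h3 : 0 ≤ ε * Real.log 2 * k0 := by positivity
    calc _ = min ξ ξ⁻¹ * (ε * Real.log 2 * k0 / 3) := by ring
      _ ≤ ξ ^ ε * (∫ y in Ioi (0 : ℝ), w y * ((y / ξ) ^ ε - 1)) :=
        mul_le_mul (hξm ε h1) (by linarith) (by positivity) (Real.rpow_pos_of_pos hξ _).le
  · have h1 : |-ε| ≤ 1 := by rw [abs_neg, abs_of_pos hε]; linarith
    obtain ⟨i1, e1⟩ := keyI (-ε) (by linarith) h1
    have hneg : ∀ y, 0 < y → w y * ((y / ξ) ^ (-ε) - 1)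
        = -(w y * ((y / ξ) ^ ε - 1) * ((y / ξ) ^ ε)⁻¹) := by
      intro y hy
      rw [Real.rpow_neg (by positivity)]
      have := (Real.rpow_pos_of_pos (show 0 < y / ξ by positivity) ε).ne'
      field_simp
      ring
    have h2 : ε * Real.log 2 * k0 / 3 ≤ ∫ y in Ioi (0 : ℝ), -(w y * ((y / ξ) ^ (-ε) - 1)) := by
      calc ε * Real.log 2 * k0 / 3 = ∫ y in S, ε * Real.log 2 / 3 * w y := by
            rw [integral_const_mul]; ring
        _ ≤ ∫ y in S, -(w y * ((y / ξ) ^ (-ε) - 1)) :=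
          setIntegral_mono_on ((iw.mono_set hSsub).const_mul _) (i1.neg.mono_set hSsub)
            measurableSet_Ioo fun y hy => by
              have hy0 : 0 < y := hSsub hy
              rw [hneg y hy0, neg_neg]
              have hz3 : (y / ξ) ^ ε ≤ 3 := by
                have a1 : y / ξ ≤ 3 := by rw [div_le_iff₀ hξ]; exact hy.2.le
                have a2 : (1 : ℝ) ≤ y / ξ := by rw [le_div_iff₀ hξ]; have := hy.1; linarith
                calc (y / ξ) ^ ε ≤ (y / ξ) ^ (1 : ℝ) :=
                      Real.rpow_le_rpow_of_exponent_le a2 (by linarith)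
                  _ ≤ 3 := by rw [Real.rpow_one]; exact a1
              have hzp := Real.rpow_pos_of_pos (show 0 < y / ξ by positivity) ε
              have hinv : (3 : ℝ)⁻¹ ≤ ((y / ξ) ^ ε)⁻¹ := inv_anti₀ hzp hz3
              calc ε * Real.log 2 / 3 * w y = w y * (ε * Real.log 2) * 3⁻¹ := by ring
                _ ≤ w y * ((y / ξ) ^ ε - 1) * ((y / ξ) ^ ε)⁻¹ :=
                  mul_le_mul (mul_le_mul_of_nonneg_left (hlow ε y hy hε) (wpos y hy).le) hinv
                    (by norm_num) (hsign ε y hy0 hε)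
        _ ≤ _ := setIntegral_mono_set i1.neg
          ((ae_restrict_iff' measurableSet_Ioi).2 (ae_of_all _ fun y hy => by
            have hy : 0 < y := hy
            simp only [Pi.zero_apply]
            rw [hneg y hy, neg_neg]
            exact mul_nonneg (hsign ε y hy hε) (by positivity)))
          (Eventually.of_forall hSsub)
    rw [integral_neg] at h2
    rw [sub_eq_add_neg, e1]
    have : min ξ ξ⁻¹ * (ε * Real.log 2 * k0 / 3)
        ≤ ξ ^ (-ε) * -(∫ y in Ioi (0 : ℝ), w y * ((y / ξ) ^ (-ε) - 1)) :=
      mul_le_mul (hξm (-ε) h1) h2 (by positivity) (Real.rpow_pos_of_pos hξ _).le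
    linarith

lemma diskWeight_mono {N M M' y : ℝ} (hN : 0 < N) (hy : 0 ≤ y) (h : M ≤ M') :
    diskWeight N M y ≤ diskWeight N M' y := by
  have : 0 ≤ Real.log (1 + y / N) :=
    Real.log_nonneg (by have : 0 ≤ y / N := by positivity
                        linarith)
  rw [diskWeight, diskWeight, Real.exp_le_exp]
  nlinarith

lemma rpow_le_rpow_add_rpow {y a l u : ℝ} (hy : 0 < y) (hl : l ≤ a) (hu : a ≤ u) :
    y ^ a ≤ y ^ l + y ^ u := by
  have h1 := Real.rpow_pos_of_pos hy l
  have h2 := Real.rpow_pos_of_pos hy u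
  rcases le_total y 1 with h | h
  · have := Real.rpow_le_rpow_of_exponent_ge hy h hl; linarith
  · have := Real.rpow_le_rpow_of_exponent_le h hu; linarith

/-- The parameter `a` enters both the power of `y` and the exponent of the weight. The weight is
largest with exponent `m`, and the power is bounded by the sum of its two extreme cases. -/
lemma continuousOn_realMoment_diskWeight {N : ℝ} (hN : 0 < N) (m : ℝ) {k l u : ℝ} (hk : 0 ≤ k)
    (hl : 0 < l) (hlu : l ≤ u) :
    ContinuousOn (fun a => realMoment (diskWeight N (m - a)) (a + k) 0) (Icc l u) := by
  have hW := expKernel_diskWeight hN m (Λ := N / 4) (by linarith)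
  refine continuousOn_of_dominated
    (bound := fun y => y ^ (l + k - 1) * diskWeight N m y * Real.exp (-0 * y)
      + y ^ (u + k - 1) * diskWeight N m y * Real.exp (-0 * y)) (fun a ha => ?_) (fun a ha => ?_)
    ((hW.integrableOn (by linarith) (by linarith)).add
      (hW.integrableOn (by linarith) (by linarith))) ?_
  · have hWa := expKernel_diskWeight hN (m - a) (Λ := N / 4) (by linarith)
    exact (hWa.integrableOn (b := a + k) (by linarith [ha.1]) (σ := 0)
      (by linarith)).aestronglyMeasurable
  · refine (ae_restrict_iff' measurableSet_Ioi).2 (ae_of_all _ fun y hy => ?_)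
    have hy : 0 < y := hy
    have h1 := rpow_le_rpow_add_rpow hy (a := a + k - 1) (l := l + k - 1) (u := u + k - 1)
      (by linarith [ha.1]) (by linarith [ha.2])
    have h2 := diskWeight_mono hN hy.le (show m - a ≤ m by linarith [ha.1])
    have h3 := Real.rpow_pos_of_pos hy (a + k - 1)
    have h4 := diskWeight_pos N (m - a) y
    rw [Real.norm_eq_abs, abs_of_pos (by positivity), ← add_mul, ← add_mul]
    have := Real.rpow_pos_of_pos hy (l + k - 1)
    have := Real.rpow_pos_of_pos hy (u + k - 1)
    gcongr
  · refine (ae_restrict_iff' measurableSet_Ioi).2 (ae_of_all _ fun y hy => ?_)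
    have hy : 0 < y := hy
    refine ContinuousOn.mul (ContinuousOn.mul ?_ ?_) continuousOn_const
    · exact fun a _ => (Real.continuousAt_const_rpow hy.ne').comp_continuousWithinAt
        (f := fun a => a + k - 1) (by fun_prop)
    · unfold diskWeight
      fun_prop

/-- The Neumann condition for the decaying solution at finite `N` has a root close to `δ₀`. -/
lemma exists_neumann_root (C : ℝ) : ∃ N₀ : ℝ, 3 ≤ N₀ ∧ ∀ N m : ℝ, N₀ ≤ N →
    |m - N ^ 2 / 2 - xiZero * N| ≤ C →
    ∃ a, |a - deltaZero| ≤ (Real.sqrt N)⁻¹ ∧ deltaZero / 2 ≤ a ∧ a ≤ 3 / 4 ∧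
      N * realMoment (diskWeight N (m - a)) (a + 1) 0
        = (m - N ^ 2 / 2) * realMoment (diskWeight N (m - a)) a 0 := by
  have hd := deltaZero_pos
  have hd2 := deltaZero_lt
  have hξ := xiZero_pos
  obtain ⟨N₁, D, hN₁, hD, hest⟩ := realMoment_diskWeight_estimates (|C| + 1)
  obtain ⟨k, hk, hdef⟩ := exists_neumannDefect_bound
  obtain ⟨G, hG, hΓ⟩ := Gamma_bddOn (deltaZero / 2) 2 (by linarith)
  set K := D * G + xiZero * (D * G) + |C| * (D * G) with hK
  have hK0 : 0 < K := by positivity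
  -- With `ε = N^(-1/2)`, the approximation error is `K ε²` against a defect of size at least `k ε`.
  -- The first entry gives `K ε < k`; the second keeps `δ₀ ± ε` within `δ₀/2` of `δ₀`.
  set s := max (K / k + 1) (2 / deltaZero) with hs
  refine ⟨max N₁ (s ^ 2), le_max_of_le_left hN₁, fun N m hN hm => ?_⟩
  have hN1 : N₁ ≤ N := (le_max_left _ _).trans hN
  have hN0 : 0 < N := by linarith
  have hs0 : 0 < s := lt_max_of_lt_left (by positivity)
  have hsN : s ≤ Real.sqrt N := by
    rw [← Real.sqrt_sq hs0.le]
    exact Real.sqrt_le_sqrt ((le_max_right _ _).trans hN)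
  have hsq : 0 < Real.sqrt N := hs0.trans_le hsN
  set ε := (Real.sqrt N)⁻¹ with hε
  have hε0 : 0 < ε := inv_pos.2 hsq
  have hεN : ε ^ 2 = N⁻¹ := by rw [hε, inv_pow, Real.sq_sqrt hN0.le]
  have hε2 : ε ≤ deltaZero / 2 := by
    have h1 : 2 / deltaZero ≤ Real.sqrt N := (le_max_right _ _).trans hsN
    rw [hε, inv_le_comm₀ hsq (by positivity), inv_div]
    exact h1
  have hKε : K * ε < k := by
    have h1 : K / k + 1 ≤ Real.sqrt N := (le_max_left _ _).trans hsN
    rw [hε, ← div_eq_mul_inv, div_lt_iff₀ hsq]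
    have h2 : K = k * (K / k) := by field_simp
    nlinarith
  set f : ℝ → ℝ := fun a => realMoment (diskWeight N (m - a)) (a + 1) 0
    - (m - N ^ 2 / 2) / N * realMoment (diskWeight N (m - a)) a 0 with hf
  have hcont : ContinuousOn f (Icc (deltaZero - ε) (deltaZero + ε)) := by
    refine ContinuousOn.sub ?_ (continuousOn_const.mul ?_)
    · exact continuousOn_realMoment_diskWeight hN0 m zero_le_one (by linarith) (by linarith)
    · have := continuousOn_realMoment_diskWeight hN0 m le_rfl
        (l := deltaZero - ε) (u := deltaZero + ε) (by linarith) (by linarith)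
      simpa using this
  have happrox : ∀ a, deltaZero / 2 ≤ a → a ≤ 1 → |f a - neumannDefect a| ≤ K * ε ^ 2 := by
    intro a ha ha1
    have hM : m - a = N ^ 2 / 2 + xiZero * N + (m - N ^ 2 / 2 - xiZero * N - a) := by ring
    have hc : |m - N ^ 2 / 2 - xiZero * N - a| ≤ |C| + 1 := by
      refine (abs_sub _ _).trans (add_le_add (hm.trans (le_abs_self C)) ?_)
      rw [abs_of_nonneg (by linarith)]; exact ha1
    have h1 := (hest N _ (a + 1) 0 hN1 hc (by linarith) le_rfl).2
    have h0 := hest N _ a 0 hN1 hc (by linarith) le_rfl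
    rw [← hM, zero_sub] at h1 h0
    have G1 := hΓ (a + 1) ⟨by linarith, by linarith⟩
    have G0 := hΓ a ⟨by linarith, by linarith⟩
    have hDN : 0 ≤ D / N := by positivity
    have h1' := h1.trans (mul_le_mul_of_nonneg_left G1 hDN)
    have h0' := h0.2.trans (mul_le_mul_of_nonneg_left G0 hDN)
    have h0'' := h0.1.trans (mul_le_mul_of_nonneg_left G0 hD.le)
    have hpos : 0 < realMoment (diskWeight N (m - a)) a 0 :=
      (expKernel_diskWeight hN0 (m - a) (Λ := 1) (by linarith)).realMoment_pos (by linarith)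
        (by norm_num)
    set A := realMoment (diskWeight N (m - a)) (a + 1) 0
    set B := realMoment (diskWeight N (m - a)) a 0
    have e : f a - neumannDefect a = (A - pcf (a + 1) (-xiZero))
        + (-(xiZero * (B - pcf a (-xiZero))) + -((m - N ^ 2 / 2 - xiZero * N) / N * B)) := by
      simp only [hf, neumannDefect]
      field_simp
      ring
    have e2 : K * ε ^ 2 = D / N * G + (xiZero * (D / N * G) + |C| / N * (D * G)) := by
      rw [hεN, hK]; ring
    rw [e, e2]
    refine (abs_add_le _ _).trans (add_le_add h1' ((abs_add_le _ _).trans (add_le_add ?_ ?_)))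
    · rw [abs_neg, abs_mul, abs_of_pos hξ]
      exact mul_le_mul_of_nonneg_left h0' hξ.le
    · rw [abs_neg, abs_mul, abs_div, abs_of_pos hN0, abs_of_pos hpos]
      exact mul_le_mul (div_le_div_of_nonneg_right (hm.trans (le_abs_self C)) hN0.le) h0'' hpos.le
        (by positivity)
  have hkε : K * ε ^ 2 ≤ k * ε := by nlinarith
  obtain ⟨d1, d2⟩ := hdef ε hε0 hε2
  have b1 := abs_le.1 (happrox (deltaZero + ε) (by linarith) (by linarith))
  have b2 := abs_le.1 (happrox (deltaZero - ε) (by linarith) (by linarith))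
  obtain ⟨a, ha, hfa⟩ := intermediate_value_Icc (by linarith) hcont
    (show (0 : ℝ) ∈ Icc (f (deltaZero - ε)) (f (deltaZero + ε)) from
      ⟨by linarith [b2.2], by linarith [b1.1]⟩)
  refine ⟨a, abs_le.2 ⟨by linarith [ha.1], by linarith [ha.2]⟩, by linarith [ha.1],
    by linarith [ha.2], ?_⟩
  simp only [hf] at hfa
  field_simp at hfa
  linarith

/-- On `y ≤ 1` the extra factor `y` is at most `1`; on `y ≥ 1` the integral is `O(e^(-σ))`, which
the mass of the lower moment on `(0, 1)` dominates. The constant is thus uniform in `σ ≥ 0`, as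
needed to bound logarithmic derivatives up to infinity. -/
lemma ExpKernel.realMoment_succ_le {g : ℝ → ℝ} {Λ : ℝ} (hg : ExpKernel g Λ) (hΛ : 0 < Λ) {b : ℝ}
    (hb : 0 < b) : ∃ K, 0 < K ∧ ∀ σ, 0 ≤ σ → realMoment g (b + 1) σ ≤ K * realMoment g b σ := by
  set A := realMoment g (b + 1) 0
  have hA : 0 < A := hg.realMoment_pos (by linarith) (by linarith)
  have hint0 := hg.integrableOn hb (σ := 0) (by linarith)
  have hint1 := hg.integrableOn (b := b + 1) (by linarith) (σ := 0) (by linarith)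
  have hpos : ∀ b σ y : ℝ, 0 < y → 0 < y ^ (b - 1) * g y * Real.exp (-σ * y) := fun b σ y hy => by
    have := hg.pos y hy.le
    have := Real.rpow_pos_of_pos hy (b - 1)
    positivity
  have hsub : Ioo (0 : ℝ) 1 ⊆ Ioi 0 := fun y hy => hy.1
  set c := ∫ y in Ioo (0 : ℝ) 1, y ^ (b - 1) * g y * Real.exp (-0 * y)
  have hc : 0 < c := by
    rw [integral_pos_iff_support_of_nonneg_ae _ (hint0.mono_set hsub)]
    · rw [Measure.restrict_apply' measurableSet_Ioo]
      refine lt_of_lt_of_le ?_ (measure_mono (s := Ioo 0 1) fun y hy => ⟨(hpos b 0 y hy.1).ne', hy⟩)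
      simp
    · exact (ae_restrict_iff' measurableSet_Ioo).2 (ae_of_all _ fun y hy => (hpos b 0 y hy.1).le)
  refine ⟨1 + A / c, by positivity, fun σ hσ => ?_⟩
  have i0 := hg.integrableOn hb (σ := σ) (by linarith)
  have i1 := hg.integrableOn (b := b + 1) (by linarith) (σ := σ) (by linarith)
  have h1 : realMoment g (b + 1) σ ≤ realMoment g b σ + Real.exp (-σ) * A := by
    simp only [realMoment, A]
    rw [← integral_const_mul, ← integral_add i0 (hint1.const_mul _)]
    refine setIntegral_mono_on i1 (i0.add (hint1.const_mul _)) measurableSet_Ioi fun y hy => ?_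
    have hy : 0 < y := hy
    have e : y ^ (b + 1 - 1) = y ^ (b - 1) * y := by
      rw [← Real.rpow_add_one hy.ne']; ring_nf
    rcases le_total y 1 with h | h
    · have p0 := hpos b σ y hy
      have p1 := hpos (b + 1) 0 y hy
      have : y ^ (b + 1 - 1) * g y * Real.exp (-σ * y)
          = (y ^ (b - 1) * g y * Real.exp (-σ * y)) * y := by rw [e]; ring
      rw [this]
      have := mul_le_of_le_one_right p0.le h
      have := mul_pos (Real.exp_pos (-σ)) p1
      linarith
    · have p0 := hpos b σ y hy
      have : Real.exp (-σ * y) ≤ Real.exp (-σ) := by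
        rw [Real.exp_le_exp]; nlinarith
      have h3 := hg.pos y hy.le
      have h4 := Real.rpow_pos_of_pos hy (b + 1 - 1)
      have := mul_le_mul_of_nonneg_left this (mul_pos h4 h3).le
      simp only [neg_zero, zero_mul, Real.exp_zero, mul_one]
      linarith
  have h2 : Real.exp (-σ) * c ≤ realMoment g b σ := by
    rw [← integral_const_mul]
    refine le_trans (setIntegral_mono_on ((hint0.mono_set hsub).const_mul _) (i0.mono_set hsub)
      measurableSet_Ioo fun y hy => ?_) (setIntegral_mono_set i0
      ((ae_restrict_iff' measurableSet_Ioi).2 (ae_of_all _ fun y hy => (hpos b σ y hy).le))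
      (Eventually.of_forall hsub))
    have h3 := hg.pos y hy.1.le
    have h4 := Real.rpow_pos_of_pos hy.1 (b - 1)
    have : Real.exp (-σ) ≤ Real.exp (-σ * y) := by
      rw [Real.exp_le_exp]; nlinarith [hy.2, hy.1]
    simp only [neg_zero, zero_mul, Real.exp_zero, mul_one]
    rw [mul_comm]
    exact mul_le_mul_of_nonneg_left this (mul_pos h4 h3).le
  have h3 : Real.exp (-σ) * A ≤ A / c * realMoment g b σ := by
    calc _ = A / c * (Real.exp (-σ) * c) := by field_simp
      _ ≤ _ := mul_le_mul_of_nonneg_left h2 (by positivity)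
  linarith

/-! ### The explicit decaying solution of the radial equation. -/

/-- The scaled variable `(N/2) (r²/R² - 1)`. -/
def layerVar (N R r : ℝ) : ℝ := N / 2 * (r ^ 2 / R ^ 2 - 1)

/-- The prefactor `(r/R)^m e^(-(N²/4) (r²/R² - 1))`. -/
def radialPre (N R : ℝ) (m : ℤ) (r : ℝ) : ℝ :=
  (r / R) ^ m * Real.exp (-(N ^ 2 / 4) * (r ^ 2 / R ^ 2 - 1))

/-- The decaying solution of the radial equation with eigenvalue `h B (1 - 2 a)`. -/
def radialSol (N R : ℝ) (m : ℤ) (a r : ℝ) : ℝ :=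
  radialPre N R m r * realMoment (diskWeight N (m - a)) a (layerVar N R r)

/-- The derivative of `radialSol`. -/
def radialSol' (N R : ℝ) (m : ℤ) (a r : ℝ) : ℝ :=
  radialPre N R m r * ((m / r - N ^ 2 * r / (2 * R ^ 2))
      * realMoment (diskWeight N (m - a)) a (layerVar N R r)
    - N * r / R ^ 2 * realMoment (diskWeight N (m - a)) (a + 1) (layerVar N R r))

section
variable {N R a r : ℝ} {m : ℤ}

lemma layerVar_gt (hN : 0 < N) (hR : 0 < R) (hr : 0 < r) : -(N / 2) < layerVar N R r := by
  have : 0 < N / 2 * (r ^ 2 / R ^ 2) := by positivity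
  simp only [layerVar]; linarith

lemma layerVar_nonneg (hN : 0 < N) (hR : 0 < R) (hr : R ≤ r) : 0 ≤ layerVar N R r := by
  have : 1 ≤ r ^ 2 / R ^ 2 := by
    rw [one_le_div (by positivity)]; exact pow_le_pow_left₀ hR.le hr 2
  exact mul_nonneg (by positivity) (by linarith)

lemma layerVar_self (hR : 0 < R) : layerVar N R R = 0 := by
  simp [layerVar, div_self (pow_ne_zero 2 hR.ne')]

lemma hasDerivAt_layerVar (r : ℝ) : HasDerivAt (layerVar N R) (N * r / R ^ 2) r := by
  have := ((((hasDerivAt_pow 2 r).div_const (R ^ 2)).sub_const 1).const_mul (N / 2))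
  refine this.congr_deriv ?_
  simp only [Nat.cast_ofNat, Nat.add_one_sub_one, pow_one]
  ring

lemma radialPre_pos (hR : 0 < R) (hr : 0 < r) : 0 < radialPre N R m r :=
  mul_pos (zpow_pos (div_pos hr hR) _) (Real.exp_pos _)

lemma hasDerivAt_radialPre (hR : 0 < R) (hr : 0 < r) :
    HasDerivAt (radialPre N R m)
      (radialPre N R m r * (m / r - N ^ 2 * r / (2 * R ^ 2))) r := by
  have h1 : HasDerivAt (fun r : ℝ => (r / R) ^ m) (m * (r / R) ^ (m - 1) * (1 / R)) r := by
    have := (hasDerivAt_zpow m (r / R) (Or.inl (by positivity))).comp r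
      ((hasDerivAt_id r).div_const R)
    simpa [Function.comp_def] using this
  have h2 : HasDerivAt (fun r : ℝ => -(N ^ 2 / 4) * (r ^ 2 / R ^ 2 - 1))
      (-(N ^ 2 / 4) * (2 * r / R ^ 2)) r := by
    simpa using ((((hasDerivAt_pow 2 r).div_const (R ^ 2)).sub_const 1).const_mul (-(N ^ 2 / 4)))
  refine (h1.mul h2.exp).congr_deriv ?_
  rw [zpow_sub_one₀ (by positivity)]
  simp only [radialPre]
  field_simp
  ring

lemma expKernel_radial (hN : 0 < N) (hR : 0 < R) (hr : 0 < r) (M : ℝ) :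
    ∃ Λ, ExpKernel (diskWeight N M) Λ ∧ -Λ < layerVar N R r := by
  obtain ⟨Λ, h1, h2⟩ := exists_between (layerVar_gt hN hR hr)
  exact ⟨-Λ, expKernel_diskWeight hN M (by linarith), by linarith⟩

lemma hasDerivAt_realMoment_layerVar (hN : 0 < N) (hR : 0 < R) (hr : 0 < r) (M : ℝ) {b : ℝ}
    (hb : 0 < b) : HasDerivAt (fun r => realMoment (diskWeight N M) b (layerVar N R r))
      (-realMoment (diskWeight N M) (b + 1) (layerVar N R r) * (N * r / R ^ 2)) r := by
  obtain ⟨Λ, hW, hΛ⟩ := expKernel_radial hN hR hr M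
  exact (hW.hasDerivAt_realMoment hb hΛ).comp r (hasDerivAt_layerVar r)

lemma radialSol_pos (hN : 0 < N) (hR : 0 < R) (ha : 0 < a) (hr : 0 < r) :
    0 < radialSol N R m a r := by
  obtain ⟨Λ, hW, hΛ⟩ := expKernel_radial hN hR hr (m - a)
  exact mul_pos (radialPre_pos hR hr) (hW.realMoment_pos ha hΛ)

lemma hasDerivAt_radialSol (hN : 0 < N) (hR : 0 < R) (ha : 0 < a) (hr : 0 < r) :
    HasDerivAt (radialSol N R m a) (radialSol' N R m a r) r := by
  refine ((hasDerivAt_radialPre hR hr).mul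
    (hasDerivAt_realMoment_layerVar hN hR hr (m - a) ha)).congr_deriv ?_
  simp only [radialSol']
  ring

/-- Derivatives of the moment shift `a` by one, so the second order equation is a relation between
three consecutive moments: the integration by parts recurrence of the weight, i.e. Kummer's
equation. -/
lemma hasDerivAt_mul_radialSol' (hN : 0 < N) (hR : 0 < R) (ha : 0 < a) (hr : 0 < r) :
    HasDerivAt (fun r => r * radialSol' N R m a r)
      (((m - N ^ 2 * r ^ 2 / (2 * R ^ 2)) ^ 2 / r - N ^ 2 / R ^ 2 * (1 - 2 * a) * r)
        * radialSol N R m a r) r := by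
  obtain ⟨Λ, hW, hΛ⟩ := expKernel_radial hN hR hr (m - a)
  have hrec := hW.recurrence (fun y hy => hasDerivAt_diskWeight hN _ hy.le)
    (fun y hy => diskWeight'_ode hN _ hy.le) ha hΛ
  have d0 := hasDerivAt_realMoment_layerVar hN hR hr (m - a) ha
  have d1 := hasDerivAt_realMoment_layerVar hN hR hr (m - a) (b := a + 1) (by linarith)
  rw [show a + 1 + 1 = a + 2 by ring] at d1
  have dp := hasDerivAt_radialPre (N := N) (m := m) hR hr
  have c0 : HasDerivAt (fun r : ℝ => (m - N ^ 2 * r ^ 2 / (2 * R ^ 2) : ℝ))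
      (-(N ^ 2 * (2 * r) / (2 * R ^ 2))) r := by
    simpa using (((hasDerivAt_pow 2 r).const_mul (N ^ 2)).div_const (2 * R ^ 2)).const_sub (m : ℝ)
  have c1 : HasDerivAt (fun r : ℝ => N * r ^ 2 / R ^ 2) (N * (2 * r) / R ^ 2) r := by
    simpa using ((hasDerivAt_pow 2 r).const_mul N).div_const (R ^ 2)
  have hd := dp.mul ((c0.mul d0).sub (c1.mul d1))
  have hev : (fun r => r * radialSol' N R m a r) =ᶠ[𝓝 r] fun r =>
      radialPre N R m r * ((m - N ^ 2 * r ^ 2 / (2 * R ^ 2))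
        * realMoment (diskWeight N (m - a)) a (layerVar N R r)
        - N * r ^ 2 / R ^ 2 * realMoment (diskWeight N (m - a)) (a + 1) (layerVar N R r)) := by
    filter_upwards [lt_mem_nhds hr] with s hs
    simp only [radialSol']
    field_simp
  refine (HasDerivAt.congr_of_eventuallyEq hd hev).congr_deriv ?_
  simp only [radialSol, Pi.mul_apply, Pi.sub_apply]
  set F0 := realMoment (diskWeight N (m - a)) a (layerVar N R r)
  set F1 := realMoment (diskWeight N (m - a)) (a + 1) (layerVar N R r)
  set F2 := realMoment (diskWeight N (m - a)) (a + 2) (layerVar N R r)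
  -- Twice the recurrence after substituting `σ = (N/2)(r²/R² - 1)`: the constant parts cancel and
  -- `a` drops out of the middle coefficient.
  have hrec2 : 2 * a * N * F0 + (2 + 2 * m - N ^ 2 * (r ^ 2 / R ^ 2)) * F1
      - N * (r ^ 2 / R ^ 2) * F2 = 0 := by
    have : layerVar N R r = N / 2 * (r ^ 2 / R ^ 2 - 1) := rfl
    rw [this] at hrec
    linear_combination 2 * hrec
  have e : (r ^ 2 / R ^ 2) * R ^ 2 = r ^ 2 := by field_simp
  field_simp at hrec2 ⊢
  linear_combination (-(4 * N * r ^ 2 * radialPre N R m r)) * hrec2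

lemma radialSol'_self (hR : 0 < R) (h : N * realMoment (diskWeight N (m - a)) (a + 1) 0
    = (m - N ^ 2 / 2) * realMoment (diskWeight N (m - a)) a 0) : radialSol' N R m a R = 0 := by
  simp only [radialSol', layerVar_self hR]
  have : (m / R - N ^ 2 * R / (2 * R ^ 2)) * realMoment (diskWeight N (m - a)) a 0
      - N * R / R ^ 2 * realMoment (diskWeight N (m - a)) (a + 1) 0 = 0 := by
    have e : (m / R - N ^ 2 * R / (2 * R ^ 2)) = (m - N ^ 2 / 2) / R := by field_simp
    have e2 : N * R / R ^ 2 = N / R := by field_simp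
    rw [e, e2, div_mul_eq_mul_div, ← h]
    ring
  rw [this, mul_zero]

/-- The linear growth of the logarithmic derivative is what makes the boundary term of the Wronskian
comparison controllable at infinity. -/
lemma abs_radialSol'_le (hN : 0 < N) (hR : 0 < R) (ha : 0 < a) :
    ∃ K, 0 < K ∧ ∀ r, R ≤ r → |radialSol' N R m a r| ≤ K * r * radialSol N R m a r := by
  obtain ⟨K, hK, hb⟩ := (expKernel_diskWeight hN (m - a) (Λ := N / 4)
    (by linarith)).realMoment_succ_le (by linarith) ha
  refine ⟨|(m : ℝ)| / R ^ 2 + N ^ 2 / (2 * R ^ 2) + N / R ^ 2 * K, by positivity, fun r hr => ?_⟩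
  have hr0 : 0 < r := hR.trans_le hr
  have hp := radialPre_pos (N := N) (m := m) hR hr0
  have hW := expKernel_diskWeight hN (m - a) (Λ := N / 4) (by linarith)
  have hσ := layerVar_nonneg hN hR hr
  have h0 := hW.realMoment_pos ha (σ := layerVar N R r) (by linarith)
  have h1 := hW.realMoment_pos (b := a + 1) (by linarith) (σ := layerVar N R r) (by linarith)
  have h2 := hb _ hσ
  rw [radialSol', radialSol, abs_mul, abs_of_pos hp]
  set F0 := realMoment (diskWeight N (m - a)) a (layerVar N R r)
  set F1 := realMoment (diskWeight N (m - a)) (a + 1) (layerVar N R r)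
  have a1 : |(m / r - N ^ 2 * r / (2 * R ^ 2)) * F0 - N * r / R ^ 2 * F1|
      ≤ (|(m : ℝ)| / R ^ 2 * r + N ^ 2 / (2 * R ^ 2) * r) * F0 + N * r / R ^ 2 * (K * F0) := by
    refine (abs_sub _ _).trans (add_le_add ?_ ?_)
    · rw [abs_mul, abs_of_pos h0]
      refine mul_le_mul_of_nonneg_right ((abs_sub _ _).trans (add_le_add ?_ ?_)) h0.le
      · rw [abs_div, abs_of_pos hr0, div_mul_eq_mul_div, div_le_div_iff₀ hr0 (by positivity),
          mul_assoc]
        exact mul_le_mul_of_nonneg_left (by nlinarith) (abs_nonneg _)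
      · rw [abs_of_nonneg (by positivity)]
        exact le_of_eq (by ring)
    · rw [abs_of_pos (by positivity)]
      exact mul_le_mul_of_nonneg_left h2 (by positivity)
  calc _ ≤ radialPre N R m r * _ := mul_le_mul_of_nonneg_left a1 hp.le
    _ = _ := by ring

lemma radialSol_le_exp (hN : 0 < N) (hR : 0 < R) (ha : 0 < a) (hm : 0 ≤ m) :
    ∃ K, 0 < K ∧ ∀ r, R ≤ r → radialSol N R m a r ≤ K * Real.exp (-r) ∧
      |radialSol' N R m a r| ≤ K * Real.exp (-r) := by
  obtain ⟨K1, hK1, hder⟩ := abs_radialSol'_le (m := m) hN hR ha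
  obtain ⟨n, rfl⟩ := Int.eq_ofNat_of_zero_le hm
  have hW := expKernel_diskWeight hN (((n : ℤ) : ℝ) - a) (Λ := N / 4) (by linarith)
  set F := realMoment (diskWeight N (((n : ℤ) : ℝ) - a)) a 0
  have hF : 0 < F := hW.realMoment_pos ha (by linarith)
  set κ := N ^ 2 / 4 / R ^ 2 with hκ
  have hκ0 : 0 < κ := by positivity
  set E := Real.exp (N ^ 2 / 4) * (n.factorial * (R⁻¹) ^ n) * F with hE
  have hE0 : 0 < E := by positivity
  have key : ∀ r, R ≤ r → radialSol N R n a r ≤ E * Real.exp (r - κ * r ^ 2) := by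
    intro r hr
    have hr0 : 0 < r := hR.trans_le hr
    have h1 := hW.realMoment_antitone ha (σ := 0) (by linarith) (layerVar_nonneg hN hR hr)
    have h2 : (r / R) ^ n ≤ n.factorial * (R⁻¹) ^ n * Real.exp r := by
      have := Real.pow_div_factorial_le_exp r hr0.le n
      rw [div_le_iff₀ (by positivity)] at this
      rw [div_eq_mul_inv, mul_pow]
      calc _ ≤ (Real.exp r * n.factorial) * (R⁻¹) ^ n :=
            mul_le_mul_of_nonneg_right this (by positivity)
        _ = _ := by ring
    have h3 : Real.exp (-(N ^ 2 / 4) * (r ^ 2 / R ^ 2 - 1))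
        = Real.exp (N ^ 2 / 4) * Real.exp (-(κ * r ^ 2)) := by
      rw [← Real.exp_add, hκ]; congr 1; ring
    have h4 : Real.exp (r - κ * r ^ 2) = Real.exp r * Real.exp (-(κ * r ^ 2)) := by
      rw [← Real.exp_add]; ring_nf
    rw [radialSol, radialPre, zpow_natCast, h3, h4]
    calc _ ≤ n.factorial * (R⁻¹) ^ n * Real.exp r
          * (Real.exp (N ^ 2 / 4) * Real.exp (-(κ * r ^ 2))) * F := by
          refine mul_le_mul (mul_le_mul_of_nonneg_right h2 (by positivity)) h1 ?_ (by positivity)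
          exact (hW.realMoment_pos ha (by linarith [layerVar_nonneg hN hR hr])).le
      _ = _ := by rw [hE]; ring
  -- The Gaussian pays for three exponentials: one bounding `(r/R)^n`, one bounding `1 + r`, and one
  -- for the decay claimed.
  have hsq : ∀ r : ℝ, 3 * r - κ * r ^ 2 ≤ 9 / (4 * κ) := by
    intro r
    rw [le_div_iff₀ (by positivity)]
    nlinarith [sq_nonneg (2 * κ * r - 3)]
  have b1 : ∀ r : ℝ, 0 ≤ r → (1 + r) * Real.exp (r - κ * r ^ 2)
      ≤ Real.exp (9 / (4 * κ)) * Real.exp (-r) := by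
    intro r hr
    have := Real.add_one_le_exp r
    calc _ ≤ Real.exp r * Real.exp (r - κ * r ^ 2) :=
          mul_le_mul_of_nonneg_right (by linarith) (Real.exp_pos _).le
      _ = Real.exp (3 * r - κ * r ^ 2) * Real.exp (-r) := by
        rw [← Real.exp_add, ← Real.exp_add]; ring_nf
      _ ≤ _ := mul_le_mul_of_nonneg_right (Real.exp_le_exp.2 (hsq r)) (Real.exp_pos _).le
  refine ⟨(1 + K1) * (E * Real.exp (9 / (4 * κ))), by positivity, fun r hr => ?_⟩
  have hr0 : 0 < r := hR.trans_le hr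
  have k1 := key r hr
  have b2 := b1 r hr0.le
  have e0 := Real.exp_pos (r - κ * r ^ 2)
  have e1 := Real.exp_pos (-r)
  have b3 : E * ((1 + r) * Real.exp (r - κ * r ^ 2))
      ≤ E * (Real.exp (9 / (4 * κ)) * Real.exp (-r)) := mul_le_mul_of_nonneg_left b2 hE0.le
  set Q := E * (Real.exp (9 / (4 * κ)) * Real.exp (-r)) with hQ
  have hQ0 : 0 < Q := by positivity
  have eq : (1 + K1) * (E * Real.exp (9 / (4 * κ))) * Real.exp (-r) = (1 + K1) * Q := by
    rw [hQ]; ring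
  rw [eq]
  have p1 : 0 < E * Real.exp (r - κ * r ^ 2) := by positivity
  have p2 : 0 < r * (E * Real.exp (r - κ * r ^ 2)) := by positivity
  constructor
  · nlinarith
  · refine (hder r hr).trans ?_
    have : K1 * r * radialSol N R n a r ≤ K1 * (r * (E * Real.exp (r - κ * r ^ 2))) := by
      rw [mul_assoc]
      exact mul_le_mul_of_nonneg_left (mul_le_mul_of_nonneg_left k1 hr0.le) hK1.le
    refine this.trans ?_
    have : K1 * (r * (E * Real.exp (r - κ * r ^ 2))) ≤ K1 * Q :=
      mul_le_mul_of_nonneg_left (by nlinarith) hK1.le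
    nlinarith

end

/-! ### Uniqueness of the Neumann ground state. -/

lemma integral_radialMeasure {E : Type*} [NormedAddCommGroup E] [NormedSpace ℝ E] {R : ℝ}
    (hR : 0 < R) (g : ℝ → E) :
    ∫ r, g r ∂(radialMeasure R) = ∫ r in Ioi R, r • g r := by
  rw [radialMeasure, integral_withDensity_eq_integral_toReal_smul (by fun_prop) (by simp)]
  refine setIntegral_congr_fun measurableSet_Ioi fun r hr => ?_
  have hr : R < r := hr
  rw [ENNReal.toReal_ofReal (by linarith)]

lemma integrable_radialMeasure {E : Type*} [NormedAddCommGroup E] [NormedSpace ℝ E] {R : ℝ}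
    (hR : 0 < R) (g : ℝ → E) :
    Integrable g (radialMeasure R) ↔ IntegrableOn (fun r => r • g r) (Ioi R) := by
  rw [radialMeasure, integrable_withDensity_iff_integrable_smul' (by fun_prop) (by simp)]
  refine integrableOn_congr_fun (fun r hr => ?_) measurableSet_Ioi
  have hr : R < r := hr
  rw [ENNReal.toReal_ofReal (by linarith)]

lemma ae_radialMeasure {R : ℝ} (hR : 0 < R) {p : ℝ → Prop} :
    (∀ᵐ r ∂(radialMeasure R), p r) ↔ ∀ᵐ r, R < r → p r := by
  rw [radialMeasure, ae_withDensity_iff (by fun_prop), ae_restrict_iff' measurableSet_Ioi]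
  refine ⟨fun h => ?_, fun h => ?_⟩
  · filter_upwards [h] with r hr h1
    exact hr h1 (by simp; linarith)
  · filter_upwards [h] with r hr h1 _
    exact hr h1

lemma integrable_mul_sq_of_memLp {R : ℝ} (hR : 0 < R) {f : ℝ → ℂ}
    (hf : MemLp f 2 (radialMeasure R)) : IntegrableOn (fun r => r * ‖f r‖ ^ 2) (Ioi R) :=
  (integrable_radialMeasure hR (fun r => ‖f r‖ ^ 2)).1 hf.norm.integrable_sq

lemma memLp_radialMeasure_of_le_exp {R K : ℝ} (hR : 0 < R) {f : ℝ → ℂ}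
    (hf : ContinuousOn f (Ioi R)) (hb : ∀ r, R < r → ‖f r‖ ≤ K * Real.exp (-r)) :
    MemLp f 2 (radialMeasure R) := by
  have hm : AEStronglyMeasurable f (radialMeasure R) :=
    (hf.aestronglyMeasurable measurableSet_Ioi).mono_ac (withDensity_absolutelyContinuous _ _)
  rw [memLp_two_iff_integrable_sq_norm hm, integrable_radialMeasure hR]
  have h1 : IntegrableOn (fun r => K ^ 2 * Real.exp (-r)) (Ioi R) :=
    (integrableOn_exp_neg_Ioi R).const_mul _
  refine Integrable.mono' h1 ?_ ((ae_restrict_iff' measurableSet_Ioi).2 (ae_of_all _ fun r hr => ?_))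
  · exact (continuousOn_id.smul ((hf.norm).pow 2)).aestronglyMeasurable measurableSet_Ioi
  · have hr : R < r := hr
    have hr0 : 0 < r := hR.trans hr
    have h2 := pow_le_pow_left₀ (norm_nonneg _) (hb r hr) 2
    rw [smul_eq_mul, norm_mul, Real.norm_eq_abs, abs_of_pos hr0, norm_pow, norm_norm]
    have h3 : r * Real.exp (-r) ≤ 1 := by
      rw [Real.exp_neg, ← div_eq_mul_inv, div_le_one (Real.exp_pos _)]
      have := Real.add_one_le_exp r
      linarith
    calc _ ≤ r * (K * Real.exp (-r)) ^ 2 := mul_le_mul_of_nonneg_left h2 hr0.le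
      _ = K ^ 2 * Real.exp (-r) * (r * Real.exp (-r)) := by ring
      _ ≤ _ := mul_le_of_le_one_right (by positivity) h3

/-- Uniqueness of the Neumann ground state, by comparison with a positive solution. -/
lemma eq_const_mul_of_neumann {R lam lam' K : ℝ} (hR : 0 < R) {V f f1 g g1 : ℝ → ℝ}
    (hlam : lam ≤ lam') (hfpos : ∀ r, R ≤ r → 0 < f r)
    (hf : ∀ r, R ≤ r → HasDerivAt f (f1 r) r)
    (hf1 : ∀ r, R < r → HasDerivAt (fun r => r * f1 r) (V r * f r - lam' * r * f r) r)
    (hf1c : ContinuousOn f1 (Ici R))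
    (hf0 : f1 R = 0) (hK : ∀ r, R ≤ r → |f1 r| ≤ K * r * f r)
    (hgc : ContinuousOn g (Ici R)) (hg1c : ContinuousOn g1 (Ici R))
    (hg : ∀ r, R < r → HasDerivAt g (g1 r) r)
    (hg1 : ∀ r, R < r → HasDerivAt (fun r => r * g1 r) (V r * g r - lam * r * g r) r)
    (hg0 : g1 R = 0) (hgi : IntegrableOn (fun r => r * g r ^ 2) (Ioi R))
    (hg1i : IntegrableOn (fun r => r * g1 r ^ 2) (Ioi R)) :
    ∃ c, ∀ r, R ≤ r → g r = c * f r := by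
  have hfc : ContinuousOn f (Ici R) := fun r hr => (hf r hr).continuousAt.continuousWithinAt
  set W : ℝ → ℝ := fun r => r * g1 r * f r - g r * (r * f1 r) with hW
  set ψ : ℝ → ℝ := fun r => g r / f r with hψ
  have hne : ∀ r, R ≤ r → f r ≠ 0 := fun r hr => (hfpos r hr).ne'
  have hψc : ContinuousOn ψ (Ici R) := hgc.div hfc fun r hr => hne r hr
  have hWc : ContinuousOn W (Ici R) :=
    ((continuousOn_id.mul hg1c).mul hfc).sub (hgc.mul (continuousOn_id.mul hf1c))
  have hWd : ∀ r, R < r → HasDerivAt W ((lam' - lam) * r * g r * f r) r := by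
    intro r hr
    refine (((hg1 r hr).mul (hf r hr.le)).sub ((hg r hr).mul (hf1 r hr))).congr_deriv ?_
    ring
  have hψd : ∀ r, R < r → HasDerivAt ψ (W r / (r * f r ^ 2)) r := by
    intro r hr
    refine ((hg r hr).div (hf r hr.le) (hne r hr.le)).congr_deriv ?_
    have := hne r hr.le
    have : r ≠ 0 := (hR.trans hr).ne'
    simp only [hW]
    field_simp
  -- Both terms are nonnegative because `lam ≤ lam'`. Thus `W ψ` increases from the value `0` given
  -- at `R` by the two Neumann conditions.
  have hPd : ∀ r, R < r → HasDerivAt (fun r => W r * ψ r)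
      ((lam' - lam) * r * g r ^ 2 + W r ^ 2 / (r * f r ^ 2)) r := by
    intro r hr
    refine ((hWd r hr).mul (hψd r hr)).congr_deriv ?_
    have := hne r hr.le
    simp only [hψ]
    field_simp
  have hPc : ContinuousOn (fun r => W r * ψ r) (Ici R) := hWc.mul hψc
  have hP0 : W R * ψ R = 0 := by simp [hW, hf0, hg0]
  have hmono : MonotoneOn (fun r => W r * ψ r) (Ici R) := by
    refine monotoneOn_of_deriv_nonneg (convex_Ici R) hPc ?_ ?_
    · rw [interior_Ici]
      exact fun r hr => (hPd r hr).differentiableAt.differentiableWithinAt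
    · rw [interior_Ici]
      intro r hr
      have hr : R < r := hr
      have hr0 : 0 < r := hR.trans hr
      rw [(hPd r hr).deriv]
      have : 0 ≤ lam' - lam := by linarith
      positivity
  have hint : IntegrableOn (fun r => (1 + K) * (r * g r ^ 2) * (1 + (R ^ 2)⁻¹)
      + (R ^ 2)⁻¹ * (r * g1 r ^ 2)) (Ioi R) :=
    ((hgi.const_mul (1 + K)).mul_const _).add (hg1i.const_mul _)
  have hbound : ∀ r, R < r → |W r * ψ r / r| ≤ (1 + K) * (r * g r ^ 2) * (1 + (R ^ 2)⁻¹)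
      + (R ^ 2)⁻¹ * (r * g1 r ^ 2) := by
    intro r hr
    have hr0 : 0 < r := hR.trans hr
    have h1 := hfpos r hr.le
    have hK0 : 0 ≤ K := by
      have h2 := (abs_nonneg _).trans (hK r hr.le)
      by_contra! hneg
      have := mul_neg_of_neg_of_pos (mul_neg_of_neg_of_pos hneg hr0) h1
      linarith
    have e : W r * ψ r / r = g1 r * g r - f1 r / f r * g r ^ 2 := by
      simp only [hW, hψ]; field_simp
    have h3 : |f1 r / f r| ≤ K * r := by
      rw [abs_div, abs_of_pos h1, div_le_iff₀ h1]; exact hK r hr.le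
    have h4 : |g1 r * g r| ≤ (R ^ 2)⁻¹ * (r * g r ^ 2) + (R ^ 2)⁻¹ * (r * g1 r ^ 2) + r * g r ^ 2 := by
      have a1 : |g1 r * g r| ≤ (g1 r ^ 2) / (4 * r) + r * g r ^ 2 := by
        have e2 : (g1 r ^ 2) / (4 * r) + r * g r ^ 2 - g1 r * g r
            = (g1 r - 2 * r * g r) ^ 2 / (4 * r) := by field_simp; ring
        have e3 : (g1 r ^ 2) / (4 * r) + r * g r ^ 2 + g1 r * g r
            = (g1 r + 2 * r * g r) ^ 2 / (4 * r) := by field_simp; ring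
        have p2 : 0 ≤ (g1 r - 2 * r * g r) ^ 2 / (4 * r) := by positivity
        have p3 : 0 ≤ (g1 r + 2 * r * g r) ^ 2 / (4 * r) := by positivity
        rw [abs_le]; constructor <;> linarith
      have a2 : (g1 r ^ 2) / (4 * r) ≤ (R ^ 2)⁻¹ * (r * g1 r ^ 2) := by
        rw [div_le_iff₀ (by positivity), inv_mul_eq_div, div_mul_eq_mul_div,
          le_div_iff₀ (by positivity)]
        have : R ^ 2 ≤ r ^ 2 := pow_le_pow_left₀ hR.le hr.le 2
        nlinarith [sq_nonneg (g1 r), mul_le_mul_of_nonneg_left this (sq_nonneg (g1 r)),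
          mul_nonneg (sq_nonneg (g1 r)) (sq_nonneg r)]
      have a3 : 0 ≤ (R ^ 2)⁻¹ * (r * g r ^ 2) := by positivity
      linarith
    have h5 : |f1 r / f r * g r ^ 2| ≤ K * (r * g r ^ 2) := by
      rw [abs_mul, abs_of_nonneg (sq_nonneg (g r)), ← mul_assoc]
      exact mul_le_mul_of_nonneg_right h3 (sq_nonneg _)
    have h6 : 0 ≤ K * (r * g r ^ 2) * (R ^ 2)⁻¹ := by positivity
    rw [e]
    have := abs_sub (g1 r * g r) (f1 r / f r * g r ^ 2)
    linarith
  -- A positive value `p` at `r1` would persist, so `p / r` would be bounded by the integrable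
  -- majorant of `W ψ / r`, contradicting the divergence of `∫ 1/r`.
  have hzero : ∀ r, R ≤ r → W r * ψ r = 0 := by
    intro r1 hr1
    have h0 : 0 ≤ W r1 * ψ r1 := by
      have := hmono self_mem_Ici hr1 hr1
      simpa [hP0] using this
    refine le_antisymm ?_ h0
    by_contra! hpos
    set p := W r1 * ψ r1
    refine not_integrableOn_Ioi_inv (a := r1) ?_
    have h1 : IntegrableOn (fun r => p⁻¹ * ((1 + K) * (r * g r ^ 2) * (1 + (R ^ 2)⁻¹)
      + (R ^ 2)⁻¹ * (r * g1 r ^ 2))) (Ioi r1) :=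
      (hint.mono_set (Ioi_subset_Ioi hr1)).const_mul _
    refine Integrable.mono' h1 measurable_inv.aestronglyMeasurable
      ((ae_restrict_iff' measurableSet_Ioi).2 (ae_of_all _ fun r hr => ?_))
    have hr : r1 < r := hr
    have hRr : R < r := hr1.trans_lt hr
    have hr0 : 0 < r := hR.trans hRr
    have h2 : p ≤ W r * ψ r := hmono hr1 hRr.le hr.le
    have h3 := (le_abs_self _).trans (hbound r hRr)
    rw [Real.norm_eq_abs, abs_of_pos (inv_pos.2 hr0), ← div_eq_inv_mul, le_div_iff₀ hpos]
    refine le_trans ?_ h3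
    rw [div_eq_inv_mul]
    exact mul_le_mul_of_nonneg_left h2 (inv_pos.2 hr0).le
  have hψ0 : ∀ r, R < r → HasDerivAt ψ 0 r := by
    intro r hr
    have hr0 : 0 < r := hR.trans hr
    have h1 : HasDerivAt (fun r => W r * ψ r) 0 r := by
      refine (hasDerivAt_const r (0 : ℝ)).congr_of_eventuallyEq ?_
      filter_upwards [lt_mem_nhds hr] with s hs using hzero s (le_of_lt hs)
    have h2 := h1.unique (hPd r hr)
    have h3 : 0 ≤ lam' - lam := by linarith
    have h4 : 0 ≤ (lam' - lam) * r * g r ^ 2 := by positivity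
    have hf2 : 0 < r * f r ^ 2 := by have := hfpos r hr.le; positivity
    have h5 : 0 ≤ W r ^ 2 / (r * f r ^ 2) := by positivity
    have h6 : W r ^ 2 / (r * f r ^ 2) = 0 := by linarith
    have h7 : W r = 0 := by
      rw [div_eq_zero_iff] at h6
      rcases h6 with h6 | h6
      · exact pow_eq_zero_iff two_ne_zero |>.1 h6
      · exact absurd h6 hf2.ne'
    have := hψd r hr
    rwa [h7, zero_div] at this
  refine ⟨ψ R, fun r hr => ?_⟩
  have : ψ r = ψ R := by
    refine constant_of_has_deriv_right_zero (a := R) (b := r)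
      (hψc.mono Icc_subset_Ici_self) (fun x hx => ?_) r ⟨hr, le_rfl⟩
    -- At `R` itself the quotient has only a one-sided derivative, recovered as the limit of the
    -- interior derivatives.
    rcases hx.1.eq_or_lt with h | h
    · subst h
      refine hasDerivWithinAt_Ici_of_tendsto_deriv (s := Ioi R) ?_ ?_ self_mem_nhdsWithin ?_
      · exact fun x hx => (hψ0 x hx).differentiableAt.differentiableWithinAt
      · exact (hψc R self_mem_Ici).mono Ioi_subset_Ici_self
      · refine tendsto_const_nhds.congr' ?_
        filter_upwards [self_mem_nhdsWithin] with x hx using (hψ0 x hx).deriv.symm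
    · exact (hψ0 x h).hasDerivWithinAt
  rw [← this]
  simp only [hψ]
  rw [div_mul_cancel₀ _ (hne r hr)]

lemma InRadialDomain.hasDerivAt {B R h : ℝ} {m : ℤ} {f : ℝ → ℂ} (hf : InRadialDomain B R h m f)
    {r : ℝ} (hr : R < r) : HasDerivAt f (derivWithin f (Ici R) r) r :=
  (hf.differentiableOn r hr.le).hasDerivWithinAt.hasDerivAt (Ici_mem_nhds hr)

lemma InRadialDomain.continuousOn_derivWithin {B R h : ℝ} {m : ℤ} {f : ℝ → ℂ}
    (hf : InRadialDomain B R h m f) : ContinuousOn (derivWithin f (Ici R)) (Ici R) := by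
  intro r hr
  have hr : R ≤ r := hr
  have h1 := (hf.deriv_ac (r + 1) (by linarith)).continuousOn
  rw [uIcc_of_le (by linarith)] at h1
  refine (h1 r ⟨hr, by linarith⟩).mono_of_mem_nhdsWithin ?_
  rw [← Ici_inter_Iic]
  exact inter_mem_nhdsWithin _ (Iic_mem_nhds (by linarith))

/-- An almost everywhere eigenfunction in the domain solves the radial equation classically. -/
lemma InRadialDomain.hasDerivAt_mul_derivWithin {B R h μ : ℝ} {m : ℤ} {f : ℝ → ℂ} (hR : 0 < R)
    (hh : 0 < h) (hf : InRadialDomain B R h m f)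
    (hae : ∀ᵐ r ∂(radialMeasure R), radialOp B h m f r = (μ : ℂ) * f r) {r : ℝ} (hr : R < r) :
    HasDerivAt (fun r : ℝ => (r : ℂ) * derivWithin f (Ici R) r)
      ((((h * m - B * r ^ 2 / 2) ^ 2 / (h ^ 2 * r) - μ / h ^ 2 * r : ℝ) : ℂ) * f r) r := by
  set k := derivWithin f (Ici R) with hk
  set G : ℝ → ℂ := fun r =>
    (((h * m - B * r ^ 2 / 2) ^ 2 / (h ^ 2 * r) - μ / h ^ 2 * r : ℝ) : ℂ) * f r with hG
  set g : ℝ → ℂ := fun r => (r : ℂ)⁻¹ * (G r - k r) with hg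
  -- A `C¹` primitive of the derivative that the equation prescribes; `max t R` extends the
  -- integrand continuously to the whole line. Absolute continuity makes `k - J` constant, which
  -- upgrades the almost everywhere equation to a classical one.
  set J : ℝ → ℂ := fun x => ∫ t in R..x, g (max t R) with hJ
  have hkc : ContinuousOn k (Ici R) := hf.continuousOn_derivWithin
  have hfc : ContinuousOn f (Ici R) := hf.differentiableOn.continuousOn
  have hpos : ∀ x ∈ Ici R, (x : ℝ) ≠ 0 := fun x hx => (hR.trans_le hx).ne'
  have hgc : ContinuousOn g (Ici R) := by
    have c1 : ContinuousOn (fun r : ℝ => (r : ℂ)⁻¹) (Ici R) :=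
      ContinuousOn.inv₀ (by fun_prop) fun x hx => by exact_mod_cast hpos x hx
    have c2 : ContinuousOn (fun r : ℝ => (h * m - B * r ^ 2 / 2) ^ 2 / (h ^ 2 * r) - μ / h ^ 2 * r)
        (Ici R) :=
      (ContinuousOn.div (by fun_prop) (by fun_prop) fun x hx =>
        mul_ne_zero (by positivity) (hpos x hx)).sub (by fun_prop)
    exact c1.mul (((Complex.continuous_ofReal.comp_continuousOn c2).mul hfc).sub hkc)
  have hgext : Continuous fun t => g (max t R) :=
    hgc.comp_continuous (by fun_prop) fun t => le_max_right t R
  have hJd : ∀ x, HasDerivAt J (g (max x R)) x := fun x =>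
    intervalIntegral.integral_hasDerivAt_right (hgext.intervalIntegrable _ _)
      (hgext.stronglyMeasurableAtFilter _ _) hgext.continuousAt
  have hJ1 : ContDiff ℝ 1 J := by
    rw [contDiff_one_iff_deriv]
    refine ⟨fun x => (hJd x).differentiableAt, ?_⟩
    rw [funext fun x => (hJd x).deriv]
    exact hgext
  set b := r + 1 with hb
  have hRb : R < b := by linarith
  have hAC := hf.deriv_ac b hRb
  have hJAC : AbsolutelyContinuousOnInterval J R b := hJ1.contDiffOn.absolutelyContinuousOnInterval
  have hdiff := hAC.boundedVariationOn.ae_differentiableAt_of_mem_uIcc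
  rw [ae_radialMeasure hR] at hae
  have hne1 : ∀ᵐ x : ℝ, x ≠ R := by simp [ae_iff, measure_singleton]
  have hae0 : ∀ᵐ x, x ∈ uIcc R b → HasDerivAt (k - J) 0 x := by
    filter_upwards [hdiff, hae, hne1] with x hx1 hx2 hx3 hx
    have hxR : R < x := by
      rw [uIcc_of_le hRb.le] at hx
      exact lt_of_le_of_ne hx.1 (Ne.symm hx3)
    have hx0 : 0 < x := hR.trans hxR
    have hx0' : (x : ℂ) ≠ 0 := by exact_mod_cast hx0.ne'
    have hkd := (hx1 hx).hasDerivAt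
    have hop := hx2 hxR
    have hid : HasDerivAt (fun ρ : ℝ => (ρ : ℂ)) 1 x := Complex.ofRealCLM.hasDerivAt
    have hder : deriv (fun ρ : ℝ => (ρ : ℂ) * deriv f ρ) x = 1 * k x + (x : ℂ) * deriv k x := by
      have hev : (fun ρ : ℝ => (ρ : ℂ) * deriv f ρ) =ᶠ[𝓝 x] fun ρ : ℝ => (ρ : ℂ) * k ρ := by
        filter_upwards [lt_mem_nhds hxR] with s hs
        rw [(hf.hasDerivAt hs).deriv]
      rw [hev.deriv_eq]
      exact (hid.mul hkd).deriv
    rw [radialOp, hder] at hop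
    have hk' : deriv k x = g x := by
      have hh' : (h : ℂ) ≠ 0 := by exact_mod_cast hh.ne'
      simp only [hg, hG]
      push_cast at hop ⊢
      field_simp at hop ⊢
      linear_combination -hop
    have := hkd.sub (hJd x)
    rwa [hk', max_eq_left hxR.le, sub_self] at this
  obtain ⟨C, hC⟩ := (hAC.sub hJAC).const_of_ae_hasDerivAt_zero hae0
  have hkd : HasDerivAt k (g r) r := by
    have h1 : HasDerivAt (fun x => J x + C) (g (max r R)) r := (hJd r).add_const C
    rw [max_eq_left hr.le] at h1
    refine h1.congr_of_eventuallyEq ?_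
    filter_upwards [Ioo_mem_nhds hr (show r < b by linarith)] with x hx
    have := hC x (by rw [uIcc_of_le hRb.le]; exact ⟨hx.1.le, hx.2.le⟩)
    simp only [Pi.sub_apply] at this
    rw [← this, hk]; ring
  have hid : HasDerivAt (fun ρ : ℝ => (ρ : ℂ)) 1 r := Complex.ofRealCLM.hasDerivAt
  refine (hid.mul hkd).congr_deriv ?_
  have hr0' : (r : ℂ) ≠ 0 := by exact_mod_cast (hR.trans hr).ne'
  simp only [hg]
  rw [mul_inv_cancel_left₀ hr0', one_mul, add_sub_cancel]

section
variable {B R h N a : ℝ} {m : ℤ}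

lemma derivWithin_radialSol (hN : 0 < N) (hR : 0 < R) (ha : 0 < a) {r : ℝ} (hr : R ≤ r) :
    derivWithin (fun r => (radialSol N R m a r : ℂ)) (Ici R) r = (radialSol' N R m a r : ℂ) :=
  ((hasDerivAt_radialSol hN hR ha (hR.trans_le hr)).ofReal_comp.hasDerivWithinAt).derivWithin
    (uniqueDiffOn_Ici R r hr)

lemma hasDerivAt_radialSol' (hN : 0 < N) (hR : 0 < R) (ha : 0 < a) {r : ℝ} (hr : 0 < r) :
    HasDerivAt (radialSol' N R m a) (r⁻¹ * (((m - N ^ 2 * r ^ 2 / (2 * R ^ 2)) ^ 2 / r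
      - N ^ 2 / R ^ 2 * (1 - 2 * a) * r) * radialSol N R m a r - radialSol' N R m a r)) r := by
  have h1 := (hasDerivAt_inv hr.ne').mul (hasDerivAt_mul_radialSol' (m := m) hN hR ha hr)
  have hev : radialSol' N R m a =ᶠ[𝓝 r] (fun r => r⁻¹) * fun r => r * radialSol' N R m a r := by
    filter_upwards [lt_mem_nhds hr] with s hs
    simp only [Pi.mul_apply]
    field_simp
  refine (h1.congr_of_eventuallyEq hev).congr_deriv ?_
  field_simp
  ring

lemma radialOp_radialSol (hh : 0 < h) (hN : 0 < N) (hR : 0 < R) (ha : 0 < a)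
    (hNh : N ^ 2 * h = B * R ^ 2) {r : ℝ} (hr : R < r) :
    radialOp B h m (fun r => (radialSol N R m a r : ℂ)) r
      = ((h * B * (1 - 2 * a) : ℝ) : ℂ) * (radialSol N R m a r : ℂ) := by
  have hr0 : 0 < r := hR.trans hr
  have hev : (fun ρ : ℝ => (ρ : ℂ) * deriv (fun r => (radialSol N R m a r : ℂ)) ρ)
      =ᶠ[𝓝 r] fun ρ => ((ρ * radialSol' N R m a ρ : ℝ) : ℂ) := by
    filter_upwards [lt_mem_nhds hr0] with s hs
    rw [(hasDerivAt_radialSol hN hR ha hs).ofReal_comp.deriv]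
    push_cast; rfl
  rw [radialOp, hev.deriv_eq, (hasDerivAt_mul_radialSol' hN hR ha hr0).ofReal_comp.deriv]
  rw [← Complex.ofReal_neg, ← Complex.ofReal_mul, ← Complex.ofReal_mul, ← Complex.ofReal_add,
    ← Complex.ofReal_mul]
  congr 1
  have hB : B = N ^ 2 * h / R ^ 2 := by field_simp; linarith
  rw [hB]
  field_simp
  ring

lemma inRadialDomain_radialSol (hh : 0 < h) (hN : 0 < N) (hR : 0 < R) (ha : 0 < a)
    (hm : 0 ≤ m) (hNh : N ^ 2 * h = B * R ^ 2) (hroot : radialSol' N R m a R = 0) :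
    InRadialDomain B R h m (fun r => (radialSol N R m a r : ℂ)) := by
  obtain ⟨K, hK, hb⟩ := radialSol_le_exp (m := m) hN hR ha hm
  have hd : ∀ r, 0 < r → HasDerivAt (fun r => (radialSol N R m a r : ℂ))
      (radialSol' N R m a r : ℂ) r := fun r hr => (hasDerivAt_radialSol hN hR ha hr).ofReal_comp
  have hd' : ∀ r, 0 < r → ContinuousAt (fun r => (radialSol' N R m a r : ℂ)) r := fun r hr =>
    (hasDerivAt_radialSol' hN hR ha hr).ofReal_comp.continuousAt
  have hmem : MemLp (fun r => (radialSol N R m a r : ℂ)) 2 (radialMeasure R) := by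
    refine memLp_radialMeasure_of_le_exp (K := K) hR (fun r hr => ?_) fun r hr => ?_
    · exact (hd r (hR.trans hr)).continuousAt.continuousWithinAt
    · rw [Complex.norm_real, Real.norm_eq_abs,
        abs_of_pos (radialSol_pos hN hR ha (hR.trans hr))]
      exact (hb r hr.le).1
  refine ⟨?_, ?_, hmem, ?_, ?_, ?_⟩
  · exact fun r hr => (hd r (hR.trans_le hr)).differentiableAt.differentiableWithinAt
  · intro b hRb
    have hc : ContDiffOn ℝ 1 (fun r => (radialSol' N R m a r : ℂ)) (Ioi 0) := by
      rw [contDiffOn_one_iff_derivWithin (isOpen_Ioi.uniqueDiffOn)]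
      have hdd : ∀ r ∈ Ioi (0 : ℝ), HasDerivAt (fun r => (radialSol' N R m a r : ℂ)) _ r :=
        fun r hr => (hasDerivAt_radialSol' hN hR ha hr).ofReal_comp
      refine ⟨fun r hr => (hdd r hr).differentiableAt.differentiableWithinAt, ?_⟩
      refine ContinuousOn.congr ?_ fun r hr =>
        ((hdd r hr).hasDerivWithinAt).derivWithin (isOpen_Ioi.uniqueDiffOn r hr)
      refine Complex.continuous_ofReal.comp_continuousOn ?_
      have c0 : ContinuousOn (radialSol N R m a) (Ioi 0) := fun r hr =>
        (hasDerivAt_radialSol hN hR ha hr).continuousAt.continuousWithinAt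
      have c1 : ContinuousOn (radialSol' N R m a) (Ioi 0) := fun r hr =>
        (hasDerivAt_radialSol' hN hR ha hr).continuousAt.continuousWithinAt
      have c2 : ContinuousOn (fun r : ℝ => r⁻¹) (Ioi 0) :=
        continuousOn_inv₀.mono fun r hr => ne_of_gt hr
      simp only [div_eq_mul_inv]
      fun_prop
    have hsub : uIcc R b ⊆ Ioi 0 := by
      rw [uIcc_of_le hRb.le]; exact fun x hx => hR.trans_le hx.1
    refine ContDiffOn.absolutelyContinuousOnInterval ((hc.mono hsub).congr fun r hr => ?_)
    rw [uIcc_of_le hRb.le] at hr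
    exact derivWithin_radialSol hN hR ha hr.1
  · refine memLp_radialMeasure_of_le_exp (K := K) hR ?_ fun r hr => ?_
    · refine ContinuousOn.congr (f := fun r => (radialSol' N R m a r : ℂ))
        (fun r hr => (hd' r (hR.trans hr)).continuousWithinAt) fun r hr =>
        (hd r (hR.trans hr)).deriv
    · rw [(hd r (hR.trans hr)).deriv, Complex.norm_real]
      exact (hb r hr.le).2
  · refine (MemLp.ae_eq ?_ (hmem.const_mul ((h * B * (1 - 2 * a) : ℝ) : ℂ)))
    rw [EventuallyEq, ae_radialMeasure hR]
    exact ae_of_all _ fun r hr => (radialOp_radialSol hh hN hR ha hNh hr).symm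
  · rw [derivWithin_radialSol hN hR ha le_rfl, hroot, Complex.ofReal_zero]

/-- The ground state is a multiple of the explicit decaying solution. -/
lemma IsRadialGroundState.eq_const_mul {f : ℝ → ℂ} (hh : 0 < h) (hN : 0 < N) (hR : 0 < R)
    (ha : 0 < a) (hm : 0 ≤ m) (hNh : N ^ 2 * h = B * R ^ 2) (hroot : radialSol' N R m a R = 0)
    (hf : IsRadialGroundState B R h m f) :
    ∃ c : ℂ, c ≠ 0 ∧ ∀ r, R ≤ r → f r = c * (radialSol N R m a r : ℂ) := by
  obtain ⟨hdom, ⟨r0, hr0, hfr0⟩, μ, hae, hvar⟩ := hf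
  have hD := inRadialDomain_radialSol hh hN hR ha hm hNh hroot
  -- The explicit solution is an admissible test function in the variational property of `μ`. This
  -- is the only inequality between eigenvalues that the comparison needs.
  have hμ : μ ≤ h * B * (1 - 2 * a) := by
    have h1 := hvar _ hD
    have hi := integrable_mul_sq_of_memLp hR hD.memLp
    simp only [Complex.norm_real, Real.norm_eq_abs, sq_abs] at hi h1
    have hpos : 0 < ∫ r in Ioi R, r * radialSol N R m a r ^ 2 := by
      have hp : ∀ r, R < r → 0 < r * radialSol N R m a r ^ 2 := fun r hr => by
        have := radialSol_pos (m := m) hN hR ha (hR.trans hr)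
        have := hR.trans hr
        positivity
      rw [integral_pos_iff_support_of_nonneg_ae _ hi]
      · rw [Measure.restrict_apply' measurableSet_Ioi]
        refine lt_of_lt_of_le ?_ (measure_mono (s := Ioi R) fun y hy => ⟨(hp y hy).ne', hy⟩)
        simp
      · exact (ae_restrict_iff' measurableSet_Ioi).2 (ae_of_all _ fun y hy => (hp y hy).le)
    rw [integral_radialMeasure hR, integral_radialMeasure hR] at h1
    have h2 : ∫ r in Ioi R, r • ((starRingEnd ℂ) (radialSol N R m a r : ℂ)
        * radialOp B h m (fun r => (radialSol N R m a r : ℂ)) r)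
        = ∫ r in Ioi R, ((h * B * (1 - 2 * a) * (r * radialSol N R m a r ^ 2) : ℝ) : ℂ) := by
      refine setIntegral_congr_fun measurableSet_Ioi fun r hr => ?_
      rw [radialOp_radialSol hh hN hR ha hNh hr, Complex.conj_ofReal, Complex.real_smul]
      push_cast
      ring
    rw [h2, integral_complex_ofReal, Complex.ofReal_re, integral_const_mul] at h1
    simp only [smul_eq_mul] at h1
    exact le_of_mul_le_mul_right h1 hpos
  set k := derivWithin f (Ici R) with hk
  have hkc : ContinuousOn k (Ici R) := hdom.continuousOn_derivWithin
  have hfc : ContinuousOn f (Ici R) := hdom.differentiableOn.continuousOn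
  obtain ⟨K, hK, hKb⟩ := abs_radialSol'_le (m := m) hN hR ha
  have hki : IntegrableOn (fun r => r * ‖k r‖ ^ 2) (Ioi R) := by
    refine (integrable_mul_sq_of_memLp hR hdom.memLp_deriv).congr_fun (fun r hr => ?_)
      measurableSet_Ioi
    simp only
    rw [(hdom.hasDerivAt hr).deriv]
  have hfi := integrable_mul_sq_of_memLp hR hdom.memLp
  have hB : B = N ^ 2 * h / R ^ 2 := by field_simp; linarith
  -- The comparison is for real functions. The equation has real coefficients, so it applies to the
  -- real and the imaginary part separately.
  have main : ∀ L : ℂ →L[ℝ] ℝ, (∀ z, |L z| ≤ ‖z‖) →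
      ∃ c : ℝ, ∀ r, R ≤ r → L (f r) = c * radialSol N R m a r := by
    intro L hL
    have hsq : ∀ F : ℝ → ℂ, ContinuousOn F (Ici R) →
        IntegrableOn (fun r => r * ‖F r‖ ^ 2) (Ioi R) →
        IntegrableOn (fun r => r * L (F r) ^ 2) (Ioi R) := by
      intro F hFc hF
      refine Integrable.mono' hF ?_ ((ae_restrict_iff' measurableSet_Ioi).2
        (ae_of_all _ fun r hr => ?_))
      · refine ContinuousOn.aestronglyMeasurable (continuousOn_id.mul
          ((L.continuous.comp_continuousOn (hFc.mono Ioi_subset_Ici_self)).pow 2)) measurableSet_Ioi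
      · have hr0 : 0 < r := hR.trans hr
        rw [norm_mul, Real.norm_eq_abs, abs_of_pos hr0, norm_pow, Real.norm_eq_abs]
        exact mul_le_mul_of_nonneg_left (pow_le_pow_left₀ (abs_nonneg _) (hL _) 2) hr0.le
    refine eq_const_mul_of_neumann (lam := μ / h ^ 2) (lam' := N ^ 2 / R ^ 2 * (1 - 2 * a)) (K := K)
      hR (V := fun r => (m - N ^ 2 * r ^ 2 / (2 * R ^ 2)) ^ 2 / r)
      (f1 := radialSol' N R m a) (g1 := fun r => L (k r)) ?_
      (fun r hr => radialSol_pos hN hR ha (hR.trans_le hr))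
      (fun r hr => hasDerivAt_radialSol hN hR ha (hR.trans_le hr)) (fun r hr => ?_)
      (fun r hr => (hasDerivAt_radialSol' hN hR ha (hR.trans_le hr)).continuousAt.continuousWithinAt)
      hroot hKb (L.continuous.comp_continuousOn hfc) (L.continuous.comp_continuousOn hkc)
      (fun r hr => L.hasFDerivAt.comp_hasDerivAt r (hdom.hasDerivAt hr)) (fun r hr => ?_)
      (by simp only [hk]; rw [hdom.neumann, map_zero]) (hsq f hfc hfi) (hsq k hkc hki)
    · rw [div_le_iff₀ (by positivity)]
      refine hμ.trans (le_of_eq ?_)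
      rw [hB]; field_simp
    · refine (hasDerivAt_mul_radialSol' hN hR ha (hR.trans hr)).congr_deriv ?_
      ring
    · have h1 := L.hasFDerivAt.comp_hasDerivAt r (hdom.hasDerivAt_mul_derivWithin hR hh hae hr)
      have e : ∀ (x : ℝ) (z : ℂ), L ((x : ℂ) * z) = x * L z := fun x z => by
        rw [← Complex.real_smul, L.map_smul, smul_eq_mul]
      simp only [Function.comp_def, e] at h1
      refine h1.congr_deriv ?_
      have hr0 : r ≠ 0 := (hR.trans hr).ne'
      rw [hB]
      field_simp
  obtain ⟨c1, h1⟩ := main Complex.reCLM Complex.abs_re_le_norm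
  obtain ⟨c2, h2⟩ := main Complex.imCLM Complex.abs_im_le_norm
  have heq : ∀ r, R ≤ r → f r = (⟨c1, c2⟩ : ℂ) * (radialSol N R m a r : ℂ) := by
    intro r hr
    apply Complex.ext
    · simpa using h1 r hr
    · simpa using h2 r hr
  refine ⟨⟨c1, c2⟩, fun h0 => hfr0 ?_, heq⟩
  rw [heq r0 hr0.le, h0, zero_mul]

end

/-! ### Normalisation and the boundary layer limit. -/

lemma integral_norm_sq_of_momentum {R : ℝ} {m : ℤ} {Φ : ℂ → ℂ} {f : ℝ → ℂ}
    (hR : 0 < R) (hf : ∀ r θ : ℝ, R ≤ r →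
      Φ ((r : ℂ) * Complex.exp (Complex.I * θ)) = Complex.exp (Complex.I * (m * θ)) * f r) :
    ∫ z in {z : ℂ | R < ‖z‖}, ‖Φ z‖ ^ 2 = 2 * Real.pi * ∫ r in Ioi R, r * ‖f r‖ ^ 2 := by
  have hmeas : MeasurableSet {z : ℂ | R < ‖z‖} := measurableSet_lt measurable_const measurable_norm
  rw [← integral_indicator hmeas, ← Complex.integral_comp_polarCoord_symm]
  have h1 : ∀ p ∈ polarCoord.target, p.1 • ({z : ℂ | R < ‖z‖}.indicator (fun z => ‖Φ z‖ ^ 2)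
      (Complex.polarCoord.symm p)) = (Ioi R).indicator (fun r => r * ‖f r‖ ^ 2) p.1 * (1 : ℝ) := by
    intro p hp
    have hp1 : 0 < p.1 := by
      rw [polarCoord_target] at hp; exact hp.1
    have e : Complex.polarCoord.symm p = (p.1 : ℂ) * Complex.exp (Complex.I * p.2) := by
      rw [Complex.polarCoord_symm_apply, mul_comm Complex.I, Complex.exp_mul_I]
      push_cast; ring
    have hn : ‖Complex.polarCoord.symm p‖ = p.1 := by
      rw [Complex.norm_polarCoord_symm, abs_of_pos hp1]
    rw [mul_one]
    by_cases hlt : R < p.1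
    · rw [indicator_of_mem (show _ ∈ {z : ℂ | R < ‖z‖} by change R < ‖_‖; rw [hn]; exact hlt), indicator_of_mem (by exact hlt), e,
        hf _ _ hlt.le, norm_mul]
      have : ‖Complex.exp (Complex.I * (m * p.2))‖ = 1 := by
        rw [Complex.norm_exp]; simp
      rw [this, one_mul, smul_eq_mul]
    · rw [indicator_of_notMem (show _ ∉ {z : ℂ | R < ‖z‖} by change ¬ R < ‖_‖; rw [hn]; exact hlt), indicator_of_notMem (by exact hlt),
        smul_zero]
  rw [setIntegral_congr_fun (by rw [polarCoord_target]; measurability) h1, polarCoord_target]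
  have h2 := setIntegral_prod_mul (μ := (volume : Measure ℝ)) (ν := (volume : Measure ℝ))
    (fun r => (Ioi R).indicator (fun r => r * ‖f r‖ ^ 2) r) (fun _ : ℝ => (1 : ℝ))
    (Ioi 0) (Ioo (-Real.pi) Real.pi)
  have h3 : ∫ r in Ioi (0 : ℝ), (Ioi R).indicator (fun r => r * ‖f r‖ ^ 2) r
      = ∫ r in Ioi R, r * ‖f r‖ ^ 2 := by
    rw [setIntegral_indicator measurableSet_Ioi, inter_eq_right.2 (Ioi_subset_Ioi hR.le)]
  rw [h3] at h2
  refine h2.trans ?_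
  simp only [integral_const, smul_eq_mul, mul_one, measureReal_restrict_apply_univ]
  rw [Real.volume_real_Ioo_of_le (by linarith [Real.pi_pos])]
  ring

lemma integral_Ioi_comp_affine {R c : ℝ} (hc : 0 < c) (g : ℝ → ℝ) :
    ∫ r in Ioi R, g r = c * ∫ t in Ioi (0 : ℝ), g (R + c * t) := by
  have him : (fun t : ℝ => R + c * t) '' Ioi 0 = Ioi R := by
    ext x
    simp only [mem_image, mem_Ioi]
    refine ⟨?_, fun hx => ⟨(x - R) / c, div_pos (by linarith) hc, by field_simp; ring⟩⟩
    rintro ⟨t, ht, rfl⟩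
    have := mul_pos hc ht
    linarith
  have hd : ∀ x ∈ Ioi (0 : ℝ), HasDerivWithinAt (fun t : ℝ => R + c * t) c (Ioi 0) x := fun x _ => by
    simpa using (((hasDerivAt_id x).const_mul c).const_add R).hasDerivWithinAt
  have hinj : InjOn (fun t : ℝ => R + c * t) (Ioi 0) := fun x _ y _ hxy => by
    have : R + c * x = R + c * y := hxy
    exact mul_left_cancel₀ hc.ne' (by linarith)
  rw [← him, integral_image_eq_integral_abs_deriv_smul measurableSet_Ioi hd hinj,
    ← integral_const_mul]
  simp only [abs_of_pos hc, smul_eq_mul]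

/-- In the layer variable the prefactor `(1 + t/N)^m e^(-N t/2 - t²/4)` is again a Kummer weight,
now with exponent `m`, so the same uniform estimates control the mass. -/
lemma radialSol_layer {N R a t : ℝ} {m : ℤ} (hN : 0 < N) (hR : 0 < R) (ht : 0 ≤ t) :
    radialSol N R m a (R + R / N * t) = Real.exp (-t ^ 2 / 4) * diskWeight N m t
      * realMoment (diskWeight N (m - a)) a (t + t ^ 2 / (2 * N)) := by
  have h1 : (R + R / N * t) / R = 1 + t / N := by field_simp
  have hpos : 0 < 1 + t / N := by positivity
  have h2 : layerVar N R (R + R / N * t) = t + t ^ 2 / (2 * N) := by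
    simp only [layerVar]; field_simp; ring
  have h3 : -(N ^ 2 / 4) * ((R + R / N * t) ^ 2 / R ^ 2 - 1) = -N * t / 2 + -t ^ 2 / 4 := by
    field_simp; ring
  have h4 : (1 + t / N) ^ m = Real.exp (m * Real.log (1 + t / N)) := by
    rw [← Real.rpow_intCast, Real.rpow_def_of_pos hpos, mul_comm]
  rw [radialSol, radialPre, h1, h2, h3, h4, diskWeight, ← Real.exp_add, ← Real.exp_add]
  congr 2
  ring

lemma tendsto_pcf {ι : Type*} {l : Filter ι} [l.IsCountablyGenerated] {b x : ι → ℝ} {b₀ x₀ : ℝ}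
    (hb₀ : 0 < b₀) (hb : Tendsto b l (𝓝 b₀)) (hx : Tendsto x l (𝓝 x₀)) :
    Tendsto (fun i => pcf (b i) (x i)) l (𝓝 (pcf b₀ x₀)) := by
  have hg := expKernel_gaussWeight (-(x₀ - 1) + 1)
  have e1 : ∀ᶠ i in l, b i ∈ Ioo (b₀ / 2) (b₀ + 1) :=
    hb.eventually (Ioo_mem_nhds (by linarith) (by linarith))
  have e2 : ∀ᶠ i in l, x₀ - 1 < x i := hx.eventually (lt_mem_nhds (by linarith))
  refine tendsto_integral_filter_of_dominated_convergence
    (fun y => y ^ (b₀ / 2 - 1) * gaussWeight y * Real.exp (-(x₀ - 1) * y)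
      + y ^ (b₀ + 1 - 1) * gaussWeight y * Real.exp (-(x₀ - 1) * y)) ?_ ?_
    ((hg.integrableOn (by linarith) (by linarith)).add
      (hg.integrableOn (by linarith) (by linarith))) ?_
  · filter_upwards [e1] with i hi
    exact ((expKernel_gaussWeight (1 - x i)).integrableOn (b := b i) (by linarith [hi.1])
      (σ := x i) (by linarith)).aestronglyMeasurable
  · filter_upwards [e1, e2] with i hi hi2
    refine (ae_restrict_iff' measurableSet_Ioi).2 (ae_of_all _ fun y hy => ?_)
    have hy : 0 < y := hy
    have h1 := rpow_le_rpow_add_rpow hy (a := b i - 1) (l := b₀ / 2 - 1) (u := b₀ + 1 - 1)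
      (by linarith [hi.1]) (by linarith [hi.2])
    have h3 := Real.rpow_pos_of_pos hy (b i - 1)
    have h4 := hg.pos y hy.le
    have h5 : Real.exp (-x i * y) ≤ Real.exp (-(x₀ - 1) * y) := by
      rw [Real.exp_le_exp]; nlinarith
    rw [Real.norm_eq_abs, abs_of_pos (by positivity), ← add_mul, ← add_mul]
    have := Real.rpow_pos_of_pos hy (b₀ / 2 - 1)
    have := Real.rpow_pos_of_pos hy (b₀ + 1 - 1)
    gcongr
  · refine (ae_restrict_iff' measurableSet_Ioi).2 (ae_of_all _ fun y hy => ?_)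
    have hy : 0 < y := hy
    have t1 : Tendsto (fun i => y ^ (b i - 1)) l (𝓝 (y ^ (b₀ - 1))) :=
      tendsto_const_nhds.rpow (hb.sub_const 1) (Or.inl hy.ne')
    have t2 : Tendsto (fun i => Real.exp (-x i * y)) l (𝓝 (Real.exp (-x₀ * y))) :=
      (Real.continuous_exp.tendsto _).comp ((hx.neg).mul_const y)
    exact (t1.mul_const _).mul t2

/-- Convergence of the moments of `diskWeight` to parabolic cylinder functions. -/
lemma tendsto_realMoment_diskWeight {C b₀ σ₀ : ℝ} {N M b σ : ℕ → ℝ} (hN : Tendsto N atTop atTop)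
    (hM : ∀ᶠ n in atTop, |M n - N n ^ 2 / 2 - xiZero * N n| ≤ C) (hb₀ : 0 < b₀)
    (hb : Tendsto b atTop (𝓝 b₀)) (hσ : Tendsto σ atTop (𝓝 σ₀)) (hσ0 : ∀ᶠ n in atTop, 0 ≤ σ n) :
    Tendsto (fun n => realMoment (diskWeight (N n) (M n)) (b n) (σ n)) atTop
      (𝓝 (pcf b₀ (σ₀ - xiZero))) := by
  obtain ⟨N₀, D, hN₀, hD, hest⟩ := realMoment_diskWeight_estimates C
  have hΓ : Tendsto (fun n => Real.Gamma (b n)) atTop (𝓝 (Real.Gamma b₀)) :=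
    ((continuousOn_Gamma_Ioi b₀ hb₀).continuousAt (Ioi_mem_nhds hb₀)).tendsto.comp hb
  have h0 : Tendsto (fun n => D / N n * Real.Gamma (b n)) atTop (𝓝 0) := by
    simpa using (tendsto_const_nhds.div_atTop hN).mul hΓ
  have h1 := tendsto_pcf hb₀ hb (hσ.sub_const xiZero)
  have h2 : Tendsto (fun n => realMoment (diskWeight (N n) (M n)) (b n) (σ n)
      - pcf (b n) (σ n - xiZero)) atTop (𝓝 0) := by
    refine squeeze_zero_norm' ?_ h0
    filter_upwards [hN.eventually_ge_atTop N₀, hM, hσ0, hb.eventually (lt_mem_nhds hb₀)]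
      with n n1 n2 n3 n4
    have := (hest (N n) _ (b n) (σ n) n1 n2 n4 n3).2
    rwa [show N n ^ 2 / 2 + xiZero * N n + (M n - N n ^ 2 / 2 - xiZero * N n) = M n by ring] at this
  have := h2.add h1
  simpa using this

/-- The boundary layer profile. -/
def layerProfile (t : ℝ) : ℝ := pcf deltaZero (t - xiZero)

/-- The mass `∫₀^∞ e^(-t² + 2 ξ₀ t) v(t)² dt` of the boundary layer profile. -/
def layerMass : ℝ :=
  ∫ t in Ioi (0 : ℝ), (Real.exp (-t ^ 2 / 4) * limitWeight t * layerProfile t) ^ 2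

/-- The mass integrand of `radialSol` in the layer variable. -/
def diskMassDensity (N : ℝ) (m : ℤ) (a t : ℝ) : ℝ :=
  (1 + t / N) * (Real.exp (-t ^ 2 / 4) * diskWeight N m t
    * realMoment (diskWeight N (m - a)) a (t + t ^ 2 / (2 * N))) ^ 2

lemma integral_mul_sq_radialSol {N R a : ℝ} {m : ℤ} (hN : 0 < N) (hR : 0 < R) :
    ∫ r in Ioi R, r * radialSol N R m a r ^ 2
      = R ^ 2 / N * ∫ t in Ioi (0 : ℝ), diskMassDensity N m a t := by
  rw [integral_Ioi_comp_affine (div_pos hR hN), ← integral_const_mul, ← integral_const_mul]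
  refine setIntegral_congr_fun measurableSet_Ioi fun t ht => ?_
  have ht : 0 < t := ht
  rw [radialSol_layer hN hR ht.le, diskMassDensity]
  field_simp

lemma tendsto_diskWeight {C t : ℝ} {N M : ℕ → ℝ} (hN : Tendsto N atTop atTop)
    (hM : ∀ᶠ n in atTop, |M n - N n ^ 2 / 2 - xiZero * N n| ≤ C) (ht : 0 ≤ t) :
    Tendsto (fun n => diskWeight (N n) (M n) t) atTop (𝓝 (limitWeight t)) := by
  obtain ⟨N₀, D, hN₀, hD, hest⟩ := diskWeight_estimates C
  have h0 : Tendsto (fun n => D / N n * Real.exp (-1 * t)) atTop (𝓝 0) := by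
    simpa using (tendsto_const_nhds.div_atTop hN).mul_const (Real.exp (-1 * t))
  have h2 : Tendsto (fun n => diskWeight (N n) (M n) t - limitWeight t) atTop (𝓝 0) := by
    refine squeeze_zero_norm' ?_ h0
    filter_upwards [hN.eventually_ge_atTop N₀, hM] with n n1 n2
    have := (hest (N n) _ t n1 n2 ht).2.1
    rwa [show N n ^ 2 / 2 + xiZero * N n + (M n - N n ^ 2 / 2 - xiZero * N n) = M n by ring] at this
  simpa using h2.add_const (limitWeight t)

lemma tendsto_integral_diskMassDensity {C : ℝ} {N a : ℕ → ℝ} {m : ℕ → ℤ}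
    (hN : Tendsto N atTop atTop)
    (hm : ∀ᶠ n in atTop, |(m n : ℝ) - N n ^ 2 / 2 - xiZero * N n| ≤ C)
    (ha : Tendsto a atTop (𝓝 deltaZero)) :
    Tendsto (fun n => ∫ t in Ioi (0 : ℝ), diskMassDensity (N n) (m n) (a n) t) atTop
      (𝓝 layerMass) := by
  have hd := deltaZero_pos
  have hd2 := deltaZero_lt
  have haI : ∀ᶠ n in atTop, a n ∈ Ioo (deltaZero / 2) 1 :=
    ha.eventually (Ioo_mem_nhds (by linarith) (by linarith))
  have hma : ∀ᶠ n in atTop, |(m n : ℝ) - a n - N n ^ 2 / 2 - xiZero * N n| ≤ C + 1 := by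
    filter_upwards [hm, haI] with n h1 h2
    rw [show (m n : ℝ) - a n - N n ^ 2 / 2 - xiZero * N n
      = ((m n : ℝ) - N n ^ 2 / 2 - xiZero * N n) - a n by ring]
    refine (abs_sub _ _).trans (add_le_add h1 ?_)
    rw [abs_of_pos (by linarith [h2.1])]; exact h2.2.le
  obtain ⟨N₀, D, hN₀, hD, hest⟩ := diskWeight_estimates C
  obtain ⟨N₁, D1, hN₁, hD1, hest1⟩ := realMoment_diskWeight_estimates (C + 1)
  obtain ⟨G, hG, hΓ⟩ := Gamma_bddOn (deltaZero / 2) 1 (by linarith)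
  refine tendsto_integral_filter_of_dominated_convergence
    -- The squared weight decays like `e^(-2t)`; one factor `e^t` bounds the Jacobian `1 + t/N`.
    (fun t => (D * (D1 * G)) ^ 2 * Real.exp (-t)) ?_ ?_
    ((integrableOn_exp_neg_Ioi 0).const_mul _) ?_
  · filter_upwards [hN.eventually_gt_atTop 0, haI] with n n1 n2
    refine ContinuousOn.aestronglyMeasurable ?_ measurableSet_Ioi
    have c1 : ContinuousOn (diskWeight (N n) (m n)) (Ioi 0) :=
      (continuousOn_diskWeight n1 _).mono Ioi_subset_Ici_self
    have c2 : ContinuousOn (fun t => realMoment (diskWeight (N n) (m n - a n)) (a n)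
        (t + t ^ 2 / (2 * N n))) (Ioi 0) := by
      intro t ht
      have ht : 0 < t := ht
      have := (expKernel_diskWeight n1 (m n - a n) (Λ := N n / 4) (by linarith)).hasDerivAt_realMoment
        (b := a n) (by linarith [n2.1]) (σ := t + t ^ 2 / (2 * N n)) (by
          have : 0 < t ^ 2 / (2 * N n) := by positivity
          linarith)
      exact (this.continuousAt.comp (f := fun t : ℝ => t + t ^ 2 / (2 * N n))
        (by fun_prop)).continuousWithinAt
    unfold diskMassDensity
    exact ContinuousOn.mul (by fun_prop) (((ContinuousOn.mul (by fun_prop) c1).mul c2).pow 2)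
  · filter_upwards [hN.eventually_ge_atTop N₀, hN.eventually_ge_atTop N₁, hm, hma, haI]
      with n n0 n1 h1 h2 h3
    refine (ae_restrict_iff' measurableSet_Ioi).2 (ae_of_all _ fun t ht => ?_)
    have ht : 0 < t := ht
    have hN1 : 1 ≤ N n := hN₀.trans n0
    have hNp : 0 < N n := by linarith
    have hσ : 0 ≤ t + t ^ 2 / (2 * N n) := by positivity
    have b1 := (hest (N n) _ t n0 h1 ht.le).1
    rw [show N n ^ 2 / 2 + xiZero * N n + ((m n : ℝ) - N n ^ 2 / 2 - xiZero * N n) = m n by ring]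
      at b1
    have b2 := (hest1 (N n) _ (a n) _ n1 h2 (by linarith [h3.1]) hσ).1
    rw [show N n ^ 2 / 2 + xiZero * N n + ((m n : ℝ) - a n - N n ^ 2 / 2 - xiZero * N n)
      = m n - a n by ring] at b2
    have b3 := b2.trans (mul_le_mul_of_nonneg_left (hΓ (a n) ⟨h3.1.le, h3.2.le⟩) hD1.le)
    have p2 : 0 < realMoment (diskWeight (N n) (m n - a n)) (a n) (t + t ^ 2 / (2 * N n)) :=
      (expKernel_diskWeight hNp _ (Λ := N n / 4) (by linarith)).realMoment_pos
        (by linarith [h3.1]) (by linarith)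
    have p1 := diskWeight_pos (N n) (m n) t
    have hfac : 1 + t / N n ≤ Real.exp t := by
      have := Real.add_one_le_exp t
      have := div_le_self ht.le hN1
      linarith
    have hexp : Real.exp (-t ^ 2 / 4) ≤ 1 := Real.exp_le_one_iff.2 (by nlinarith [sq_nonneg t])
    have hX : Real.exp (-t ^ 2 / 4) * diskWeight (N n) (m n) t
        * realMoment (diskWeight (N n) (m n - a n)) (a n) (t + t ^ 2 / (2 * N n))
        ≤ 1 * (D * Real.exp (-1 * t)) * (D1 * G) := by
      refine mul_le_mul (mul_le_mul hexp b1 p1.le zero_le_one) b3 p2.le (by positivity)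
    have hX2 := pow_le_pow_left₀ (by positivity) hX 2
    rw [Real.norm_eq_abs, diskMassDensity, abs_of_nonneg (by positivity)]
    refine (mul_le_mul hfac hX2 (by positivity) (Real.exp_pos _).le).trans (le_of_eq ?_)
    have : Real.exp (-t) = Real.exp t * (Real.exp (-1 * t)) ^ 2 := by
      rw [← Real.exp_nat_mul, ← Real.exp_add]; congr 1; push_cast; ring
    rw [this]; ring
  · refine (ae_restrict_iff' measurableSet_Ioi).2 (ae_of_all _ fun t ht => ?_)
    have ht : 0 < t := ht
    have t1 : Tendsto (fun n => 1 + t / N n) atTop (𝓝 (1 + 0)) :=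
      (tendsto_const_nhds.div_atTop hN).const_add 1
    have t2 : Tendsto (fun n => t + t ^ 2 / (2 * N n)) atTop (𝓝 (t + 0)) :=
      (tendsto_const_nhds.div_atTop (hN.const_mul_atTop two_pos)).const_add t
    rw [add_zero] at t1 t2
    have t3 := tendsto_realMoment_diskWeight hN hma hd ha t2 (by
      filter_upwards [hN.eventually_gt_atTop 0] with n n1
      positivity)
    have t4 := tendsto_diskWeight hN hm ht.le
    have := t1.mul ((((t4.const_mul (Real.exp (-t ^ 2 / 4))).mul t3)).pow 2)
    rw [one_mul] at this
    exact this

lemma layerProfile_pos (t : ℝ) : 0 < layerProfile t := pcf_pos deltaZero_pos _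

lemma layerMass_pos : 0 < layerMass := by
  have hd := deltaZero_pos
  have hi : IntegrableOn (fun t => (Real.exp (-t ^ 2 / 4) * limitWeight t * layerProfile t) ^ 2)
      (Ioi 0) := by
    set C := Real.exp ((1 + xiZero) ^ 2) * layerProfile 0
    have hC : 0 < C := mul_pos (Real.exp_pos _) (layerProfile_pos 0)
    refine Integrable.mono' (g := fun t => C ^ 2 * Real.exp (-t))
      ((integrableOn_exp_neg_Ioi 0).const_mul _) ?_
      ((ae_restrict_iff' measurableSet_Ioi).2 (ae_of_all _ fun t ht => ?_))
    · have : Continuous layerProfile :=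
        (contDiff_pcf hd).continuous.comp (continuous_id.sub continuous_const)
      have : Continuous limitWeight := by unfold limitWeight; fun_prop
      exact Continuous.aestronglyMeasurable (by fun_prop)
    · have ht : 0 < t := ht
      have h1 := limitWeight_le 1 t
      have h2 : layerProfile t ≤ layerProfile 0 := pcf_antitone hd (by linarith)
      have h3 : Real.exp (-t ^ 2 / 4) ≤ 1 := Real.exp_le_one_iff.2 (by nlinarith [sq_nonneg t])
      have p1 : 0 < limitWeight t := Real.exp_pos _
      have p2 := layerProfile_pos t
      have hX : Real.exp (-t ^ 2 / 4) * limitWeight t * layerProfile t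
          ≤ 1 * (Real.exp ((1 + xiZero) ^ 2) * Real.exp (-1 * t)) * layerProfile 0 :=
        mul_le_mul (mul_le_mul h3 h1 p1.le zero_le_one) h2 p2.le (by positivity)
      have hX2 := pow_le_pow_left₀ (by positivity) hX 2
      rw [Real.norm_eq_abs, abs_of_nonneg (sq_nonneg _)]
      refine hX2.trans ?_
      have e : (1 * (Real.exp ((1 + xiZero) ^ 2) * Real.exp (-1 * t)) * layerProfile 0) ^ 2
          = C ^ 2 * (Real.exp (-1 * t)) ^ 2 := by ring
      rw [e]
      refine mul_le_mul_of_nonneg_left ?_ (sq_nonneg _)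
      rw [← Real.exp_nat_mul, Real.exp_le_exp]
      push_cast; linarith
  rw [layerMass, integral_pos_iff_support_of_nonneg (fun t => sq_nonneg _) hi,
    Measure.restrict_apply' measurableSet_Ioi]
  refine lt_of_lt_of_le ?_ (measure_mono (s := Ioi 0) fun y hy => ⟨?_, hy⟩)
  · simp
  · have p2 := layerProfile_pos y
    have p1 : 0 < limitWeight y := Real.exp_pos _
    simp only [Function.mem_support]
    positivity

/-! ### Watson's lemma, uniform in the half plane. -/

lemma expKernel_one : ExpKernel (fun _ => 1) 0 :=
  ⟨continuousOn_const, fun _ _ => one_pos, 1, one_pos, fun y _ => by simp⟩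

/-- The formula is the Gamma integral for real `σ`; both sides are analytic on the right half plane,
so the identity theorem extends it with the principal branch. -/
lemma laplaceMoment_one {b : ℝ} (hb : 0 < b) {σ : ℂ} (hσ : 0 < σ.re) :
    laplaceMoment (fun _ => 1) b σ = (Real.Gamma b : ℂ) * (1 / σ) ^ (b : ℂ) := by
  have hopen : IsOpen {z : ℂ | 0 < z.re} := isOpen_lt continuous_const Complex.continuous_re
  have h1 : AnalyticOnNhd ℂ (laplaceMoment (fun _ => 1) b) {z : ℂ | 0 < z.re} := by
    have := expKernel_one.differentiableOn_laplaceMoment hb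
    rw [neg_zero] at this
    exact this.analyticOnNhd hopen
  have h2 : AnalyticOnNhd ℂ (fun z : ℂ => (Real.Gamma b : ℂ) * (1 / z) ^ (b : ℂ))
      {z : ℂ | 0 < z.re} := by
    refine DifferentiableOn.analyticOnNhd (fun z hz => ?_) hopen
    have hz : 0 < z.re := hz
    have hz0 : z ≠ 0 := fun h => by simp [h] at hz
    have hs : 1 / z ∈ Complex.slitPlane := by
      left
      rw [one_div, Complex.inv_re]
      exact div_pos hz (Complex.normSq_pos.2 hz0)
    refine (DifferentiableAt.const_mul ?_ _).differentiableWithinAt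
    exact ((differentiableAt_const _).div differentiableAt_id hz0).cpow (differentiableAt_const _) hs
  have hpre : IsPreconnected {z : ℂ | 0 < z.re} := (convex_halfSpace_re_gt 0).isPreconnected
  have heq : ∀ x : ℝ, 0 < x → laplaceMoment (fun _ => 1) b x
      = (Real.Gamma b : ℂ) * (1 / (x : ℂ)) ^ (b : ℂ) := by
    intro x hx
    have h3 := Complex.integral_cpow_mul_exp_neg_mul_Ioi (a := b) (r := x) (by simpa using hb) hx
    rw [← Complex.Gamma_ofReal, mul_comm, ← h3, laplaceMoment]
    refine setIntegral_congr_fun measurableSet_Ioi fun y hy => ?_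
    have hy : 0 < y := hy
    simp only [mul_one]
    rw [Complex.ofReal_cpow hy.le]
    push_cast
    rw [neg_mul]
  refine h1.eqOn_of_preconnected_of_frequently_eq h2 hpre (z₀ := 1) (by simp) ?_ hσ
  have ht : Tendsto (fun x : ℝ => (x : ℂ)) (𝓝[>] 1) (𝓝[≠] 1) := by
    refine tendsto_nhdsWithin_iff.2 ⟨?_, ?_⟩
    · refine Tendsto.mono_left ?_ nhdsWithin_le_nhds
      simpa using (Complex.continuous_ofReal.tendsto 1)
    · filter_upwards [self_mem_nhdsWithin] with x hx
      have hx : 1 < x := hx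
      simp only [mem_compl_iff, mem_singleton_iff]
      exact_mod_cast hx.ne'
  refine ht.frequently (Eventually.frequently ?_)
  filter_upwards [self_mem_nhdsWithin] with x hx
  have hx : 1 < x := hx
  exact heq x (by linarith)

lemma abs_diskWeight_sub_one_le {N M D y : ℝ} (hN : 0 < N) (hy : 0 ≤ y)
    (hD : ∀ x, 0 ≤ x → |diskWeight' N M x| ≤ D) : |diskWeight N M y - 1| ≤ D * y := by
  have := Convex.norm_image_sub_le_of_norm_hasDerivWithin_le (s := Icc 0 y) (C := D)
    (fun x hx => (hasDerivAt_diskWeight hN M hx.1).hasDerivWithinAt) (fun x hx => hD x hx.1)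
    (convex_Icc 0 y) (left_mem_Icc.2 hy) (right_mem_Icc.2 hy)
  simpa [diskWeight_zero, abs_of_nonneg hy] using this

/-- Watson's lemma for the scaled Kummer integral, uniformly in the half plane. -/
lemma laplaceMoment_diskWeight_sub_le (C : ℝ) {l u : ℝ} (hl : 0 < l) (hlu : l ≤ u) (hu : u < 1) :
    ∃ N₀ K : ℝ, 3 ≤ N₀ ∧ 0 < K ∧ ∀ (N c b : ℝ) (σ : ℂ), N₀ ≤ N → |c| ≤ C → l ≤ b → b ≤ u →
      0 < σ.re → ‖laplaceMoment (diskWeight N (N ^ 2 / 2 + xiZero * N + c)) b σ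
        - (Real.Gamma b : ℂ) * (1 / σ) ^ (b : ℂ)‖ ≤ K / ‖σ‖ := by
  obtain ⟨N₀, D, hN₀, hD, hest⟩ := diskWeight_estimates C
  -- A majorant of `G'` independent of `N`, `b` and `σ`, up to a constant. Near `0` it uses `w - 1 =
  -- O(y)` and `b ≥ l > 0`; at infinity `w - 1` is merely bounded, and `b ≤ u < 1` gives
  -- integrability.
  set g0 : ℝ → ℝ := fun y => if y ≤ 1 then y ^ (l - 1) else y ^ (u - 2) with hg0
  have hg0i : IntegrableOn g0 (Ioi 0) := by
    rw [← Ioc_union_Ioi_eq_Ioi (zero_le_one' ℝ)]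
    refine IntegrableOn.union ?_ ?_
    · have h1 : IntegrableOn (fun y : ℝ => y ^ (l - 1)) (Ioc 0 1) := by
        rw [← intervalIntegrable_iff_integrableOn_Ioc_of_le zero_le_one]
        exact intervalIntegral.intervalIntegrable_rpow' (by linarith)
      refine h1.congr_fun (fun y hy => ?_) measurableSet_Ioc
      simp only [hg0, if_pos hy.2]
    · have h1 : IntegrableOn (fun y : ℝ => y ^ (u - 2)) (Ioi 1) :=
        integrableOn_Ioi_rpow_of_lt (by linarith) one_pos
      refine h1.congr_fun (fun y hy => ?_) measurableSet_Ioi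
      have hy : 1 < y := hy
      simp only [hg0, if_neg (not_le.2 hy)]
  have hg0n : ∀ y, 0 < y → 0 ≤ g0 y := fun y hy => by
    simp only [hg0]; split_ifs <;> positivity
  have hI : 0 ≤ ∫ y in Ioi (0 : ℝ), g0 y := setIntegral_nonneg measurableSet_Ioi hg0n
  refine ⟨max N₀ 3, (2 * D + 1) * (∫ y in Ioi (0 : ℝ), g0 y) + 1, le_max_right _ _, by positivity,
    fun N c b σ hN hc hlb hbu hσ => ?_⟩
  have hN' : N₀ ≤ N := (le_max_left _ _).trans hN
  have hN3 : 3 ≤ N := (le_max_right _ _).trans hN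
  have hN0 : 0 < N := by linarith
  have hb : 0 < b := by linarith
  have hb1 : b < 1 := by linarith
  set M := N ^ 2 / 2 + xiZero * N + c
  set w := diskWeight N M
  have hexp1 : ∀ y : ℝ, 0 ≤ y → Real.exp (-1 * y) ≤ 1 := fun y hy =>
    Real.exp_le_one_iff.2 (by linarith)
  have hw' : ∀ y, 0 ≤ y → |diskWeight' N M y| ≤ D := fun y hy =>
    ((hest N c y hN' hc hy).2.2).trans (mul_le_of_le_one_right hD.le (hexp1 y hy))
  have hwy : ∀ y, 0 ≤ y → |w y - 1| ≤ D * y := fun y hy => abs_diskWeight_sub_one_le hN0 hy hw'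
  have hw1 : ∀ y, 0 ≤ y → |w y - 1| ≤ D + 1 := fun y hy => by
    have h1 := ((hest N c y hN' hc hy).1).trans (mul_le_of_le_one_right hD.le (hexp1 y hy))
    have h2 := diskWeight_pos N M y
    rw [abs_le]; constructor
    · linarith
    · have : w y ≤ D := h1
      linarith
  set G : ℝ → ℝ := fun y => y ^ (b - 1) * (w y - 1) with hG
  set G' : ℝ → ℝ := fun y => (b - 1) * y ^ (b - 1 - 1) * (w y - 1)
    + y ^ (b - 1) * diskWeight' N M y with hG'
  have hGd : ∀ y, 0 < y → HasDerivAt G (G' y) y := fun y hy =>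
    (Real.hasDerivAt_rpow_const (Or.inl hy.ne')).mul ((hasDerivAt_diskWeight hN0 M hy.le).sub_const 1)
  have hG'b : ∀ y, 0 < y → |G' y| ≤ (2 * D + 1) * g0 y := by
    intro y hy
    have p1 := Real.rpow_pos_of_pos hy (b - 1)
    have p2 := Real.rpow_pos_of_pos hy (b - 1 - 1)
    have e1 : y ^ (b - 1) = y ^ (b - 1 - 1) * y := by
      rw [← Real.rpow_add_one hy.ne']; ring_nf
    have t1 : |(b - 1) * y ^ (b - 1 - 1) * (w y - 1)| ≤ y ^ (b - 1 - 1) * |w y - 1| := by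
      rw [abs_mul, abs_mul, abs_of_pos p2]
      refine mul_le_mul_of_nonneg_right (mul_le_of_le_one_left p2.le ?_) (abs_nonneg _)
      rw [abs_le]; constructor <;> linarith
    have t2 : |y ^ (b - 1) * diskWeight' N M y| ≤ y ^ (b - 1) * (D * Real.exp (-1 * y)) := by
      rw [abs_mul, abs_of_pos p1]
      exact mul_le_mul_of_nonneg_left (hest N c y hN' hc hy.le).2.2 p1.le
    refine (abs_add_le _ _).trans ((add_le_add t1 t2).trans ?_)
    rcases le_or_gt y 1 with h | h
    · simp only [hg0, if_pos h]
      have a1 : y ^ (b - 1 - 1) * |w y - 1| ≤ D * y ^ (b - 1) := by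
        rw [e1]
        calc _ ≤ y ^ (b - 1 - 1) * (D * y) := mul_le_mul_of_nonneg_left (hwy y hy.le) p2.le
          _ = _ := by ring
      have a2 : y ^ (b - 1) * (D * Real.exp (-1 * y)) ≤ y ^ (b - 1) * D :=
        mul_le_mul_of_nonneg_left (mul_le_of_le_one_right hD.le (hexp1 y hy.le)) p1.le
      have a3 : y ^ (b - 1) ≤ y ^ (l - 1) :=
        Real.rpow_le_rpow_of_exponent_ge hy h (by linarith)
      have a4 := Real.rpow_pos_of_pos hy (l - 1)
      nlinarith
    · simp only [hg0, if_neg (not_le.2 h)]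
      have a1 : y ^ (b - 1 - 1) * |w y - 1| ≤ y ^ (b - 1 - 1) * (D + 1) :=
        mul_le_mul_of_nonneg_left (hw1 y hy.le) p2.le
      have a0 : y * Real.exp (-1 * y) ≤ 1 := by
        rw [neg_one_mul, Real.exp_neg, ← div_eq_mul_inv, div_le_one (Real.exp_pos _)]
        have := Real.add_one_le_exp y
        linarith
      have a2 : y ^ (b - 1) * (D * Real.exp (-1 * y)) ≤ y ^ (b - 1 - 1) * D := by
        rw [e1]
        calc _ = y ^ (b - 1 - 1) * D * (y * Real.exp (-1 * y)) := by ring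
          _ ≤ _ := mul_le_of_le_one_right (by positivity) a0
      have a3 : y ^ (b - 1 - 1) ≤ y ^ (u - 2) :=
        Real.rpow_le_rpow_of_exponent_le h.le (by linarith)
      nlinarith
  have hW := expKernel_diskWeight hN0 M (Λ := 1) (by linarith)
  have iW := hW.integrableOn_complex hb (σ := σ) (by linarith)
  have i1 := expKernel_one.integrableOn_complex hb (σ := σ) (by simpa using hσ)
  set E : ℝ → ℂ := fun y => Complex.exp (-σ * y) with hE
  have hdiff : laplaceMoment w b σ - (Real.Gamma b : ℂ) * (1 / σ) ^ (b : ℂ)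
      = ∫ y in Ioi (0 : ℝ), (G y : ℂ) * E y := by
    rw [← laplaceMoment_one hb hσ, laplaceMoment, laplaceMoment, ← integral_sub iW i1]
    congr 1 with y
    simp only [hG, hE]
    push_cast
    ring
  have iG : IntegrableOn (fun y => (G y : ℂ) * E y) (Ioi 0) := by
    refine (iW.sub i1).congr_fun (fun y _ => ?_) measurableSet_Ioi
    simp only [hG, hE, Pi.sub_apply]
    push_cast
    ring
  have hEn : ∀ y : ℝ, 0 < y → ‖E y‖ ≤ 1 := fun y hy => by
    simp only [hE, Complex.norm_exp]
    refine Real.exp_le_one_iff.2 ?_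
    have := mul_pos hσ hy
    simp
    linarith
  have cG' : ContinuousOn G' (Ioi 0) := by
    have c1 : ∀ s : ℝ, ContinuousOn (fun y : ℝ => y ^ s) (Ioi 0) := fun s y hy =>
      (Real.continuousAt_rpow_const _ _ (Or.inl (ne_of_gt hy))).continuousWithinAt
    have c2 : ContinuousOn w (Ioi 0) := (continuousOn_diskWeight hN0 M).mono Ioi_subset_Ici_self
    have c3 : ContinuousOn (diskWeight' N M) (Ioi 0) := by
      unfold diskWeight'
      refine c2.mul (continuousOn_const.add (continuousOn_const.div (by fun_prop) fun y hy => ?_))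
      have hy : 0 < y := hy
      positivity
    exact ((continuousOn_const.mul (c1 _)).mul (c2.sub continuousOn_const)).add ((c1 _).mul c3)
  have hGEn : ∀ y, 0 < y → ‖(G' y : ℂ) * E y‖ ≤ (2 * D + 1) * g0 y := fun y hy => by
    rw [norm_mul, Complex.norm_real]
    exact (mul_le_of_le_one_right (norm_nonneg _) (hEn y hy)).trans (hG'b y hy)
  have iG' : IntegrableOn (fun y => (G' y : ℂ) * E y) (Ioi 0) := by
    refine Integrable.mono' (hg0i.const_mul (2 * D + 1)) ?_
      ((ae_restrict_iff' measurableSet_Ioi).2 (ae_of_all _ hGEn))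
    exact ((Complex.continuous_ofReal.comp_continuousOn cG').mul
      (Continuous.continuousOn (by simp only [hE]; fun_prop))).aestronglyMeasurable measurableSet_Ioi
  have hG0 : ∀ y, 0 < y → ‖(G y : ℂ) * E y‖ ≤ D * y ^ b := fun y hy => by
    have p1 := Real.rpow_pos_of_pos hy (b - 1)
    have e1 : y ^ b = y ^ (b - 1) * y := by
      rw [← Real.rpow_add_one hy.ne']; ring_nf
    rw [norm_mul, Complex.norm_real]
    refine (mul_le_of_le_one_right (norm_nonneg _) (hEn y hy)).trans ?_
    rw [Real.norm_eq_abs, abs_mul, abs_of_pos p1, e1]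
    calc _ ≤ y ^ (b - 1) * (D * y) := mul_le_mul_of_nonneg_left (hwy y hy.le) p1.le
      _ = _ := by ring
  have hGinf : ∀ y, 0 < y → ‖(G y : ℂ) * E y‖ ≤ (D + 1) * y ^ (-(1 - b)) := fun y hy => by
    have p1 := Real.rpow_pos_of_pos hy (b - 1)
    rw [norm_mul, Complex.norm_real]
    refine (mul_le_of_le_one_right (norm_nonneg _) (hEn y hy)).trans ?_
    rw [Real.norm_eq_abs, abs_mul, abs_of_pos p1, neg_sub, mul_comm]
    exact mul_le_mul_of_nonneg_right (hw1 y hy.le) p1.le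
  have hE0 : (G 0 : ℂ) * E 0 = 0 := by simp [hG, w, diskWeight_zero]
  have hcont : ContinuousWithinAt (fun y => (G y : ℂ) * E y) (Ici 0) 0 := by
    rw [← continuousWithinAt_Ioi_iff_Ici, ContinuousWithinAt, hE0]
    have ht : Tendsto (fun y : ℝ => D * y ^ b) (𝓝[>] 0) (𝓝 0) := by
      have := ((Real.continuousAt_rpow_const 0 b (Or.inr hb.le)).tendsto.const_mul D)
      rw [Real.zero_rpow hb.ne', mul_zero] at this
      exact this.mono_left nhdsWithin_le_nhds
    refine squeeze_zero_norm' ?_ ht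
    filter_upwards [self_mem_nhdsWithin] with y hy using hG0 y hy
  have htop : Tendsto (fun y => (G y : ℂ) * E y) atTop (𝓝 0) := by
    have ht : Tendsto (fun y : ℝ => (D + 1) * y ^ (-(1 - b))) atTop (𝓝 0) := by
      simpa using (tendsto_rpow_neg_atTop (show 0 < 1 - b by linarith)).const_mul (D + 1)
    refine squeeze_zero_norm' ?_ ht
    filter_upwards [eventually_gt_atTop 0] with y hy using hGinf y hy
  have hder : ∀ y ∈ Ioi (0 : ℝ), HasDerivAt (fun y => (G y : ℂ) * E y)
      ((G' y : ℂ) * E y - σ * ((G y : ℂ) * E y)) y := by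
    intro y hy
    have hid : HasDerivAt (fun ρ : ℝ => (ρ : ℂ)) 1 y := Complex.ofRealCLM.hasDerivAt
    have d2 : HasDerivAt E (Complex.exp (-σ * y) * (-σ * 1)) y := (hid.const_mul (-σ)).cexp
    refine ((hGd y hy).ofReal_comp.mul d2).congr_deriv ?_
    simp only [hE]
    ring
  -- One integration by parts gives `σ ∫ G e^(-σ y) = ∫ G' e^(-σ y)`, and `Re σ > 0` enters only
  -- through `|e^(-σ y)| ≤ 1`. Hence the bound is uniform up to the imaginary axis.
  have hIBP := integral_Ioi_of_hasDerivAt_of_tendsto hcont hder (iG'.sub (iG.const_mul σ)) htop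
  rw [integral_sub iG' (iG.const_mul σ), integral_const_mul, hE0, sub_zero] at hIBP
  have hσ0 : σ ≠ 0 := fun h => by simp [h] at hσ
  have hσn : 0 < ‖σ‖ := norm_pos_iff.2 hσ0
  rw [hdiff, le_div_iff₀ hσn, mul_comm, ← norm_mul, ← sub_eq_zero.1 hIBP]
  refine (norm_integral_le_of_norm_le (hg0i.const_mul (2 * D + 1))
    ((ae_restrict_iff' measurableSet_Ioi).2 (ae_of_all _ hGEn))).trans ?_
  rw [integral_const_mul]
  linarith

lemma norm_log_le {z : ℂ} {T : ℝ} (h : |Real.log ‖z‖| ≤ T) : ‖Complex.log z‖ ≤ T + Real.pi := by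
  refine (Complex.norm_le_abs_re_add_abs_im _).trans (add_le_add ?_ ?_)
  · rwa [Complex.log_re]
  · rw [Complex.log_im]; exact Complex.abs_arg_le_pi z

lemma tendsto_log_mul_inv_sqrt {N : ℕ → ℝ} (hN : Tendsto N atTop atTop) (L : ℝ) :
    Tendsto (fun n => (L + Real.log (N n)) * (Real.sqrt (N n))⁻¹) atTop (𝓝 0) := by
  have h1 : Tendsto (fun x : ℝ => Real.log x / x ^ (1 / 2 : ℝ)) atTop (𝓝 0) :=
    (isLittleO_log_rpow_atTop (by norm_num)).tendsto_div_nhds_zero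
  have h2 : Tendsto (fun x : ℝ => L / x ^ (1 / 2 : ℝ)) atTop (𝓝 0) :=
    tendsto_const_nhds.div_atTop (tendsto_rpow_atTop (by norm_num))
  have h3 := (h2.add h1).comp hN
  rw [add_zero] at h3
  refine h3.congr fun n => ?_
  rw [Real.sqrt_eq_rpow, ← div_eq_mul_inv, add_div]
  rfl

/-- Uniform outer asymptotics `F(a, σ) ~ Γ(δ₀) σ^(-δ₀)` for large `σ` in the half plane. -/
lemma laplaceMoment_diskWeight_outer {C L η : ℝ} {N M a : ℕ → ℝ} (hL : 0 < L) (hη : 0 < η)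
    (hN : Tendsto N atTop atTop)
    (hM : ∀ᶠ n in atTop, |M n - N n ^ 2 / 2 - xiZero * N n| ≤ C)
    (ha : ∀ᶠ n in atTop, |a n - deltaZero| ≤ (Real.sqrt (N n))⁻¹) :
    ∃ S : ℝ, 1 ≤ S ∧ ∀ᶠ n in atTop, ∀ σ : ℂ, 0 < σ.re → S ≤ ‖σ‖ → ‖σ‖ ≤ L * N n →
      ‖laplaceMoment (diskWeight (N n) (M n)) (a n) σ
        - (Real.Gamma deltaZero : ℂ) * (1 / σ) ^ (deltaZero : ℂ)‖
        ≤ η * ‖(1 / σ) ^ (deltaZero : ℂ)‖ := by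
  have hd := deltaZero_pos
  have hd2 := deltaZero_lt
  obtain ⟨N₀, K, hN₀, hK, hest⟩ := laplaceMoment_diskWeight_sub_le C
    (l := deltaZero / 2) (u := 3 / 4) (by linarith) (by linarith) (by norm_num)
  have hsq : Tendsto (fun n => (Real.sqrt (N n))⁻¹) atTop (𝓝 0) :=
    tendsto_inv_atTop_zero.comp (Real.tendsto_sqrt_atTop.comp hN)
  have hat : Tendsto a atTop (𝓝 deltaZero) := by
    rw [tendsto_iff_dist_tendsto_zero]
    exact squeeze_zero' (Eventually.of_forall fun n => dist_nonneg) ha hsq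
  have hΓ : Tendsto (fun n => Real.Gamma (a n)) atTop (𝓝 (Real.Gamma deltaZero)) :=
    ((continuousOn_Gamma_Ioi deltaZero hd).continuousAt (Ioi_mem_nhds hd)).tendsto.comp hat
  have hΓ2 : Tendsto (fun n => Real.Gamma (a n) * (2 * ((Real.log L + Real.pi + Real.log (N n))
      * (Real.sqrt (N n))⁻¹))) atTop (𝓝 0) := by
    have := hΓ.mul ((tendsto_log_mul_inv_sqrt hN (Real.log L + Real.pi)).const_mul 2)
    simpa using this
  have hΓ3 : Tendsto (fun n => Real.Gamma (a n) - Real.Gamma deltaZero) atTop (𝓝 0) := by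
    simpa using hΓ.sub_const (Real.Gamma deltaZero)
  have hlog := tendsto_log_mul_inv_sqrt hN (Real.log L + Real.pi)
  -- As `δ₀ < 1/2`, one has `K/|σ| ≤ K |σ|^(-1/2) |σ|^(-δ₀)` for `|σ| ≥ 1`, so the remainder is
  -- within its third of `η` once `√|σ| ≥ 3 K/η`.
  set S := max 1 ((3 * K / η) ^ 2) with hS
  refine ⟨S, le_max_left _ _, ?_⟩
  filter_upwards [hN.eventually_ge_atTop N₀, hM, ha, hat.eventually (Ioo_mem_nhds
      (show deltaZero / 2 < deltaZero by linarith) (show deltaZero < 3 / 4 by linarith)),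
    hΓ2.eventually (gt_mem_nhds (show 0 < η / 3 by positivity)),
    hΓ3.eventually (Ioo_mem_nhds (show -(η / 3) < 0 by linarith) (show 0 < η / 3 by linarith)),
    hlog.eventually (gt_mem_nhds one_pos)] with n n0 n1 n2 n3 n4 n5 n6 σ hσ hS1 hS2
  have hσ0 : σ ≠ 0 := fun h => by simp [h] at hσ
  have hσn : 0 < ‖σ‖ := norm_pos_iff.2 hσ0
  have hσ1 : 1 ≤ ‖σ‖ := (le_max_left _ _).trans hS1
  have hN0 : 0 < N n := by linarith
  set X := (1 / σ) ^ (deltaZero : ℂ) with hX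
  have hXn : ‖X‖ = (‖σ‖ ^ deltaZero)⁻¹ := by
    rw [hX, Complex.norm_cpow_real, norm_div, norm_one, one_div, Real.inv_rpow hσn.le]
  have hpd := Real.rpow_pos_of_pos hσn deltaZero
  have hX0 : 0 < ‖X‖ := by rw [hXn]; positivity
  have t1 : ‖laplaceMoment (diskWeight (N n) (M n)) (a n) σ
      - (Real.Gamma (a n) : ℂ) * (1 / σ) ^ (a n : ℂ)‖ ≤ η / 3 * ‖X‖ := by
    have h1 := hest (N n) (M n - N n ^ 2 / 2 - xiZero * N n) (a n) σ n0 n1 n3.1.le n3.2.le hσ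
    rw [show N n ^ 2 / 2 + xiZero * N n + (M n - N n ^ 2 / 2 - xiZero * N n) = M n by ring] at h1
    refine h1.trans ?_
    have h2 : ‖σ‖ ^ deltaZero ≤ Real.sqrt ‖σ‖ := by
      rw [Real.sqrt_eq_rpow]
      exact Real.rpow_le_rpow_of_exponent_le hσ1 hd2.le
    have h3 : 3 * K / η ≤ Real.sqrt ‖σ‖ :=
      Real.le_sqrt_of_sq_le ((le_max_right _ _).trans hS1)
    have h4 : 0 < Real.sqrt ‖σ‖ := Real.sqrt_pos.2 hσn
    have h5 : Real.sqrt ‖σ‖ * Real.sqrt ‖σ‖ = ‖σ‖ := Real.mul_self_sqrt hσn.le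
    rw [hXn, div_le_iff₀ hσn]
    rw [div_le_iff₀ hη] at h3
    have h6 : K ≤ η / 3 * Real.sqrt ‖σ‖ := by linarith
    have h7 : Real.sqrt ‖σ‖ ≤ (‖σ‖ ^ deltaZero)⁻¹ * ‖σ‖ := by
      rw [inv_mul_eq_div, le_div_iff₀ hpd]
      calc _ ≤ Real.sqrt ‖σ‖ * Real.sqrt ‖σ‖ := mul_le_mul_of_nonneg_left h2 h4.le
        _ = _ := h5
    calc K ≤ η / 3 * Real.sqrt ‖σ‖ := h6
      _ ≤ η / 3 * ((‖σ‖ ^ deltaZero)⁻¹ * ‖σ‖) := mul_le_mul_of_nonneg_left h7 (by positivity)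
      _ = _ := by ring
  have t2 : ‖(Real.Gamma (a n) : ℂ) * ((1 / σ) ^ (a n : ℂ) - X)‖ ≤ η / 3 * ‖X‖ := by
    have hne : (1 / σ) ≠ 0 := one_div_ne_zero hσ0
    have e : (1 / σ) ^ (a n : ℂ) = X * (1 / σ) ^ ((a n : ℂ) - deltaZero) := by
      rw [hX, ← Complex.cpow_add _ _ hne]
      congr 1; ring
    -- Here the rate of convergence of `a` matters: `|log σ|` may be as large as `log N`, and
    -- multiplied by `|a - δ₀| ≤ N^(-1/2)` it still tends to `0`.
    have hlogσ : ‖Complex.log (1 / σ)‖ ≤ Real.log L + Real.pi + Real.log (N n) := by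
      have : |Real.log ‖1 / σ‖| ≤ Real.log (L * N n) := by
        rw [norm_div, norm_one, one_div, Real.log_inv, abs_neg,
          abs_of_nonneg (Real.log_nonneg hσ1)]
        exact Real.log_le_log hσn hS2
      refine (norm_log_le this).trans (le_of_eq ?_)
      rw [Real.log_mul hL.ne' hN0.ne']; ring
    have hz : ‖Complex.log (1 / σ) * ((a n : ℂ) - deltaZero)‖
        ≤ (Real.log L + Real.pi + Real.log (N n)) * (Real.sqrt (N n))⁻¹ := by
      rw [norm_mul]
      refine mul_le_mul hlogσ ?_ (norm_nonneg _) ((norm_nonneg _).trans hlogσ)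
      rw [← Complex.ofReal_sub, Complex.norm_real]; exact n2
    have he : ‖(1 / σ) ^ ((a n : ℂ) - deltaZero) - 1‖
        ≤ 2 * ((Real.log L + Real.pi + Real.log (N n)) * (Real.sqrt (N n))⁻¹) := by
      rw [Complex.cpow_def_of_ne_zero hne]
      refine (Complex.norm_exp_sub_one_le (hz.trans n6.le)).trans ?_
      exact mul_le_mul_of_nonneg_left hz (by norm_num)
    have hG0 : 0 < Real.Gamma (a n) := Real.Gamma_pos_of_pos (by linarith [n3.1])
    rw [e, show X * (1 / σ) ^ ((a n : ℂ) - deltaZero) - X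
      = X * ((1 / σ) ^ ((a n : ℂ) - deltaZero) - 1) by ring, norm_mul, norm_mul, Complex.norm_real,
      Real.norm_eq_abs, abs_of_pos hG0]
    calc _ ≤ Real.Gamma (a n) * (‖X‖ * (2 * ((Real.log L + Real.pi + Real.log (N n))
          * (Real.sqrt (N n))⁻¹))) :=
          mul_le_mul_of_nonneg_left (mul_le_mul_of_nonneg_left he hX0.le) hG0.le
      _ = Real.Gamma (a n) * (2 * ((Real.log L + Real.pi + Real.log (N n))
          * (Real.sqrt (N n))⁻¹)) * ‖X‖ := by ring
      _ ≤ _ := mul_le_mul_of_nonneg_right n4.le hX0.le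
  have t3 : ‖((Real.Gamma (a n) - Real.Gamma deltaZero : ℝ) : ℂ) * X‖ ≤ η / 3 * ‖X‖ := by
    rw [norm_mul, Complex.norm_real]
    exact mul_le_mul_of_nonneg_right (abs_le.2 ⟨n5.1.le, n5.2.le⟩) hX0.le
  have e : laplaceMoment (diskWeight (N n) (M n)) (a n) σ - (Real.Gamma deltaZero : ℂ) * X
      = (laplaceMoment (diskWeight (N n) (M n)) (a n) σ
        - (Real.Gamma (a n) : ℂ) * (1 / σ) ^ (a n : ℂ))
      + (Real.Gamma (a n) : ℂ) * ((1 / σ) ^ (a n : ℂ) - X)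
      + ((Real.Gamma (a n) - Real.Gamma deltaZero : ℝ) : ℂ) * X := by
    push_cast; ring
  rw [e]
  refine (norm_add₃_le).trans ?_
  linarith

/-! ### The holomorphic factor of the ground states and its asymptotics. -/

/-- The holomorphic extension of `r ↦ (N/2) (r²/R² - 1)`. -/
def complexLayerVar (N R : ℝ) (z : ℂ) : ℂ := (N / 2 : ℝ) * (z ^ 2 / (R : ℂ) ^ 2 - 1)

lemma complexLayerVar_ofReal (N R r : ℝ) :
    complexLayerVar N R (r : ℂ) = (layerVar N R r : ℂ) := by
  simp only [complexLayerVar, layerVar]; push_cast; ring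

lemma complexLayerVar_re (N R : ℝ) (z : ℂ) :
    (complexLayerVar N R z).re = N / 2 * ((z ^ 2).re / R ^ 2 - 1) := by
  have : complexLayerVar N R z = ((N / 2 : ℝ) : ℂ) * (z ^ 2 / ((R ^ 2 : ℝ) : ℂ) - 1) := by
    simp [complexLayerVar]
  rw [this, Complex.re_ofReal_mul, Complex.sub_re, Complex.div_ofReal_re, Complex.one_re]

lemma hasDerivAt_complexLayerVar (N R : ℝ) (z : ℂ) :
    HasDerivAt (complexLayerVar N R) ((N / 2 : ℝ) * (2 * z / (R : ℂ) ^ 2)) z := by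
  have := (((hasDerivAt_pow 2 z).div_const ((R : ℂ) ^ 2)).sub_const 1).const_mul ((N / 2 : ℝ) : ℂ)
  refine this.congr_deriv ?_
  simp

lemma hasDerivAt_laplaceMoment_complexLayerVar {N R b : ℝ} (M : ℝ) (hN : 0 < N) (hR : 0 < R)
    (hb : 0 < b) {z : ℂ} (hz : 0 < (z ^ 2).re) :
    HasDerivAt (fun z => laplaceMoment (diskWeight N M) b (complexLayerVar N R z))
      (-laplaceMoment (diskWeight N M) (b + 1) (complexLayerVar N R z)
        * ((N / 2 : ℝ) * (2 * z / (R : ℂ) ^ 2))) z := by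
  have h1 : -(N / 2) < (complexLayerVar N R z).re := by
    rw [complexLayerVar_re]
    have : 0 < N / 2 * ((z ^ 2).re / R ^ 2) := by positivity
    linarith
  obtain ⟨Λ, hΛ1, hΛ2⟩ := exists_between h1
  exact ((expKernel_diskWeight hN M (Λ := -Λ) (by linarith)).hasDerivAt_laplaceMoment hb
    (by linarith)).comp z (hasDerivAt_complexLayerVar N R z)

lemma hasDerivAt_layerProfile (t : ℝ) :
    HasDerivAt layerProfile (-pcf (deltaZero + 1) (t - xiZero)) t := by
  have := (hasDerivAt_pcf deltaZero_pos (t - xiZero)).comp_sub_const t xiZero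
  exact this

lemma contDiff_layerProfile : ContDiff ℝ (⊤ : ℕ∞) layerProfile :=
  (contDiff_pcf deltaZero_pos).comp (contDiff_id.sub contDiff_const)

lemma layerProfile_ode (t : ℝ) :
    -(deriv (deriv layerProfile) t) + 2 * (t - Real.sqrt deGennesConst) * deriv layerProfile t
      + layerProfile t = deGennesConst * layerProfile t := by
  have hd := deltaZero_pos
  have h1 : deriv layerProfile = fun t => -pcf (deltaZero + 1) (t - xiZero) :=
    funext fun t => (hasDerivAt_layerProfile t).deriv
  have h2 : HasDerivAt (fun t => -pcf (deltaZero + 1) (t - xiZero))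
      (pcf (deltaZero + 2) (t - xiZero)) t := by
    have := ((hasDerivAt_pcf (b := deltaZero + 1) (by linarith) (t - xiZero)).comp_sub_const
      t xiZero).neg
    rw [neg_neg, show deltaZero + 1 + 1 = deltaZero + 2 by ring] at this
    exact this
  have h3 := pcf_recurrence hd (t - xiZero)
  rw [h1, h2.deriv, h3, ← one_sub_two_mul_deltaZero]
  change _ + 2 * (t - Real.sqrt _) * _ + layerProfile t = _
  rw [one_sub_two_mul_deltaZero]
  change _ + 2 * (t - xiZero) * _ + layerProfile t = _
  rw [← one_sub_two_mul_deltaZero]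
  simp only [layerProfile]
  ring

/-- The universal constant `K₀`, normalising the boundary layer profile. -/
def layerConst : ℝ := (Real.sqrt (2 * Real.pi * layerMass))⁻¹

lemma layerConst_pos : 0 < layerConst := by
  have := layerMass_pos
  have := Real.pi_pos
  exact inv_pos.2 (Real.sqrt_pos.2 (by positivity))

/-- Explicit form of one momentum ground state. -/
lemma IsMomentumGroundState.exists_eq {B R h N a : ℝ} {m : ℤ} {Φ : ℂ → ℂ} (hh : 0 < h) (hN : 3 ≤ N)
    (hR : 0 < R) (ha : 0 < a) (hm : 0 ≤ m) (hNh : N ^ 2 * h = B * R ^ 2)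
    (hroot : N * realMoment (diskWeight N (m - a)) (a + 1) 0
      = (m - N ^ 2 / 2) * realMoment (diskWeight N (m - a)) a 0)
    (hΦ : IsMomentumGroundState B R h m Φ) :
    ∃ κ : ℂ, κ ≠ 0 ∧ (∀ r θ : ℝ, R ≤ r → Φ ((r : ℂ) * Complex.exp (Complex.I * θ))
        = Complex.exp (Complex.I * (m * θ)) * (κ * (radialSol N R m a r : ℂ))) ∧
      ‖κ‖ ^ 2 * (2 * Real.pi * (R ^ 2 / N * ∫ t in Ioi (0 : ℝ), diskMassDensity N m a t)) = 1 := by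
  obtain ⟨⟨f, hf, hΦf⟩, hnorm⟩ := hΦ
  have hN0 : 0 < N := by linarith
  obtain ⟨κ, hκ, heq⟩ := hf.eq_const_mul hh hN0 hR ha hm hNh (radialSol'_self hR hroot)
  refine ⟨κ, hκ, fun r θ hr => by rw [hΦf r θ hr, heq r hr], ?_⟩
  rw [integral_norm_sq_of_momentum hR hΦf] at hnorm
  rw [← hnorm, ← integral_mul_sq_radialSol hN0 hR]
  have : ∫ r in Ioi R, r * ‖f r‖ ^ 2 = ‖κ‖ ^ 2 * ∫ r in Ioi R, r * radialSol N R m a r ^ 2 := by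
    rw [← integral_const_mul]
    refine setIntegral_congr_fun measurableSet_Ioi fun r hr => ?_
    have hr : R < r := hr
    rw [heq r hr.le, norm_mul, Complex.norm_real, mul_pow, Real.norm_eq_abs, sq_abs]
    ring
  rw [this]
  ring

lemma tendsto_deltaZero_of_abs_le {N a : ℕ → ℝ} (hN : Tendsto N atTop atTop)
    (ha : ∀ᶠ n in atTop, |a n - deltaZero| ≤ (Real.sqrt (N n))⁻¹) :
    Tendsto a atTop (𝓝 deltaZero) := by
  rw [tendsto_iff_dist_tendsto_zero]
  exact squeeze_zero' (Eventually.of_forall fun n => dist_nonneg) ha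
    (tendsto_inv_atTop_zero.comp (Real.tendsto_sqrt_atTop.comp hN))

/-- The holomorphic factor of a ground state: `β` is the normalisation relative to `layerConst`. -/
def extState (N R M a β : ℝ) (z : ℂ) : ℂ :=
  ((β * (layerConst / R * N ^ deltaZero) : ℝ) : ℂ)
    * laplaceMoment (diskWeight N M) a (complexLayerVar N R z)

lemma hasDerivAt_extState {N R a : ℝ} (M β : ℝ) (hN : 0 < N) (hR : 0 < R) (ha : 0 < a) {z : ℂ}
    (hz : 0 < (z ^ 2).re) :
    HasDerivAt (extState N R M a β) (((β * (layerConst / R * N ^ deltaZero) : ℝ) : ℂ)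
      * (-laplaceMoment (diskWeight N M) (a + 1) (complexLayerVar N R z)
        * ((N / 2 : ℝ) * (2 * z / (R : ℂ) ^ 2)))) z :=
  (hasDerivAt_laplaceMoment_complexLayerVar M hN hR ha hz).const_mul _

lemma analyticOnNhd_extState {N R a : ℝ} (M β : ℝ) (hN : 0 < N) (hR : 0 < R) (ha : 0 < a) :
    AnalyticOnNhd ℂ (extState N R M a β) {z : ℂ | 0 < (z ^ 2).re} := by
  refine DifferentiableOn.analyticOnNhd (fun z hz =>
    (hasDerivAt_extState M β hN hR ha hz).differentiableAt.differentiableWithinAt) ?_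
  exact isOpen_lt continuous_const (Complex.continuous_re.comp (continuous_pow 2))

lemma extState_ofReal (N R M a β x : ℝ) :
    extState N R M a β (x : ℂ) = ((β * (layerConst / R * N ^ deltaZero)
      * realMoment (diskWeight N M) a (layerVar N R x) : ℝ) : ℂ) := by
  rw [extState, complexLayerVar_ofReal, laplaceMoment_ofReal]
  push_cast
  rfl

lemma ofReal_mul_cpow {x : ℝ} (hx : 0 < x) {z : ℂ} (hz : z ≠ 0) (w : ℂ) :
    ((x : ℂ) * z) ^ w = (x : ℂ) ^ w * z ^ w := by
  have hx' : (x : ℂ) ≠ 0 := Complex.ofReal_ne_zero.2 hx.ne'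
  rw [Complex.cpow_def_of_ne_zero (mul_ne_zero hx' hz), Complex.cpow_def_of_ne_zero hx',
    Complex.cpow_def_of_ne_zero hz, Complex.log_ofReal_mul hx hz, ← Complex.ofReal_log hx.le,
    add_mul, Complex.exp_add]

/-- The base `2 R²/(z² - R²)` equals `N/σ`, and a positive factor leaves a principal power without
changing the branch. This exhibits the leading term as the Watson term times the amplitude of
`extState`. -/
lemma outerTerm_eq {N R : ℝ} (hN : 0 < N) (hR : 0 < R) (K : ℝ) {z : ℂ}
    (hz : 0 < (complexLayerVar N R z).re) :
    outerTerm K R z = ((K / R * N ^ deltaZero : ℝ) : ℂ)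
      * ((Real.Gamma deltaZero : ℂ) * (1 / complexLayerVar N R z) ^ (deltaZero : ℂ)) := by
  have h0 : complexLayerVar N R z ≠ 0 := fun h => by simp [h] at hz
  have hR' : (R : ℂ) ≠ 0 := Complex.ofReal_ne_zero.2 hR.ne'
  have hN' : (N : ℂ) ≠ 0 := Complex.ofReal_ne_zero.2 hN.ne'
  have e0 : complexLayerVar N R z = N * (z ^ 2 - (R : ℂ) ^ 2) / (2 * (R : ℂ) ^ 2) := by
    rw [complexLayerVar]; push_cast; field_simp
  have h1 : z ^ 2 - (R : ℂ) ^ 2 ≠ 0 := fun h => h0 (by rw [e0, h]; simp)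
  have e : 2 * (R : ℂ) ^ 2 / (z ^ 2 - (R : ℂ) ^ 2) = (N : ℂ) * (1 / complexLayerVar N R z) := by
    rw [e0]; field_simp
  rw [outerTerm, e, ofReal_mul_cpow hN (one_div_ne_zero h0), ← Complex.ofReal_cpow hN.le]
  push_cast
  ring

lemma norm_complexLayerVar {N R : ℝ} (hN : 0 < N) (hR : 0 < R) (z : ℂ) :
    ‖complexLayerVar N R z‖ = N / 2 * (‖z ^ 2 - (R : ℂ) ^ 2‖ / R ^ 2) := by
  have hR' : (R : ℂ) ≠ 0 := Complex.ofReal_ne_zero.2 hR.ne'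
  have : complexLayerVar N R z = ((N / 2 : ℝ) : ℂ) * ((z ^ 2 - (R : ℂ) ^ 2) / (R : ℂ) ^ 2) := by
    rw [complexLayerVar, sub_div, div_self (pow_ne_zero 2 hR')]
  rw [this, norm_mul, norm_div, norm_pow, Complex.norm_real, Complex.norm_real, Real.norm_eq_abs,
    Real.norm_eq_abs, abs_of_pos hR, abs_of_pos (half_pos hN)]

/-- Outer asymptotics of the ground states, uniform away from the boundary layer. -/
lemma extState_outer {C R : ℝ} {N M a β : ℕ → ℝ} (hR : 0 < R) (hN : Tendsto N atTop atTop)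
    (hM : ∀ᶠ n in atTop, |M n - N n ^ 2 / 2 - xiZero * N n| ≤ C)
    (ha : ∀ᶠ n in atTop, |a n - deltaZero| ≤ (Real.sqrt (N n))⁻¹)
    (hβ : Tendsto β atTop (𝓝 1)) {ρ ε : ℝ} (hε : 0 < ε) :
    ∃ S : ℝ, 1 ≤ S ∧ ∀ᶠ n in atTop, ∀ z : ℂ, R ^ 2 < (z ^ 2).re → ‖z‖ ≤ ρ →
      S ≤ ‖complexLayerVar (N n) R z‖ →
        ‖extState (N n) R (M n) (a n) (β n) z - outerTerm layerConst R z‖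
          ≤ ε * ‖outerTerm layerConst R z‖ := by
  have hΓ : 0 < Real.Gamma deltaZero := Real.Gamma_pos_of_pos deltaZero_pos
  set L := ρ ^ 2 / R ^ 2 + 1 with hL
  have hL0 : 0 < L := by positivity
  -- Once `|β| ≤ 2`, the error of the Laplace integral costs at most `ε Γ(δ₀)/2`; the other half of
  -- the budget is for `|β - 1| ≤ ε/2`.
  obtain ⟨S, hS1, hS⟩ := laplaceMoment_diskWeight_outer (η := ε * Real.Gamma deltaZero / 4) hL0
    (by positivity) hN hM ha
  refine ⟨S, hS1, ?_⟩
  have hβ1 : Tendsto (fun n => β n - 1) atTop (𝓝 0) := by simpa using hβ.sub_const 1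
  filter_upwards [hS, hN.eventually_gt_atTop 0, hβ1.eventually (Ioo_mem_nhds
    (show -(min 1 (ε / 2)) < 0 by simp [hε]) (show 0 < min 1 (ε / 2) by simp [hε]))]
    with n h1 hn hβn z hz hzρ hzS
  have hβ2 : |β n - 1| ≤ ε / 2 :=
    abs_le.2 ⟨by linarith [hβn.1, min_le_right 1 (ε / 2)],
      by linarith [hβn.2, min_le_right 1 (ε / 2)]⟩
  have hβ3 : |β n| ≤ 2 := abs_le.2 ⟨by linarith [hβn.1, min_le_left 1 (ε / 2)],
      by linarith [hβn.2, min_le_left 1 (ε / 2)]⟩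
  have hσ : 0 < (complexLayerVar (N n) R z).re := by
    rw [complexLayerVar_re]
    have : 1 < (z ^ 2).re / R ^ 2 := by rwa [one_lt_div (by positivity)]
    exact mul_pos (half_pos hn) (by linarith)
  have hσL : ‖complexLayerVar (N n) R z‖ ≤ L * N n := by
    rw [norm_complexLayerVar hn hR]
    have : ‖z ^ 2 - (R : ℂ) ^ 2‖ ≤ ρ ^ 2 + R ^ 2 := by
      refine (norm_sub_le _ _).trans ?_
      rw [norm_pow, norm_pow, Complex.norm_real, Real.norm_eq_abs, sq_abs]
      gcongr
    have : ‖z ^ 2 - (R : ℂ) ^ 2‖ / R ^ 2 ≤ L := by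
      rw [hL, div_add_one (by positivity)]
      gcongr
    nlinarith
  have h2 := h1 _ hσ hzS hσL
  rw [outerTerm_eq hn hR _ hσ, extState]
  set X := (1 / complexLayerVar (N n) R z) ^ (deltaZero : ℂ)
  set F := laplaceMoment (diskWeight (N n) (M n)) (a n) (complexLayerVar (N n) R z)
  set A := layerConst / R * N n ^ deltaZero
  have hA : 0 < A := by
    have := layerConst_pos
    positivity
  have e : ((β n * A : ℝ) : ℂ) * F - (A : ℂ) * ((Real.Gamma deltaZero : ℂ) * X)
      = (A : ℂ) * ((β n : ℂ) * (F - (Real.Gamma deltaZero : ℂ) * X)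
        + ((β n - 1 : ℝ) : ℂ) * ((Real.Gamma deltaZero : ℂ) * X)) := by
    push_cast; ring
  rw [e, norm_mul, norm_mul (A : ℂ), mul_left_comm ε]
  refine mul_le_mul_of_nonneg_left ((norm_add_le _ _).trans ?_) (norm_nonneg _)
  rw [norm_mul, norm_mul, norm_mul, Complex.norm_real, Complex.norm_real, Complex.norm_real,
    Real.norm_eq_abs, Real.norm_eq_abs, Real.norm_eq_abs, abs_of_pos hΓ]
  have h3 := mul_le_mul hβ3 h2 (norm_nonneg _) two_pos.le
  have h4 := mul_le_mul_of_nonneg_right hβ2 (mul_nonneg hΓ.le (norm_nonneg X))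
  linarith

lemma norm_outerTerm_le {K R d : ℝ} (hK : 0 < K) (hR : 0 < R) (hd : 0 < d) {z : ℂ}
    (hz : R ^ 2 + d ≤ (z ^ 2).re) :
    ‖outerTerm K R z‖ ≤ K * Real.Gamma deltaZero / R * (2 * R ^ 2 / d) ^ deltaZero := by
  have hΓ : 0 < Real.Gamma deltaZero := Real.Gamma_pos_of_pos deltaZero_pos
  have h1 : d ≤ ‖z ^ 2 - (R : ℂ) ^ 2‖ := by
    refine le_trans ?_ (Complex.re_le_norm _)
    rw [Complex.sub_re, ← Complex.ofReal_pow, Complex.ofReal_re]; linarith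
  rw [outerTerm, norm_mul, Complex.norm_real, Real.norm_eq_abs, abs_of_pos (by positivity),
    Complex.norm_cpow_real, norm_div, norm_mul, norm_pow, Complex.norm_real, Real.norm_eq_abs,
    sq_abs, Complex.norm_two]
  refine mul_le_mul_of_nonneg_left ?_ (by positivity)
  refine Real.rpow_le_rpow (by positivity) ?_ deltaZero_pos.le
  gcongr

/-- The ground states stay bounded on compact subsets of the exterior region. -/
lemma extState_bddOn {C R : ℝ} {N M a β : ℕ → ℝ} (hR : 0 < R) (hN : Tendsto N atTop atTop)
    (hM : ∀ᶠ n in atTop, |M n - N n ^ 2 / 2 - xiZero * N n| ≤ C)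
    (ha : ∀ᶠ n in atTop, |a n - deltaZero| ≤ (Real.sqrt (N n))⁻¹)
    (hβ : Tendsto β atTop (𝓝 1)) {K : Set ℂ} (hK : IsCompact K)
    (hKR : K ⊆ {z : ℂ | R ^ 2 < (z ^ 2).re}) :
    ∃ D : ℝ, ∀ᶠ n in atTop, ∀ z ∈ K, ‖extState (N n) R (M n) (a n) (β n) z‖ ≤ D := by
  rcases K.eq_empty_or_nonempty with rfl | hne
  · exact ⟨0, by simp⟩
  obtain ⟨z₀, hz₀, hmin⟩ := hK.exists_isMinOn hne
    (Complex.continuous_re.comp (continuous_pow 2)).continuousOn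
  obtain ⟨ρ, hρ⟩ := hK.isBounded.exists_norm_le
  set d := (z₀ ^ 2).re - R ^ 2 with hd
  have hd0 : 0 < d := sub_pos.2 (hKR hz₀)
  have hle : ∀ z ∈ K, R ^ 2 + d ≤ (z ^ 2).re := fun z hz => by
    have : (z₀ ^ 2).re ≤ (z ^ 2).re := hmin hz
    linarith
  obtain ⟨S, hS1, hS⟩ := extState_outer (ρ := ρ) (ε := 1) hR hN hM ha hβ one_pos
  refine ⟨2 * (layerConst * Real.Gamma deltaZero / R * (2 * R ^ 2 / d) ^ deltaZero), ?_⟩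
  filter_upwards [hS, hN.eventually_gt_atTop 0,
    hN.eventually_ge_atTop (S * (2 * R ^ 2 / d))] with n h1 hn hnS z hz
  have h2 := h1 z (hKR hz) (hρ z hz) (by
    refine le_trans ?_ (Complex.re_le_norm _)
    rw [complexLayerVar_re]
    have h3 : d / R ^ 2 ≤ (z ^ 2).re / R ^ 2 - 1 := by
      rw [div_sub_one (by positivity)]
      have := hle z hz
      gcongr; linarith
    calc S = S * (2 * R ^ 2 / d) / 2 * (d / R ^ 2) := by field_simp
      _ ≤ N n / 2 * ((z ^ 2).re / R ^ 2 - 1) :=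
        mul_le_mul (by linarith) h3 (by positivity) (by positivity))
  have h3 := norm_outerTerm_le layerConst_pos hR hd0 (hle z hz)
  have h4 := norm_le_norm_add_norm_sub (outerTerm layerConst R z)
    (extState (N n) R (M n) (a n) (β n) z)
  rw [one_mul] at h2
  have h5 : ‖extState (N n) R (M n) (a n) (β n) z‖ ≤ ‖outerTerm layerConst R z‖
    + ‖extState (N n) R (M n) (a n) (β n) z - outerTerm layerConst R z‖ := by
    have := norm_add_le (outerTerm layerConst R z)
      (extState (N n) R (M n) (a n) (β n) z - outerTerm layerConst R z)
    rwa [add_sub_cancel] at this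
  linarith

lemma layerVar_layer {N R : ℝ} (hN : 0 < N) (hR : 0 < R) (t : ℝ) :
    layerVar N R (R + t * (R / N)) = t + t ^ 2 / (2 * N) := by
  rw [layerVar]; field_simp; ring

lemma tendsto_realMoment_layer {C b₀ t : ℝ} {N M b : ℕ → ℝ} (hN : Tendsto N atTop atTop)
    (hM : ∀ᶠ n in atTop, |M n - N n ^ 2 / 2 - xiZero * N n| ≤ C) (hb₀ : 0 < b₀)
    (hb : Tendsto b atTop (𝓝 b₀)) (ht : 0 < t) :
    Tendsto (fun n => realMoment (diskWeight (N n) (M n)) (b n) (t + t ^ 2 / (2 * N n))) atTop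
      (𝓝 (pcf b₀ (t - xiZero))) := by
  have t2 : Tendsto (fun n => t + t ^ 2 / (2 * N n)) atTop (𝓝 (t + 0)) :=
    (tendsto_const_nhds.div_atTop (hN.const_mul_atTop two_pos)).const_add t
  rw [add_zero] at t2
  refine tendsto_realMoment_diskWeight hN hM hb₀ hb t2 ?_
  filter_upwards [hN.eventually_gt_atTop 0] with n n1
  positivity

/-- Boundary layer asymptotics of the ground states. -/
lemma extState_layer {C R t : ℝ} {N M a β : ℕ → ℝ} (hR : 0 < R) (hN : Tendsto N atTop atTop)
    (hM : ∀ᶠ n in atTop, |M n - N n ^ 2 / 2 - xiZero * N n| ≤ C)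
    (ha : Tendsto a atTop (𝓝 deltaZero)) (hβ : Tendsto β atTop (𝓝 1)) (ht : 0 < t) :
    (fun n => extState (N n) R (M n) (a n) (β n) ((R + t * (R / N n) : ℝ) : ℂ)) ~[atTop]
      fun n => ((layerConst * layerProfile t / R * N n ^ deltaZero : ℝ) : ℂ) := by
  have hp := layerProfile_pos t
  rw [isEquivalent_iff_exists_eq_mul]
  refine ⟨fun n => ((β n * (realMoment (diskWeight (N n) (M n)) (a n) (t + t ^ 2 / (2 * N n))
    / layerProfile t) : ℝ) : ℂ), ?_, ?_⟩
  · have h1 := hβ.mul ((tendsto_realMoment_layer hN hM deltaZero_pos ha ht).div_const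
      (layerProfile t))
    rw [show pcf deltaZero (t - xiZero) = layerProfile t from rfl, div_self hp.ne', one_mul] at h1
    rw [← Complex.ofReal_one]
    exact (Complex.continuous_ofReal.tendsto _).comp h1
  · filter_upwards [hN.eventually_gt_atTop 0] with n hn
    rw [extState_ofReal, layerVar_layer hn hR, Pi.mul_apply, ← Complex.ofReal_mul]
    congr 1
    field_simp

/-- Boundary layer asymptotics of the derivative of the ground states. -/
lemma deriv_extState_layer {C R t : ℝ} {N M a β : ℕ → ℝ} (hR : 0 < R)
    (hN : Tendsto N atTop atTop)
    (hM : ∀ᶠ n in atTop, |M n - N n ^ 2 / 2 - xiZero * N n| ≤ C)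
    (ha : Tendsto a atTop (𝓝 deltaZero)) (hβ : Tendsto β atTop (𝓝 1)) (ht : 0 < t) :
    (fun n => deriv (extState (N n) R (M n) (a n) (β n)) ((R + t * (R / N n) : ℝ) : ℂ)) ~[atTop]
      fun n => ((layerConst * deriv layerProfile t / R ^ 2 * N n ^ (deltaZero + 1) : ℝ) : ℂ) := by
  have hd := deltaZero_pos
  rw [(hasDerivAt_layerProfile t).deriv]
  set p := pcf (deltaZero + 1) (t - xiZero) with hpdef
  have hp : 0 < p := pcf_pos (by linarith) _
  rw [isEquivalent_iff_exists_eq_mul]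
  refine ⟨fun n => ((β n * (1 + t / N n) * (realMoment (diskWeight (N n) (M n)) (a n + 1)
    (t + t ^ 2 / (2 * N n)) / p) : ℝ) : ℂ), ?_, ?_⟩
  · have t1 : Tendsto (fun n => 1 + t / N n) atTop (𝓝 (1 + 0)) :=
      (tendsto_const_nhds.div_atTop hN).const_add 1
    have h1 := (hβ.mul t1).mul ((tendsto_realMoment_layer hN hM (by linarith) (ha.add_const 1)
      ht).div_const p)
    rw [← hpdef, div_self hp.ne', add_zero, one_mul, one_mul] at h1
    rw [← Complex.ofReal_one]
    exact (Complex.continuous_ofReal.tendsto _).comp h1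
  · filter_upwards [hN.eventually_gt_atTop 0, ha.eventually (lt_mem_nhds hd)] with n hn han
    have hx : 0 < ((((R + t * (R / N n) : ℝ) : ℂ)) ^ 2).re := by
      rw [← Complex.ofReal_pow, Complex.ofReal_re]; positivity
    rw [(hasDerivAt_extState _ _ hn hR han hx).deriv, complexLayerVar_ofReal, laplaceMoment_ofReal,
      layerVar_layer hn hR, Pi.mul_apply, ← Complex.ofReal_mul, Real.rpow_add_one hn.ne']
    set F := realMoment (diskWeight (N n) (M n)) (a n + 1) (t + t ^ 2 / (2 * N n))
    rw [show ((β n * (layerConst / R * N n ^ deltaZero) : ℝ) : ℂ) * (-(F : ℂ) * ((N n / 2 : ℝ)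
      * (2 * ((R + t * (R / N n) : ℝ) : ℂ) / (R : ℂ) ^ 2)))
      = ((β n * (layerConst / R * N n ^ deltaZero) * (-F * (N n / 2
      * (2 * (R + t * (R / N n)) / R ^ 2))) : ℝ) : ℂ) by push_cast; ring]
    congr 1
    field_simp

/-! ### Ground states along the sequence and the conclusion. -/

/-- The large parameter `N = √(B R² / h)` along a sequence of momenta. -/
lemma IsESequence.momentum_bound {B R C₂ e₀ : ℝ} {h : ℕ → ℝ} {m : ℕ → ℤ} (hB : 0 < B) (hR : 0 < R)
    (hs : IsESequence B R C₂ e₀ h m) (s : ℤ) :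
    ∃ N : ℕ → ℝ, Tendsto N atTop atTop ∧ (∀ n, 0 < N n) ∧ (∀ n, N n ^ 2 = B * R ^ 2 / h n) ∧
      ∃ C : ℝ, ∀ᶠ n in atTop, |((m n + s : ℤ) : ℝ) - N n ^ 2 / 2 - xiZero * N n| ≤ C := by
  have hq : ∀ n, 0 < B * R ^ 2 / h n := fun n => by have := hs.pos n; positivity
  refine ⟨fun n => Real.sqrt (B * R ^ 2 / h n), ?_, fun n => Real.sqrt_pos.2 (hq n),
    fun n => Real.sq_sqrt (hq n).le, |C₂| + |e₀| + |(s : ℝ)| + 1, ?_⟩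
  · refine Real.tendsto_sqrt_atTop.comp ?_
    have h1 : Tendsto (fun n => (h n)⁻¹) atTop atTop :=
      tendsto_inv_nhdsGT_zero.comp (tendsto_nhdsWithin_iff.2
        ⟨hs.tendsto_zero, Eventually.of_forall hs.pos⟩)
    simpa only [div_eq_mul_inv] using h1.const_mul_atTop (by positivity : 0 < B * R ^ 2)
  · have h1 := (hs.tendsto_xi.sub_const e₀).abs
    rw [sub_self, abs_zero] at h1
    filter_upwards [h1.eventually (gt_mem_nhds one_pos)] with n hn
    have e1 : Real.sqrt (deGennesConst * B * R ^ 2 / h n)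
        = xiZero * Real.sqrt (B * R ^ 2 / h n) := by
      rw [xiZero, ← Real.sqrt_mul deGennesConst_pos.le]; congr 1; ring
    have e2 : ((m n + s : ℤ) : ℝ) - Real.sqrt (B * R ^ 2 / h n) ^ 2 / 2
        - xiZero * Real.sqrt (B * R ^ 2 / h n)
        = C₂ - e₀ + s - (xiH B R C₂ (h n) - m n - e₀) := by
      rw [xiH, e1, Real.sq_sqrt (hq n).le]
      have := (hs.pos n).ne'
      push_cast
      field_simp
      ring
    rw [e2]
    have := abs_sub (C₂ - e₀ + s) (xiH B R C₂ (h n) - m n - e₀)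
    have := abs_add_le (C₂ - e₀) (s : ℝ)
    have := abs_sub C₂ e₀
    linarith

/-- The ground states along a sequence, up to a phase, with the asymptotics of the parameters. -/
lemma IsESequence.exists_extState {B R C₂ e₀ : ℝ} {h : ℕ → ℝ} {m : ℕ → ℤ} (hB : 0 < B) (hR : 0 < R)
    (hs : IsESequence B R C₂ e₀ h m) (s : ℤ) {Φ : ℕ → ℂ → ℂ}
    (hΦ : ∀ n, IsMomentumGroundState B R (h n) (m n + s) (Φ n)) :
    ∃ (N a β : ℕ → ℝ) (c : ℕ → ℂ) (C : ℝ), Tendsto N atTop atTop ∧ (∀ n, 0 < N n) ∧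
      (∀ n, N n ^ 2 = B * R ^ 2 / h n) ∧
      (∀ᶠ n in atTop, |((m n + s : ℤ) : ℝ) - a n - N n ^ 2 / 2 - xiZero * N n| ≤ C) ∧
      (∀ᶠ n in atTop, |a n - deltaZero| ≤ (Real.sqrt (N n))⁻¹) ∧ Tendsto β atTop (𝓝 1) ∧
      (∀ n, ‖c n‖ = 1) ∧ ∀ᶠ n in atTop, 0 < a n ∧ ∀ r θ : ℝ, R ≤ r →
        c n * Φ n ((r : ℂ) * Complex.exp (Complex.I * θ))
          = Complex.exp (Complex.I * ((m n + s : ℤ) * θ)) *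
            ((β n * (layerConst / R) * Real.sqrt (N n)
              * radialSol (N n) R (m n + s) (a n) r : ℝ) : ℂ) := by
  obtain ⟨N, hN, hN0, hNsq, C, hC⟩ := hs.momentum_bound hB hR s
  obtain ⟨N₀, hN₀, hroot⟩ := exists_neumann_root C
  set M : ℕ → ℤ := fun n => m n + s with hMdef
  -- Nonnegative momentum is required because the decay estimate treats `(r/R)^m` as a natural
  -- power.
  have hM0 : ∀ᶠ n in atTop, 0 ≤ M n := by
    filter_upwards [hC, hN.eventually_ge_atTop 1, hN.eventually_ge_atTop (2 * C)] with n h1 h2 h3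
    have h4 := (abs_le.1 h1).1
    have := xiZero_pos
    have : 0 < xiZero * N n := mul_pos xiZero_pos (hN0 n)
    have : C ≤ N n ^ 2 / 2 := by nlinarith
    have : (0 : ℝ) ≤ (M n : ℝ) := by linarith
    exact_mod_cast this
  have hgood : ∀ᶠ n in atTop, N₀ ≤ N n ∧
      |((M n : ℤ) : ℝ) - N n ^ 2 / 2 - xiZero * N n| ≤ C ∧ 0 ≤ M n := by
    filter_upwards [hN.eventually_ge_atTop N₀, hC, hM0] with n h1 h2 h3 using ⟨h1, h2, h3⟩
  have hex : ∀ n, ∃ (a : ℝ) (κ : ℂ), (N₀ ≤ N n ∧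
      |((M n : ℤ) : ℝ) - N n ^ 2 / 2 - xiZero * N n| ≤ C ∧ 0 ≤ M n) →
      |a - deltaZero| ≤ (Real.sqrt (N n))⁻¹ ∧ deltaZero / 2 ≤ a ∧ a ≤ 3 / 4 ∧ κ ≠ 0 ∧
      (∀ r θ : ℝ, R ≤ r → Φ n ((r : ℂ) * Complex.exp (Complex.I * θ))
        = Complex.exp (Complex.I * (M n * θ)) * (κ * (radialSol (N n) R (M n) a r : ℂ))) ∧
      ‖κ‖ ^ 2 * (2 * Real.pi * (R ^ 2 / N n
        * ∫ t in Ioi (0 : ℝ), diskMassDensity (N n) (M n) a t)) = 1 := fun n => by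
    by_cases hg : N₀ ≤ N n ∧ |((M n : ℤ) : ℝ) - N n ^ 2 / 2 - xiZero * N n| ≤ C ∧ 0 ≤ M n
    · obtain ⟨a, h1, h2, h3, h4⟩ := hroot (N n) (M n) hg.1 hg.2.1
      obtain ⟨κ, h5, h6, h7⟩ := (hΦ n).exists_eq (hs.pos n) (hN₀.trans hg.1) hR
        (by linarith [deltaZero_pos]) hg.2.2
        (by rw [hNsq, div_mul_cancel₀ _ (hs.pos n).ne']) h4
      exact ⟨a, κ, fun _ => ⟨h1, h2, h3, h5, h6, h7⟩⟩
    -- Dummy values for the finitely many `n` outside the asymptotic regime.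
    · exact ⟨0, 0, fun h => absurd h hg⟩
  choose a κ haκ using hex
  have ha : ∀ᶠ n in atTop, |a n - deltaZero| ≤ (Real.sqrt (N n))⁻¹ :=
    hgood.mono fun n hn => (haκ n hn).1
  set I : ℕ → ℝ := fun n => ∫ t in Ioi (0 : ℝ), diskMassDensity (N n) (M n) (a n) t with hIdef
  have hI : Tendsto I atTop (𝓝 layerMass) := tendsto_integral_diskMassDensity hN hC (tendsto_deltaZero_of_abs_le hN ha)
  have hm := layerMass_pos
  -- Normalisation gives `‖κ‖ = √(N/(2π I))/R`. Replacing `I` by its limit produces `layerConst √N /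
  -- R`, and `β` is the resulting ratio, tending to `1`. The phase `conj κ / ‖κ‖` makes the factor
  -- positive, with default `1` when `κ = 0`.
  refine ⟨N, a, fun n => Real.sqrt (layerMass / I n),
    fun n => if κ n = 0 then 1 else (starRingEnd ℂ) (κ n) / ‖κ n‖, C + 1, hN, hN0, hNsq, ?_, ha,
    ?_, fun n => ?_, ?_⟩
  · filter_upwards [hgood] with n hn
    obtain ⟨-, h2, h3, -⟩ := haκ n hn
    have h4 := abs_sub (((M n : ℤ) : ℝ) - N n ^ 2 / 2 - xiZero * N n) (a n)
    have h5 : |a n| ≤ 1 := abs_le.2 ⟨by linarith [deltaZero_pos], by linarith⟩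
    rw [show ((M n : ℤ) : ℝ) - a n - N n ^ 2 / 2 - xiZero * N n
      = ((M n : ℤ) : ℝ) - N n ^ 2 / 2 - xiZero * N n - a n by ring]
    linarith [hn.2.1]
  · have := ((tendsto_const_nhds (x := layerMass)).div hI hm.ne').sqrt
    rwa [div_self hm.ne', Real.sqrt_one] at this
  · simp only
    split_ifs with h0
    · exact norm_one
    · rw [norm_div, RCLike.norm_conj, Complex.norm_real, norm_norm,
        div_self (norm_ne_zero_iff.2 h0)]
  · filter_upwards [hgood, hI.eventually (lt_mem_nhds hm)] with n hn hIn
    obtain ⟨-, h2, -, h3, h4, h5⟩ := haκ n hn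
    refine ⟨by linarith [deltaZero_pos], fun r θ hr => ?_⟩
    have hκ : 0 < ‖κ n‖ := norm_pos_iff.2 h3
    have hpi := Real.pi_pos
    have hNn := hN0 n
    have e1 : ‖κ n‖ = Real.sqrt (layerMass / I n) * (layerConst / R) * Real.sqrt (N n) := by
      refine (sq_eq_sq₀ hκ.le ?_).1 ?_
      · have := layerConst_pos
        positivity
      · rw [mul_pow, mul_pow, div_pow, Real.sq_sqrt hNn.le, Real.sq_sqrt (by positivity),
          layerConst, inv_pow, Real.sq_sqrt (by positivity)]
        change ‖κ n‖ ^ 2 * (2 * Real.pi * (R ^ 2 / N n * I n)) = 1 at h5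
        rw [eq_div_of_mul_eq (by positivity) h5]
        field_simp
    have e2 : (starRingEnd ℂ) (κ n) / ‖κ n‖ * κ n = (‖κ n‖ : ℂ) := by
      rw [div_mul_eq_mul_div, mul_comm, Complex.mul_conj, Complex.normSq_eq_norm_sq]
      have : (‖κ n‖ : ℂ) ≠ 0 := Complex.ofReal_ne_zero.2 hκ.ne'
      push_cast
      field_simp
    have h6 := h4 r θ hr
    simp only [hMdef] at h6
    rw [if_neg h3, h6, ← e1, Complex.ofReal_mul]
    linear_combination (Complex.exp (Complex.I * ((m n + s : ℤ) * θ))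
      * (radialSol (N n) R (m n + s) (a n) r : ℂ)) * e2

end

theorem mainTheorem7 :
    ∃ (K₀ : ℝ) (v : ℝ → ℝ), 0 < K₀ ∧ (∀ t : ℝ, 0 < t → 0 < v t) ∧ ContDiffOn ℝ 2 v (Ioi 0) ∧
      (∀ t : ℝ, 0 < t →
        -(deriv (deriv v) t) + 2 * (t - Real.sqrt deGennesConst) * deriv v t + v t
          = deGennesConst * v t) ∧
      ∀ (B R C₂ e₀ : ℝ), 0 < B → 0 < R → e₀ ∈ Ioc (-(1 / 2) : ℝ) (1 / 2) →
      ∀ (h : ℕ → ℝ) (m : ℕ → ℤ), IsESequence B R C₂ e₀ h m →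
      ∀ s : ℤ, (s = 0 ∨ s = 1) →
      ∀ Φ : ℕ → ℂ → ℂ, (∀ n, IsMomentumGroundState B R (h n) (m n + s) (Φ n)) →
      ∃ (c : ℕ → ℂ) (u : ℕ → ℂ → ℂ),
        (∀ n, ‖c n‖ = 1) ∧
        (∀ᶠ n in atTop,
          (∀ z : ℂ, R ≤ ‖z‖ →
            c n * Φ n z = (((B * R ^ 2 / h n) ^ (deGennesConst / 4) : ℝ) : ℂ)
              * (z / (R : ℂ)) ^ (m n + s)
              * ((Real.exp (-(B / (4 * h n)) * (‖z‖ ^ 2 - R ^ 2)) : ℝ) : ℂ)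
              * u n (‖z‖ : ℂ)) ∧
          AnalyticOnNhd ℂ (u n) {r : ℂ | 0 < (r ^ 2).re} ∧
          (∀ x : ℝ, x ≠ 0 → (u n (x : ℂ)).im = 0)) ∧
        (∀ K : Set ℂ, IsCompact K → K ⊆ {r : ℂ | R ^ 2 < (r ^ 2).re} →
          ∃ C : ℝ, ∀ᶠ n in atTop, ∀ r ∈ K, ‖u n r‖ ≤ C) ∧
        (∀ ρ ε : ℝ, 0 < ρ → 0 < ε → ∃ κ : ℝ, 0 < κ ∧ ∀ᶠ n in atTop, ∀ r : ℂ,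
          R ^ 2 < (r ^ 2).re → ‖r‖ ≤ ρ →
          Real.sqrt (h n) / ‖r ^ 2 - (R : ℂ) ^ 2‖ ≤ κ →
            ‖u n r - outerTerm K₀ R r‖ ≤ ε * ‖outerTerm K₀ R r‖) ∧
        (∀ t : ℝ, 0 < t →
          (fun n => u n (layerPoint B R t (h n))) ~[atTop]
            (fun n => ((K₀ * v t / R
              * (h n / (B * R ^ 2)) ^ ((deGennesConst - 1) / 4) : ℝ) : ℂ))) ∧
        (∀ t : ℝ, 0 < t →
          (fun n => deriv (u n) (layerPoint B R t (h n))) ~[atTop]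
            (fun n => ((K₀ * deriv v t / R ^ 2
              * (h n / (B * R ^ 2)) ^ ((deGennesConst - 3) / 4) : ℝ) : ℂ))) := by
  refine ⟨layerConst, layerProfile, layerConst_pos, fun t _ => layerProfile_pos t,
    (contDiff_infty.1 contDiff_layerProfile 2).contDiffOn,
    fun t _ => layerProfile_ode t, ?_⟩
  intro B R C₂ e₀ hB hR _ h m hs s _ Φ hΦ
  obtain ⟨N, a, β, c, C, hN, hN0, hNsq, hM, ha, hβ, hc, hform⟩ := hs.exists_extState hB hR s hΦ
  have hat := tendsto_deltaZero_of_abs_le hN ha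
  have hNh : ∀ n, Real.sqrt (h n / B) = R / N n := fun n => by
    have := hN0 n
    rw [Real.sqrt_eq_iff_mul_self_eq_of_pos (by positivity)]
    have h1 := hNsq n
    have := hs.pos n
    rw [eq_div_iff this.ne'] at h1
    field_simp
    linarith
  have hinv : ∀ (n : ℕ) (x : ℝ), (h n / (B * R ^ 2)) ^ x = N n ^ (-(2 * x)) := fun n x => by
    have e : h n / (B * R ^ 2) = (N n ^ (2 : ℝ))⁻¹ := by
      rw [Real.rpow_two, hNsq, inv_div]
    rw [e, ← Real.rpow_neg (hN0 n).le, ← Real.rpow_mul (hN0 n).le]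
    congr 1; ring
  refine ⟨c, fun n => extState (N n) R ((m n + s : ℤ) - a n) (a n) (β n), hc, ?_, ?_, ?_, ?_, ?_⟩
  · filter_upwards [hform] with n hn
    have hNn := hN0 n
    refine ⟨fun z hz => ?_, analyticOnNhd_extState _ _ hNn hR hn.1, fun x _ => ?_⟩
    · have e1 : (z : ℂ) = (‖z‖ : ℂ) * Complex.exp (Complex.I * (z.arg : ℂ)) := by
        rw [mul_comm Complex.I]; exact (Complex.norm_mul_exp_arg_mul_I z).symm
      have e2 : (z / (R : ℂ)) ^ (m n + s) = (((‖z‖ / R) ^ (m n + s) : ℝ) : ℂ)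
          * Complex.exp (Complex.I * ((m n + s : ℤ) * (z.arg : ℂ))) := by
        conv_lhs => rw [e1]
        rw [mul_div_right_comm, mul_zpow, ← Complex.exp_int_mul]
        push_cast
        ring_nf
      -- The amplitude `√N` splits according to `1/2 = Θ₀/2 + δ₀`: the first part is the prefactor
      -- in the statement, the second stays in the holomorphic factor.
      have e3 : Real.sqrt (N n) = (B * R ^ 2 / h n) ^ (deGennesConst / 4) * N n ^ deltaZero := by
        rw [← hNsq, ← Real.rpow_two, ← Real.rpow_mul hNn.le, ← Real.rpow_add hNn,
          Real.sqrt_eq_rpow, ← one_sub_two_mul_deltaZero]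
        congr 1; ring
      have e4 : -(B / (4 * h n)) * (‖z‖ ^ 2 - R ^ 2)
          = -(N n ^ 2 / 4) * (‖z‖ ^ 2 / R ^ 2 - 1) := by
        have := (hs.pos n).ne'
        rw [hNsq]; field_simp
      have e5 := hn.2 ‖z‖ z.arg hz
      rw [← e1] at e5
      rw [e5, e2, e4, extState_ofReal, radialSol, radialPre, e3]
      push_cast
      ring
    · rw [extState_ofReal, Complex.ofReal_im]
  · exact fun K hK hKR => extState_bddOn hR hN hM ha hβ hK hKR
  · intro ρ ε _ hε
    obtain ⟨S, hS1, hS⟩ := extState_outer (ρ := ρ) hR hN hM ha hβ hε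
    have hS0 : 0 < S := by linarith
    -- Since `√h = R √B/N` and `|σ| = N |r² - R²|/(2 R²)`, this threshold is exactly the condition
    -- `|σ| ≥ S`.
    refine ⟨Real.sqrt B / (2 * R * S), by positivity, ?_⟩
    filter_upwards [hS] with n hn r hr hrρ hrκ
    refine hn r hr hrρ ?_
    have hd : 0 < ‖r ^ 2 - (R : ℂ) ^ 2‖ := by
      refine lt_of_lt_of_le ?_ (Complex.re_le_norm _)
      rw [Complex.sub_re, ← Complex.ofReal_pow, Complex.ofReal_re]; linarith
    have hsB := Real.sqrt_pos.2 hB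
    have hNn := hN0 n
    have h1 : Real.sqrt (h n) = R / N n * Real.sqrt B := by
      rw [← hNh, Real.sqrt_div (hs.pos n).le, div_mul_cancel₀ _ hsB.ne']
    rw [h1, div_le_div_iff₀ hd (by positivity)] at hrκ
    rw [norm_complexLayerVar hNn hR]
    have h2 : R / N n * Real.sqrt B * (2 * R * S) = Real.sqrt B * (2 * R ^ 2 / N n * S) := by ring
    rw [h2] at hrκ
    have h3 := le_of_mul_le_mul_left hrκ hsB
    calc S = N n / 2 * ((2 * R ^ 2 / N n * S) / R ^ 2) := by field_simp
      _ ≤ _ := by gcongr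
  · intro t ht
    have := extState_layer hR hN hM hat hβ ht
    simp only [layerPoint, hNh, hinv]
    -- Exponents agree because `-2 (Θ₀ - 1)/4 = δ₀`.
    convert this using 6
    rw [← one_sub_two_mul_deltaZero]; ring
  · intro t ht
    have := deriv_extState_layer hR hN hM hat hβ ht
    simp only [layerPoint, hNh, hinv]
    -- Here `-2 (Θ₀ - 3)/4 = δ₀ + 1`: the derivative in `r` costs one further power of `N`.
    convert this using 6
    rw [← one_sub_two_mul_deltaZero]; ring
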